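/- Let $S$ be a finite set of time series, and let $\mathcal V^f = S\times\mathbb Z$ be the set of variables $s_t$ (series $s$ at time $t$), where each variable $v$ takes values in a countable discrete set $\Omega_v$ with at least two elements. **Graphs.** A *full time causal graph* (FTCG) is a directed acyclic graph on $\mathcal V^f$ without edges that go backward in time (variables may have infinitely many parents). A directed graph $\mathcal G^s$ on $S$ (cycles and self-loops allowed) is the *summary causal graph* (SCG) of an FTCG $\mathcal G^f$ if, for all $a,b\in S$: $a\to b$ in $\mathcal G^s$ if and only if $a_{t-\gamma}\to b_t$ in $\mathcal G^f$ for some $t\in\mathbb Z$ and $\gamma\ge 0$. Then $\mathcal G^f$ is a *candidate FTCG* of $\mathcal G^s$; $\mathcal C(\mathcal G^s)$ is the set of all of them. **Criterion.** A path is a sequence of distinct vertices, each joined to the next one by an edge in either direction; it is *causal* if all edges point towards its last vertex. A path from $\mathbf X$ to $\mathbf Y$ is *proper* if only its first vertex is in $\mathbf X$. $\mathbf Z$ *blocks* a path if a non-collider of the path is in $\mathbf Z$, or if some collider of the path has no descendant in $\mathbf Z$ (a vertex is a descendant of itself). $\mathbf Z$ satisfies the *adjustment criterion* relative to $\mathbf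 X$ and $\mathbf Y$ in $\mathcal G^f$ if (1) $\mathbf Z$ contains no descendant of any $W\notin\mathbf X$ on a proper causal path from $\mathbf X$ to $\mathbf Y$, and (2) $\mathbf Z$ blocks all proper non-causal paths from $\mathbf X$ to $\mathbf Y$. $\mathbf Z$ satisfies the *common adjustment criterion* relative to $\mathbf X$ and $\mathbf Y$ in $\mathcal G^s$ if it satisfies the adjustment criterion in every $\mathcal G^f\in\mathcal C(\mathcal G^s)$. **Distributions.** A probability distribution $P$ on $\prod_v\Omega_v$ is *compatible* with an FTCG $\mathcal G^f$, with conditional distributions $P(v\mid \mathrm{pa}(v))$ of the variables given their parents, if (a) for all times $a\le b$, given the variables before time $a$, the joint distribution of the variables at times $a,\dots,b$ is the product of their factors $P(v\mid\mathrm{pa}(v))$, and (b) disjoint sets of variables that are closed under taking parents are independent (for variables with finitely many ancestors, (b) follows from (a)). For finite disjoint $\mathbf X,\mathbf Y$, $P(\mathbf y\mid \mathrm{do}(\mathbf x))$ is given by the truncated factorization: the variables before the earliest time in $\mathbf X\cup\mathbf Y$ keep their distribution, $\mathbf X$ is set to $\mathbf x$, and the other variables are drawn from their factors $P(v\mid\mathrm{pa}(v))$.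 $P$ is compatible with $\mathcal G^s$ if it is compatible with some $\mathcal G^f\in\mathcal C(\mathcal G^s)$. **Proposition.** Let $\mathcal G^s$ be an SCG and let $\mathbf X,\mathbf Y,\mathbf Z\subseteq\mathcal V^f$ be finite and pairwise disjoint. The following are equivalent: (i) $\mathbf Z$ satisfies the common adjustment criterion relative to $\mathbf X$ and $\mathbf Y$ in $\mathcal G^s$; (ii) for every $P$ compatible with $\mathcal G^s$ (with the interventional distribution of any $\mathcal G^f\in\mathcal C(\mathcal G^s)$ and any conditional distributions $P(v\mid \mathrm{pa}(v))$ with which $P$ is compatible), all values $\mathbf y$, and all values $\mathbf x$ for which the right-hand side is defined, i.e. $P(\mathbf x,\mathbf z)>0$ whenever $P(\mathbf z)>0$, $$P(\mathbf y\mid \mathrm{do}(\mathbf x))=\begin{cases}P(\mathbf y\mid\mathbf x) & \text{if }\mathbf Z=\emptyset,\\ \sum_{\mathbf z}P(\mathbf y\mid\mathbf x,\mathbf z)\,P(\mathbf z)&\text{otherwise,}\end{cases}$$ where the sum runs over the values $\mathbf z$ with $P(\mathbf z)>0$. -/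

import Mathlib

open MeasureTheory ProbabilityTheory
open scoped ENNReal

namespace SCGAdjustment

/-! ### Paths, blocking and the adjustment criterion in a directed graph -/

section Graph

variable {V : Type*}

/-- There is a directed path (possibly of length zero) from `u` to `v`. -/
def IsDescendant (G : Digraph V) (u v : V) : Prop :=
  Relation.ReflTransGen G.Adj u v

/-- No directed cycle. -/
def IsAcyclic (G : Digraph V) : Prop :=
  ∀ v, ¬ Relation.TransGen G.Adj v v

/-- A path: a nonempty sequence of distinct vertices, each joined to its successor by an edge, in
either direction. -/
def IsPath (G : Digraph V) (p : List V) : Prop :=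
  p ≠ [] ∧ p.Nodup ∧ p.IsChain (fun u v => G.Adj u v ∨ G.Adj v u)

/-- A causal (directed) path: all edges point towards the last vertex. -/
def IsCausalPath (G : Digraph V) (p : List V) : Prop :=
  IsPath G p ∧ p.IsChain G.Adj

/-- A path that is not causal. -/
def IsNonCausalPath (G : Digraph V) (p : List V) : Prop :=
  IsPath G p ∧ ¬ p.IsChain G.Adj

/-- The sequence `p` leads from `X` to `Y` and only its first vertex is in `X`. -/
def IsProperFromTo (X Y : Set V) (p : List V) : Prop :=
  ∃ (u : V) (q : List V), p = u :: q ∧ u ∈ X ∧ (∀ v ∈ q, v ∉ X) ∧ ∃ v ∈ p.getLast?, v ∈ Y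

/-- `v` is a collider on `p`: the path contains `u → v ← w`. -/
def IsColliderOn (G : Digraph V) (p : List V) (v : V) : Prop :=
  ∃ u w, [u, v, w] <:+: p ∧ G.Adj u v ∧ G.Adj w v

/-- `Z` blocks `p`: a non-collider of `p` is in `Z`, or some collider of `p` has no descendant
in `Z`. -/
def Blocks (G : Digraph V) (Z : Set V) (p : List V) : Prop :=
  (∃ v ∈ p, ¬ IsColliderOn G p v ∧ v ∈ Z) ∨
    ∃ v ∈ p, IsColliderOn G p v ∧ ∀ d, IsDescendant G v d → d ∉ Z

/-- The forbidden set: all descendants of any `w ∉ X` on a proper causal path from `X` to `Y`. -/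
def forbidden (G : Digraph V) (X Y : Set V) : Set V :=
  {d | ∃ w p, IsCausalPath G p ∧ IsProperFromTo X Y p ∧ w ∈ p ∧ w ∉ X ∧ IsDescendant G w d}

/-- The adjustment criterion relative to `X` and `Y` in `G`. -/
def AdjustmentCriterion (G : Digraph V) (X Y Z : Set V) : Prop :=
  forbidden G X Y ∩ Z = ∅ ∧
    ∀ p, IsNonCausalPath G p → IsProperFromTo X Y p → Blocks G Z p

/-- A set of vertices that contains all parents of its elements. -/
def IsAncestral (G : Digraph V) (A : Set V) : Prop :=
  ∀ u v, G.Adj u v → v ∈ A → u ∈ A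

end Graph

/-! ### Full time causal graphs and summary causal graphs -/

section Time

variable {S : Type*}

/-- A full time causal graph on the instances `(s, t)` of the time series `s : S` at times `t : ℤ`:
a directed acyclic graph in which no edge goes backward in time. -/
structure IsFTCG (G : Digraph (S × ℤ)) : Prop where
  acyclic : IsAcyclic G
  forward : ∀ u v, G.Adj u v → u.2 ≤ v.2

/-- `Gs` is the summary causal graph of `Gf`: `a → b` in `Gs` if and only if
`a_{t-γ} → b_t` in `Gf` for some time `t` and some lag `γ ≥ 0`. -/
def IsReducedFrom (Gs : Digraph S) (Gf : Digraph (S × ℤ)) : Prop :=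
  ∀ a b, Gs.Adj a b ↔ ∃ (t : ℤ) (γ : ℕ), Gf.Adj (a, t - γ) (b, t)

/-- The candidate full time causal graphs of a summary causal graph. Every directed graph on `S`
is the summary of at least one full time causal graph (take all the edges `a_{t-1} → b_t`). -/
def candidates (Gs : Digraph S) : Set (Digraph (S × ℤ)) :=
  {Gf | IsFTCG Gf ∧ IsReducedFrom Gs Gf}

/-- The common adjustment criterion relative to `X` and `Y` in `Gs`. -/
def CommonAdjustmentCriterion (Gs : Digraph S) (X Y Z : Set (S × ℤ)) : Prop :=
  ∀ Gf ∈ candidates Gs, AdjustmentCriterion Gf X Y Z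

/-- All variables with times between `a` and `b`. -/
noncomputable def window [Fintype S] (a b : ℤ) : Finset (S × ℤ) :=
  Finset.univ ×ˢ Finset.Icc a b

/-- All variables with times between the earliest and the latest time of a variable in `A`. -/
noncomputable def timeSpan [Fintype S] [DecidableEq S] (A : Finset (S × ℤ)) : Finset (S × ℤ) :=
  A.biUnion fun u => A.biUnion fun v => window u.2 v.2

end Time

/-! ### Compatible distributions and interventions -/

noncomputable section Prob

variable {S : Type*} {Ω : S × ℤ → Type*}

/-- The event that the variables in `A` take the values `a`. -/
def event (A : Finset (S × ℤ)) (a : ∀ v : A, Ω v) : Set (∀ v, Ω v) :=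
  {ω | ∀ v : A, ω v = a v}

/-- The configuration that equals `w` on `F` and `ω` elsewhere. -/
def splice [DecidableEq S] (F : Finset (S × ℤ)) (w : ∀ v : F, Ω v) (ω : ∀ v, Ω v) : ∀ v, Ω v :=
  fun v => if h : v ∈ F then w ⟨v, h⟩ else ω v

variable [∀ v, MeasurableSpace (Ω v)]

/-- A conditional distribution of each variable given the values of its parents in `G`. -/
abbrev Mechanisms (G : Digraph (S × ℤ)) (Ω : S × ℤ → Type*) [∀ v, MeasurableSpace (Ω v)] :=
  ∀ v, Kernel (∀ u : {u // G.Adj u v}, Ω u) (Ω v)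

/-- The product of the factors `κ_v(w_v | pa_v)` over `v ∈ F \ X`. Parents outside `F` have their
values in `ω`. -/
def factorProduct [DecidableEq S] {G : Digraph (S × ℤ)} (κ : Mechanisms G Ω)
    (X F : Finset (S × ℤ)) (w : ∀ v : F, Ω v) (ω : ∀ v, Ω v) : ℝ≥0∞ :=
  ∏ v : F, if (v : S × ℤ) ∈ X then 1 else κ v (fun u => splice F w ω u) {w v}

/-- The joint law `P` is compatible with (Markov relative to) `G`, with the conditional
distributions `κ` of the variables given their parents.

`factorization`: the joint probability of all variables in a window of time, together with any event
`B` of the variables before that window, is the product of the conditional probabilities of the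
variables in the window given their parents.

`indep_of_disjoint`: disjoint ancestral sets are independent. If every variable has finitely many
ancestors, this follows from the factorization. Here time has no beginning, and without this
condition two variables with no common ancestor could depend on each other through a hidden common
cause at time `-∞`: with two series and only the edges `s_{t-1} → s_t`, the law under which
all variables equal one and the same coin toss satisfies `factorization`. -/
structure IsCompatible [Fintype S] [DecidableEq S] (G : Digraph (S × ℤ)) (κ : Mechanisms G Ω)
    (P : Measure (∀ v, Ω v)) : Prop where
  isProbabilityMeasure : IsProbabilityMeasure P
  isMarkovKernel : ∀ v, IsMarkovKernel (κ v)
  factorization : ∀ (a b : ℤ) (B : Set (∀ v, Ω v)),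
    MeasurableSet[cylinderEvents {v : S × ℤ | v.2 < a}] B →
    ∀ w : ∀ v : (window a b : Finset (S × ℤ)), Ω v,
      P (B ∩ event (window a b) w) = ∫⁻ ω in B, factorProduct κ ∅ (window a b) w ω ∂P
  indep_of_disjoint : ∀ A B : Set (S × ℤ), IsAncestral G A → IsAncestral G B → Disjoint A B →
    Indep (cylinderEvents A) (cylinderEvents B) P

/-- The probability `P(y | do(x))`, by the truncated factorization. The variables before the
earliest time in `X ∪ Y` keep their law, the variables in `X` are set to `x`, and all others up to
the latest time in `X ∪ Y` are drawn from their conditional distributions given their parents. -/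
def doProb [Fintype S] [DecidableEq S] {G : Digraph (S × ℤ)} (κ : Mechanisms G Ω)
    (P : Measure (∀ v, Ω v)) (X Y : Finset (S × ℤ)) (x : ∀ v : X, Ω v) (y : ∀ v : Y, Ω v) : ℝ≥0∞ :=
  ∑' w : {w : ∀ v : timeSpan (X ∪ Y), Ω v //
      (∀ (v : timeSpan (X ∪ Y)) (h : (v : S × ℤ) ∈ X), w v = x ⟨v, h⟩) ∧
      (∀ (v : timeSpan (X ∪ Y)) (h : (v : S × ℤ) ∈ Y), w v = y ⟨v, h⟩)},
    ∫⁻ ω, factorProduct κ X (timeSpan (X ∪ Y)) w ω ∂P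

/-- The right-hand side of the adjustment formula: `P(y | x)` if `Z` is empty, and
`∑ z, P(y | x, z) P(z)` otherwise. -/
def adjustedProb [DecidableEq S] (P : Measure (∀ v, Ω v)) (X Y Z : Finset (S × ℤ))
    (x : ∀ v : X, Ω v) (y : ∀ v : Y, Ω v) : ℝ≥0∞ :=
  if Z = ∅ then cond P (event X x) (event Y y)
  else ∑' z : ∀ v : Z, Ω v, cond P (event X x ∩ event Z z) (event Y y) * P (event Z z)

/-- The conditional probabilities `P(y | x, z)` in the adjustment formula are defined: `(x, z)` has
positive probability for each value `z` of positive probability. -/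
def IsAdmissible (P : Measure (∀ v, Ω v)) (X Z : Finset (S × ℤ)) (x : ∀ v : X, Ω v) : Prop :=
  ∀ z : ∀ v : Z, Ω v, P (event Z z) ≠ 0 → P (event X x ∩ event Z z) ≠ 0

end Prob

end SCGAdjustment

/-!
Fix one graph `G` and remove the first edges of all proper causal paths. In the remaining proper
back-door graph, `Z` fails to block a path from `X` to `Y` exactly if there is a chain
`t 0 ∈ Y`, `t 1, …, t k ∈ Z`, `t (k + 1) ∈ X` in which any two successive members have a common
open ancestor: a vertex outside `Z` with directed paths to both on which at most the last vertex
is in `Z`. Hence the adjustment criterion says that `Z` avoids the forbidden set and that there is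
no such chain.

*Sufficiency.* All probabilities in the formula are integrals, over the variables before the window
of time around `X`, `Y` and `Z`, of sums of products of factors. If the parents in `X` through which
proper causal paths enter a variable are fixed at `x`, then these are the products of factors for
the back-door graph. As there is no chain, the open ancestors of the vertices that are linked to `Y`
share no factor with the other ancestors of `X ∪ Y ∪ Z`. So, given `z`, the sum is a product of a
term with `X` and a term with `Y`, and, by the independence of disjoint ancestral sets, so is its
integral. The term with `X` cancels in `P(y | x, z)`.

*Necessity.* The counterexamples are linear models over `ZMod 2` whose noise bits are `1` with
probability `1/4`. If a forbidden vertex is in `Z`, a model that passes on the sum of the bit of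
some `x ∈ X` and of a second noise bit gives `3/4` on the left and at most `1/2` on the right. If
there is a chain, take a shortest one, and let the common ancestors `s i` of `t i` and `t (i + 1)`
be noise bits that are passed on to these two. Then `t 0` has the bit of `s 0`, `t (k + 1)` has that
of `s k`, and the values in `Z` reveal their sum. For `x = 1` at `t (k + 1)` and `y = 1` the formula
has `1/4` on the left and at least `1/2` on the right.
-/

namespace SCGAdjustment

/-! ### Separation by chains of common ancestors -/

section Separation

variable {V : Type*}

/-- An edge that leaves a vertex outside `Z`. These are the steps of the directed paths on which
only the last vertex may be in `Z`. -/
def OpenStep (G : Digraph V) (Z : Set V) (u v : V) : Prop :=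
  G.Adj u v ∧ u ∉ Z

/-- An edge that enters a vertex outside `X`. These are the steps of the directed paths on which
only the first vertex may be in `X`. -/
def AvoidingStep (G : Digraph V) (X : Set V) (u v : V) : Prop :=
  G.Adj u v ∧ v ∉ X

/-- The vertices outside `Z` with a directed path to `t` on which only `t` may be in `Z`. -/
def openAnc (G : Digraph V) (Z : Set V) (t : V) : Set V :=
  {s | s ∉ Z ∧ Relation.ReflTransGen (OpenStep G Z) s t}

/-- The elements of `Y`, and those of `Z` that are joined to `Y` by a sequence of elements of `Z`
of which any two successive ones have a common open ancestor. -/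
inductive Linked (G : Digraph V) (Y Z : Set V) : V → Prop
  | base {t : V} (ht : t ∈ Y) : Linked G Y Z t
  | step {t t' s : V} (ht : Linked G Y Z t) (ht' : t' ∈ Z) (hs : s ∈ openAnc G Z t)
      (hs' : s ∈ openAnc G Z t') : Linked G Y Z t'

/-- Some element of `X` has a common open ancestor with a vertex that is linked to `Y`. In an
acyclic graph this says that `X` and `Y` are not d-separated by `Z`. -/
def IsConnected (G : Digraph V) (X Y Z : Set V) : Prop :=
  ∃ x ∈ X, ∃ t s, Linked G Y Z t ∧ s ∈ openAnc G Z x ∧ s ∈ openAnc G Z t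

/-- A vertex outside `X` from which a directed path that avoids `X` leads to `Y`. -/
def IsCausalNode (G : Digraph V) (X Y : Set V) (v : V) : Prop :=
  v ∉ X ∧ ∃ y ∈ Y, Relation.ReflTransGen (AvoidingStep G X) v y

/-- The proper back-door graph: the first edges of all proper causal paths are removed. -/
def backdoorGraph (G : Digraph V) (X Y : Set V) : Digraph V where
  Adj u v := G.Adj u v ∧ ¬ (u ∈ X ∧ IsCausalNode G X Y v)

/-- No element of `Z` descends from the second vertex of a proper causal path. -/
def AvoidsForbidden (G : Digraph V) (X Y Z : Set V) : Prop :=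
  ∀ u ∈ X, ∀ v, G.Adj u v → IsCausalNode G X Y v → ∀ z ∈ Z, ¬ IsDescendant G v z

/-- The last vertex of the sequence is in `Y`. -/
def EndsIn (Y : Set V) (p : List V) : Prop :=
  ∃ y ∈ p.getLast?, y ∈ Y

/-- The condition for a walk to be open at the vertex `b` between `a` and `c`. -/
def TripleOpen (G : Digraph V) (Z : Set V) (a b c : V) : Prop :=
  (G.Adj a b → G.Adj c b → ∃ z ∈ Z, IsDescendant G b z) ∧ (¬ (G.Adj a b ∧ G.Adj c b) → b ∉ Z)

/-- A walk, with repetitions allowed, that is open given `Z` at each of its inner vertices. -/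
def OpenWalk (G : Digraph V) (Z : Set V) (p : List V) : Prop :=
  p.IsChain (fun u v => G.Adj u v ∨ G.Adj v u) ∧
    ∀ u v w, [u, v, w] <:+: p → TripleOpen G Z u v w

/-- There is an open walk from `v` to `Y` that is trivial or starts with an edge out of `v`, and `v`
is not in `Z`. -/
def WalkOut (G : Digraph V) (Y Z : Set V) (v : V) : Prop :=
  v ∉ Z ∧ ∃ l, OpenWalk G Z (v :: l) ∧ EndsIn Y (v :: l) ∧ ∀ b ∈ l.head?, G.Adj v b

/-- There is an open walk from `v` to `Y` that starts with an edge into `v`. -/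
def WalkIn (G : Digraph V) (Y Z : Set V) (v : V) : Prop :=
  ∃ b l, OpenWalk G Z (v :: b :: l) ∧ EndsIn Y (v :: b :: l) ∧ G.Adj b v

variable {G H : Digraph V} {X Y Z : Set V}

theorem IsAcyclic.asymm (hG : IsAcyclic G) {u v : V} (huv : G.Adj u v) : ¬ G.Adj v u :=
  fun hvu => hG u (.head huv (.single hvu))

theorem IsAcyclic.mono (hG : IsAcyclic G) (hle : H ≤ G) : IsAcyclic H :=
  fun v hv => hG v (Relation.TransGen.mono (fun _ _ huv => hle huv) v v hv)

theorem IsDescendant.mono (hle : H ≤ G) {u v : V} (huv : IsDescendant H u v) :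
    IsDescendant G u v :=
  Relation.ReflTransGen.mono (fun _ _ hab => hle hab) u v huv

theorem backdoorGraph_le : backdoorGraph G X Y ≤ G :=
  fun _ _ huv => huv.1

theorem reflTransGen_of_isChain {R : V → V → Prop} {a b : V} {l : List V}
    (hl : (a :: l).IsChain R) (hb : b ∈ a :: l) : Relation.ReflTransGen R a b := by
  induction l generalizing a with
  | nil => rw [List.mem_singleton.1 hb]
  | cons c l ih =>
    obtain ⟨hac, hl⟩ := List.isChain_cons_cons.1 hl
    rcases List.mem_cons.1 hb with rfl | hb
    · exact .refl
    · exact .head hac (ih hl hb)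

theorem IsAcyclic.nodup_of_isChain (hG : IsAcyclic G) {p : List V} (hp : p.IsChain G.Adj) :
    p.Nodup := by
  have hp : p.IsChain (Relation.TransGen G.Adj) := hp.imp fun _ _ => .single
  refine (List.isChain_iff_pairwise.1 hp).imp ?_
  rintro a _ haa rfl
  exact hG a haa

theorem notMem_of_isChain_avoidingStep {a w : V} {l : List V}
    (hl : (a :: l).IsChain (AvoidingStep G X)) (hw : w ∈ l) : w ∉ X := by
  induction l generalizing a with
  | nil => cases hw
  | cons b l ih =>
    obtain ⟨hab, hl⟩ := List.isChain_cons_cons.1 hl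
    rcases List.mem_cons.1 hw with rfl | hw
    · exact hab.2
    · exact ih hl hw

theorem endsIn_append_cons {l₁ l₂ : List V} {v : V} :
    EndsIn Y (l₁ ++ v :: l₂) ↔ EndsIn Y (v :: l₂) := by
  rw [EndsIn, EndsIn, List.getLast?_append_of_ne_nil _ (List.cons_ne_nil v l₂)]

theorem endsIn_cons_cons {a b : V} {l : List V} : EndsIn Y (a :: b :: l) ↔ EndsIn Y (b :: l) :=
  endsIn_append_cons (l₁ := [a])

theorem endsIn_singleton {a : V} : EndsIn Y [a] ↔ a ∈ Y := by
  simp [EndsIn]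

theorem EndsIn.exists_mem {p : List V} (hp : EndsIn Y p) : ∃ y ∈ p, y ∈ Y :=
  let ⟨y, hyp, hyY⟩ := hp
  ⟨y, List.mem_of_getLast? hyp, hyY⟩

theorem IsCausalNode.exists_properCausalPath (hG : IsAcyclic G) {u v : V} (hu : u ∈ X)
    (huv : G.Adj u v) (hv : IsCausalNode G X Y v) :
    ∃ p, IsCausalPath G p ∧ IsProperFromTo X Y p ∧ v ∈ p := by
  obtain ⟨hvX, y, hy, hvy⟩ := hv
  obtain ⟨l, hl, hlast⟩ := List.exists_isChain_cons_of_relationReflTransGen hvy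
  have hchain : (u :: v :: l).IsChain G.Adj :=
    List.isChain_cons_cons.2 ⟨huv, hl.imp fun _ _ hab => hab.1⟩
  refine ⟨u :: v :: l, ⟨⟨List.cons_ne_nil _ _, hG.nodup_of_isChain hchain,
    hchain.imp fun _ _ => .inl⟩, hchain⟩, ⟨u, v :: l, rfl, hu, ?_, ?_⟩, by simp⟩
  · rintro w (_ | ⟨_, hw⟩)
    exacts [hvX, notMem_of_isChain_avoidingStep hl hw]
  · rw [← EndsIn, endsIn_cons_cons]
    exact ⟨y, by rw [List.getLast?_eq_some_getLast (List.cons_ne_nil v l), hlast]; rfl, hy⟩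

theorem isCausalNode_of_isChain {v : V} {l : List V} (hl : (v :: l).IsChain G.Adj)
    (hX : ∀ w ∈ v :: l, w ∉ X) (hY : EndsIn Y (v :: l)) : IsCausalNode G X Y v :=
  let ⟨y, hyl, hy⟩ := hY.exists_mem
  ⟨hX v List.mem_cons_self, y, hy,
    reflTransGen_of_isChain (hl.imp_of_mem_imp fun _ b _ hb hab => ⟨hab, hX b hb⟩) hyl⟩

theorem exists_isDescendant_of_mem_forbidden {d : V} (hd : d ∈ forbidden G X Y) :
    ∃ u ∈ X, ∃ v, G.Adj u v ∧ IsCausalNode G X Y v ∧ IsDescendant G v d := by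
  obtain ⟨w, p, ⟨-, hchain⟩, ⟨u, q, rfl, hu, hqX, hY⟩, hw, hwX, hwd⟩ := hd
  have hwq : w ∈ q := (List.mem_cons.1 hw).resolve_left fun hwu => hwX (hwu ▸ hu)
  cases q with
  | nil => cases hwq
  | cons v q =>
    obtain ⟨huv, hvq⟩ := List.isChain_cons_cons.1 hchain
    exact ⟨u, hu, v, huv, isCausalNode_of_isChain hvq hqX (endsIn_cons_cons.1 hY),
      (reflTransGen_of_isChain hvq hwq).trans hwd⟩

theorem forbidden_inter_eq_empty_iff (hG : IsAcyclic G) :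
    forbidden G X Y ∩ Z = ∅ ↔ AvoidsForbidden G X Y Z := by
  rw [Set.eq_empty_iff_forall_notMem]
  constructor
  · intro h u hu v huv hv z hz hvz
    obtain ⟨p, hp, hpXY, hvp⟩ := hv.exists_properCausalPath hG hu huv
    exact h z ⟨⟨v, p, hp, hpXY, hvp, hv.1, hvz⟩, hz⟩
  · rintro h d ⟨hd, hdZ⟩
    obtain ⟨u, hu, v, huv, hv, hvd⟩ := exists_isDescendant_of_mem_forbidden hd
    exact h u hu v huv hv d hdZ hvd

theorem AvoidsForbidden.isDescendant_backdoorGraph (h : AvoidsForbidden G X Y Z) {v z : V}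
    (hz : z ∈ Z) (hvz : IsDescendant G v z) : IsDescendant (backdoorGraph G X Y) v z := by
  induction hvz using Relation.ReflTransGen.head_induction_on with
  | refl => exact .refl
  | head hab hbz ih => exact .head ⟨hab, fun hX => h _ hX.1 _ hab hX.2 z hz hbz⟩ ih

theorem openWalk_singleton {v : V} : OpenWalk G Z [v] :=
  ⟨.singleton v, fun _ _ _ h => absurd h.length_le (by simp)⟩

theorem openWalk_cons_cons {a b : V} {l : List V} : OpenWalk G Z (a :: b :: l) ↔
    (G.Adj a b ∨ G.Adj b a) ∧ (∀ c ∈ l.head?, TripleOpen G Z a b c) ∧ OpenWalk G Z (b :: l) := by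
  have hinfix : ∀ u v w, [u, v, w] <:+: a :: b :: l ↔
      (u = a ∧ v = b ∧ l.head? = some w) ∨ [u, v, w] <:+: b :: l := fun u v w => by
    rw [List.infix_cons_iff, List.cons_prefix_cons, List.cons_prefix_cons,
      List.singleton_prefix_iff_head?_eq_some]
  simp only [OpenWalk, List.isChain_cons_cons, hinfix, or_imp, forall_and, Option.mem_def]
  constructor
  · rintro ⟨⟨hab, hl⟩, hopen, hrest⟩
    exact ⟨hab, fun c hc => hopen a b c ⟨rfl, rfl, hc⟩, hl, hrest⟩
  · rintro ⟨hab, hopen, hl, hrest⟩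
    exact ⟨⟨hab, hl⟩, by rintro _ _ w ⟨rfl, rfl, hw⟩; exact hopen w hw, hrest⟩

theorem openWalk_append {l₁ l₂ : List V} {v : V} : OpenWalk G Z (l₁ ++ v :: l₂) ↔
    OpenWalk G Z (l₁ ++ [v]) ∧ OpenWalk G Z (v :: l₂) ∧
      ∀ a ∈ l₁.getLast?, ∀ b ∈ l₂.head?, TripleOpen G Z a v b := by
  induction l₁ with
  | nil => simp [openWalk_singleton]
  | cons a l₁ ih =>
    cases l₁ with
    | nil =>
      simp only [List.cons_append, List.nil_append, openWalk_cons_cons, openWalk_singleton]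
      simp only [List.head?_nil, Option.mem_def, reduceCtorEq, false_implies, implies_true,
        and_true, List.getLast?_singleton, Option.some.injEq, forall_eq']
      tauto
    | cons b l₁ =>
      have hhead : (l₁ ++ v :: l₂).head? = (l₁ ++ [v]).head? := by cases l₁ <;> rfl
      simp only [List.cons_append] at ih ⊢
      rw [openWalk_cons_cons, ih, openWalk_cons_cons, List.getLast?_cons_cons, hhead]
      tauto

theorem OpenWalk.descendant_or_isChain {v w : V} {l : List V} (h : OpenWalk G Z (v :: w :: l))
    (hvw : G.Adj v w) : (∃ z ∈ Z, IsDescendant G w z) ∨ (v :: w :: l).IsChain G.Adj := by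
  induction l generalizing v w with
  | nil => exact .inr (List.isChain_pair.2 hvw)
  | cons c l ih =>
    obtain ⟨-, hopen, hrest⟩ := openWalk_cons_cons.1 h
    by_cases hcw : G.Adj c w
    · exact .inl ((hopen c rfl).1 hvw hcw)
    · have hwc : G.Adj w c := (openWalk_cons_cons.1 hrest).1.resolve_right hcw
      rcases ih hrest hwc with ⟨z, hz, hcz⟩ | hchain
      · exact .inl ⟨z, hz, .head hwc hcz⟩
      · exact .inr (List.isChain_cons_cons.2 ⟨hvw, hchain⟩)

theorem OpenWalk.remove_loop (hG : IsAcyclic G) {l₁ l₂ l₃ : List V} {v : V}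
    (h : OpenWalk G Z (l₁ ++ v :: (l₂ ++ v :: l₃))) : OpenWalk G Z (l₁ ++ v :: l₃) := by
  obtain ⟨hinit, hloop, hopen₁⟩ := openWalk_append.1 h
  rw [← List.cons_append, openWalk_append, List.cons_append] at hloop
  obtain ⟨hloop, hfinal, hopen₂⟩ := hloop
  obtain ⟨c, m, hcm⟩ : ∃ c m, l₂ ++ [v] = c :: m := List.exists_cons_of_ne_nil (by simp)
  obtain ⟨d, hd⟩ : ∃ d, d ∈ (v :: l₂).getLast? := ⟨_, List.getLast?_eq_some_getLast (by simp)⟩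
  have hc : c ∈ (l₂ ++ v :: l₃).head? := by
    rw [← List.singleton_append, ← List.append_assoc, hcm]
    rfl
  rw [hcm] at hloop
  refine openWalk_append.2 ⟨hinit, hfinal, fun a ha b hb => ⟨fun hav _ => ?_, fun hn => ?_⟩⟩
  · by_cases hcv : G.Adj c v
    · exact (hopen₁ a ha c hc).1 hav hcv
    · -- The loop leaves `v` along an edge out of `v`, so it meets a collider below `v`.
      have hvc : G.Adj v c := (openWalk_cons_cons.1 hloop).1.resolve_right hcv
      rcases hloop.descendant_or_isChain hvc with ⟨z, hz, hcz⟩ | hchain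
      · exact ⟨z, hz, .head hvc hcz⟩
      · have hnodup := hG.nodup_of_isChain hchain
        rw [← hcm] at hnodup
        exact absurd (by simp) (List.nodup_cons.1 hnodup).1
  · by_cases hav : G.Adj a v
    · exact (hopen₂ d hd b hb).2 fun h' => hn ⟨hav, h'.2⟩
    · exact (hopen₁ a ha c hc).2 fun h' => hav h'.1

theorem exists_eq_append_of_not_nodup {p : List V} (h : ¬ p.Nodup) :
    ∃ l₁ v l₂ l₃, p = l₁ ++ v :: (l₂ ++ v :: l₃) := by
  induction p with
  | nil => exact absurd List.nodup_nil h
  | cons a p ih =>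
    by_cases ha : a ∈ p
    · obtain ⟨s, t, rfl⟩ := List.append_of_mem ha
      exact ⟨[], a, s, t, rfl⟩
    · obtain ⟨l₁, v, l₂, l₃, rfl⟩ := ih fun hp => h (List.nodup_cons.2 ⟨ha, hp⟩)
      exact ⟨a :: l₁, v, l₂, l₃, rfl⟩

theorem OpenWalk.exists_nodup (hG : IsAcyclic G) {x : V} (hx : x ∈ X) {l : List V}
    (hl : OpenWalk G Z (x :: l)) (hY : EndsIn Y (x :: l)) :
    ∃ p, OpenWalk G Z p ∧ p.Nodup ∧ IsProperFromTo X Y p := by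
  induction hn : l.length using Nat.strong_induction_on generalizing x l with
  | _ n ih =>
    subst hn
    by_cases hnodup : (x :: l).Nodup
    · by_cases hlX : ∀ v ∈ l, v ∉ X
      · exact ⟨x :: l, hl, hnodup, x, l, rfl, hx, hlX, hY⟩
      · push Not at hlX
        obtain ⟨v, hv, hvX⟩ := hlX
        obtain ⟨s, t, rfl⟩ := List.append_of_mem hv
        rw [← List.cons_append] at hl hY
        exact ih t.length (by simp only [List.length_append, List.length_cons]; omega) hvX
          (openWalk_append.1 hl).2.1 (endsIn_append_cons.1 hY) rfl
    · obtain ⟨l₁, v, l₂, l₃, heq⟩ := exists_eq_append_of_not_nodup hnodup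
      obtain ⟨l', hl'⟩ : ∃ l', l₁ ++ v :: l₃ = x :: l' := by
        cases l₁ with
        | nil => exact ⟨l₃, by rw [(List.cons.inj heq).1]; rfl⟩
        | cons a l₁ => exact ⟨l₁ ++ v :: l₃, by rw [(List.cons.inj heq).1]; rfl⟩
      have hlen := congrArg List.length heq
      have hlen' := congrArg List.length hl'
      simp only [List.length_append, List.length_cons] at hlen hlen'
      rw [heq] at hl hY
      refine ih l'.length (by omega) hx (hl' ▸ hl.remove_loop hG) ?_ rfl
      rw [← hl']
      rw [endsIn_append_cons, ← List.cons_append, endsIn_append_cons] at hY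
      exact endsIn_append_cons.2 hY

theorem OpenWalk.of_adj_iff {p : List V} (hp : OpenWalk G Z p)
    (hadj : ∀ u v, [u, v] <:+: p → (G.Adj u v ↔ H.Adj u v) ∧ (G.Adj v u ↔ H.Adj v u))
    (hdesc : ∀ v, ∀ z ∈ Z, IsDescendant G v z → IsDescendant H v z) : OpenWalk H Z p := by
  refine ⟨?_, fun u v w huvw => ?_⟩
  · exact (List.isChain_isInfix p).imp fun u v huv =>
      (List.isChain_pair.1 (hp.1.infix huv)).imp (hadj u v huv).1.1 (hadj u v huv).2.1
  · have huv := (hadj u v (.trans ⟨[], [w], rfl⟩ huvw)).1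
    have hwv := (hadj v w (.trans ⟨[u], [], rfl⟩ huvw)).2
    have hopen := hp.2 u v w huvw
    rw [TripleOpen, huv, hwv] at hopen
    refine ⟨fun h h' => ?_, hopen.2⟩
    obtain ⟨z, hz, hvz⟩ := hopen.1 h h'
    exact ⟨z, hz, hdesc v z hz hvz⟩

theorem OpenWalk.mono (hG : IsAcyclic G) (hle : H ≤ G) {p : List V} (hp : OpenWalk H Z p) :
    OpenWalk G Z p := by
  refine hp.of_adj_iff (fun u v huv => ?_) fun v z _ => IsDescendant.mono hle
  rcases List.isChain_pair.1 (hp.1.infix huv) with h | h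
  · have hvu : ¬ G.Adj v u := hG.asymm (hle h)
    exact ⟨iff_of_true h (hle h), iff_of_false (fun h' => hvu (hle h')) hvu⟩
  · have huv : ¬ G.Adj u v := hG.asymm (hle h)
    exact ⟨iff_of_false (fun h' => huv (hle h')) huv, iff_of_true h (hle h)⟩

theorem IsProperFromTo.of_pair_infix {p : List V} (hp : IsProperFromTo X Y p) {a b : V}
    (hab : [a, b] <:+: p) : b ∉ X ∧ (a ∈ X → ∃ l, p = a :: b :: l) := by
  obtain ⟨u, q, rfl, -, hq, -⟩ := hp
  rw [List.infix_cons_iff, List.cons_prefix_cons, List.singleton_prefix_iff_head?_eq_some] at hab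
  rcases hab with ⟨rfl, hb⟩ | hab
  · obtain ⟨l, rfl⟩ := List.head?_eq_some_iff.1 hb
    exact ⟨hq b List.mem_cons_self, fun _ => ⟨l, rfl⟩⟩
  · exact ⟨hq b (hab.subset (by simp)), fun ha => absurd ha (hq a (hab.subset (by simp)))⟩

theorem IsProperFromTo.exists_eq_cons_cons (hXY : Disjoint X Y) {p : List V}
    (hp : IsProperFromTo X Y p) :
    ∃ u v l, p = u :: v :: l ∧ u ∈ X ∧ (∀ w ∈ v :: l, w ∉ X) ∧ EndsIn Y (v :: l) := by
  obtain ⟨u, _ | ⟨v, l⟩, rfl, hu, hX, hY⟩ := hp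
  · exact absurd (endsIn_singleton.1 hY) (Set.disjoint_left.1 hXY hu)
  · exact ⟨u, v, l, rfl, hu, hX, endsIn_cons_cons.1 hY⟩

theorem not_isChain_of_openWalk_backdoorGraph (hG : IsAcyclic G) (hXY : Disjoint X Y) {p : List V}
    (hp : IsProperFromTo X Y p) (hopen : OpenWalk (backdoorGraph G X Y) Z p) :
    ¬ p.IsChain G.Adj := by
  intro hcausal
  obtain ⟨u, v, l, rfl, hu, hX, hY⟩ := hp.exists_eq_cons_cons hXY
  obtain ⟨huv, hvl⟩ := List.isChain_cons_cons.1 hcausal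
  rcases (List.isChain_cons_cons.1 hopen.1).1 with h | h
  · exact h.2 ⟨hu, isCausalNode_of_isChain hvl hX hY⟩
  · exact hG.asymm huv h.1

theorem AvoidsForbidden.openWalk_backdoorGraph (hF : AvoidsForbidden G X Y Z) {p : List V}
    (hp : IsProperFromTo X Y p) (hopen : OpenWalk G Z p) (hnc : ¬ p.IsChain G.Adj) :
    OpenWalk (backdoorGraph G X Y) Z p := by
  refine hopen.of_adj_iff (fun a b hab => ?_) fun v z => hF.isDescendant_backdoorGraph
  obtain ⟨hbX, haX⟩ := hp.of_pair_infix hab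
  refine ⟨⟨fun h => ⟨h, ?_⟩, fun h => h.1⟩, fun h => ⟨h, fun h' => hbX h'.1⟩, fun h => h.1⟩
  rintro ⟨ha, hb⟩
  obtain ⟨l, rfl⟩ := haX ha
  rcases hopen.descendant_or_isChain h with ⟨z, hz, hbz⟩ | hcausal
  exacts [hF a ha b h hb z hz hbz, hnc hcausal]

theorem AvoidsForbidden.openWalk_backdoorGraph_iff (hF : AvoidsForbidden G X Y Z)
    (hG : IsAcyclic G) (hXY : Disjoint X Y) {p : List V} (hp : IsProperFromTo X Y p) :
    OpenWalk (backdoorGraph G X Y) Z p ↔ OpenWalk G Z p ∧ ¬ p.IsChain G.Adj :=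
  ⟨fun h => ⟨h.mono hG backdoorGraph_le, not_isChain_of_openWalk_backdoorGraph hG hXY hp h⟩,
    fun h => hF.openWalk_backdoorGraph hp h.1 h.2⟩

theorem WalkOut.parent (hG : IsAcyclic G) {u v : V} (hv : WalkOut G Y Z v)
    (huv : OpenStep G Z u v) : WalkOut G Y Z u := by
  obtain ⟨hvZ, l, hl, hY, hout⟩ := hv
  refine ⟨huv.2, v :: l, openWalk_cons_cons.2 ⟨.inl huv.1, fun c hc => ⟨fun _ hcv => ?_,
    fun _ => hvZ⟩, hl⟩, endsIn_cons_cons.2 hY, by simpa using huv.1⟩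
  exact absurd (hout c hc) (hG.asymm hcv)

theorem WalkOut.child (hG : IsAcyclic G) {v w : V} (hv : WalkOut G Y Z v) (hvw : G.Adj v w) :
    WalkIn G Y Z w :=
  let ⟨hvZ, l, hl, hY, _⟩ := hv
  ⟨v, l, openWalk_cons_cons.2 ⟨.inr hvw, fun _ _ => ⟨fun hwv => absurd hvw (hG.asymm hwv),
    fun _ => hvZ⟩, hl⟩, endsIn_cons_cons.2 hY, hvw⟩

theorem WalkIn.child (hG : IsAcyclic G) {v w : V} (hv : WalkIn G Y Z v) (hvw : OpenStep G Z v w) :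
    WalkIn G Y Z w :=
  let ⟨b, l, hl, hY, _⟩ := hv
  ⟨v, b :: l, openWalk_cons_cons.2 ⟨.inr hvw.1, fun _ _ => ⟨fun hwv =>
    absurd hvw.1 (hG.asymm hwv), fun _ => hvw.2⟩, hl⟩, endsIn_cons_cons.2 hY, hvw.1⟩

theorem WalkIn.parent {v u : V} (hv : WalkIn G Y Z v) (hvZ : v ∈ Z) (huv : OpenStep G Z u v) :
    WalkOut G Y Z u := by
  obtain ⟨b, l, hl, hY, hbv⟩ := hv
  refine ⟨huv.2, v :: b :: l, openWalk_cons_cons.2 ⟨.inl huv.1, ?_, hl⟩, endsIn_cons_cons.2 hY,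
    by simpa using huv.1⟩
  rintro _ ⟨rfl⟩
  exact ⟨fun _ _ => ⟨v, hvZ, .refl⟩, fun hn => absurd ⟨huv.1, hbv⟩ hn⟩

theorem walkOut_of_mem_openAnc (hG : IsAcyclic G) {s t : V} (hs : s ∈ openAnc G Z t)
    (ht : WalkOut G Y Z t ∨ t ∈ Z ∧ WalkIn G Y Z t) : WalkOut G Y Z s := by
  obtain ⟨hsZ, hst⟩ := hs
  suffices hs : WalkOut G Y Z s ∨ s ∈ Z ∧ WalkIn G Y Z s from hs.resolve_right fun h => hsZ h.1
  clear hsZ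
  induction hst using Relation.ReflTransGen.head_induction_on with
  | refl => exact ht
  | head hab _ ih =>
    exact .inl (ih.elim (fun h => h.parent hG hab) fun h => h.2.parent h.1 hab)

theorem WalkOut.descend (hG : IsAcyclic G) {s t : V} (hs : WalkOut G Y Z s)
    (hst : Relation.ReflTransGen (OpenStep G Z) s t) : t = s ∨ WalkIn G Y Z t := by
  induction hst with
  | refl => exact .inl rfl
  | tail _ hbc ih =>
    right
    rcases ih with rfl | hb
    exacts [hs.child hG hbc.1, hb.child hG hbc]

theorem Linked.walkOut_or_walkIn (hG : IsAcyclic G) (hYZ : Disjoint Y Z) {t : V}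
    (ht : Linked G Y Z t) : WalkOut G Y Z t ∨ t ∈ Z ∧ WalkIn G Y Z t := by
  induction ht with
  | @base t ht =>
    exact .inl ⟨Set.disjoint_left.1 hYZ ht, [], openWalk_singleton, endsIn_singleton.2 ht, by simp⟩
  | step _ ht' hs hs' ih =>
    rcases (walkOut_of_mem_openAnc hG hs ih).descend hG hs'.2 with rfl | h
    exacts [absurd ht' hs.1, .inr ⟨ht', h⟩]

theorem IsConnected.exists_openWalk (hG : IsAcyclic G) (hYZ : Disjoint Y Z)
    (h : IsConnected G X Y Z) : ∃ x ∈ X, ∃ l, OpenWalk G Z (x :: l) ∧ EndsIn Y (x :: l) := by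
  obtain ⟨x, hx, t, s, ht, hsx, hst⟩ := h
  have hs := walkOut_of_mem_openAnc hG hst (ht.walkOut_or_walkIn hG hYZ)
  rcases hs.descend hG hsx.2 with rfl | ⟨b, l, hl, hY, -⟩
  · obtain ⟨-, l, hl, hY, -⟩ := hs
    exact ⟨_, hx, l, hl, hY⟩
  · exact ⟨x, hx, b :: l, hl, hY⟩

theorem self_mem_openAnc {v : V} (hv : v ∉ Z) : v ∈ openAnc G Z v :=
  ⟨hv, .refl⟩

theorem mem_openAnc_of_openStep {u v t : V} (huv : OpenStep G Z u v)
    (hvt : Relation.ReflTransGen (OpenStep G Z) v t) : u ∈ openAnc G Z t :=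
  ⟨huv.2, .head huv hvt⟩

theorem exists_reflTransGen_openStep {T : Set V} (hZT : Z ⊆ T) {v z : V} (hz : z ∈ T)
    (hvz : IsDescendant G v z) : ∃ t ∈ T, Relation.ReflTransGen (OpenStep G Z) v t := by
  induction hvz using Relation.ReflTransGen.head_induction_on with
  | refl => exact ⟨z, hz, .refl⟩
  | @head a b hab _ ih =>
    by_cases ha : a ∈ Z
    · exact ⟨a, hZT ha, .refl⟩
    · obtain ⟨t, ht, hbt⟩ := ih
      exact ⟨t, ht, .head ⟨hab, ha⟩ hbt⟩

theorem OpenWalk.exists_linked (hG : IsAcyclic G) (hYZ : Disjoint Y Z) {v w : V} {l : List V}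
    (h : OpenWalk G Z (v :: w :: l)) (hY : EndsIn Y (w :: l)) :
    (G.Adj v w → v ∉ Z → ∃ t, Linked G Y Z t ∧ v ∈ openAnc G Z t) ∧
      (G.Adj w v → ∃ t s, Linked G Y Z t ∧ s ∈ openAnc G Z t ∧ s ∈ openAnc G Z v) := by
  induction l generalizing v w with
  | nil =>
    have hwY : w ∈ Y := endsIn_singleton.1 hY
    have hwZ : w ∉ Z := Set.disjoint_left.1 hYZ hwY
    exact ⟨fun hvw hv => ⟨w, .base hwY, mem_openAnc_of_openStep ⟨hvw, hv⟩ .refl⟩, fun hwv =>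
      ⟨w, w, .base hwY, self_mem_openAnc hwZ, mem_openAnc_of_openStep ⟨hwv, hwZ⟩ .refl⟩⟩
  | cons c l ih =>
    obtain ⟨-, hopen, hrest⟩ := openWalk_cons_cons.1 h
    obtain ⟨hcollider, hwZ⟩ := hopen c rfl
    obtain ⟨ih_out, ih_in⟩ := ih hrest (endsIn_cons_cons.1 hY)
    have hwc := (openWalk_cons_cons.1 hrest).1
    refine ⟨fun hvw hv => ?_, fun hwv => ?_⟩
    · by_cases hcw : G.Adj c w
      · obtain ⟨t, s, ht, hst, hsw⟩ := ih_in hcw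
        obtain ⟨z, hz, hwz⟩ := hcollider hvw hcw
        obtain ⟨z', hz', hwz'⟩ := exists_reflTransGen_openStep subset_rfl hz hwz
        exact ⟨z', .step ht hz' hst ⟨hsw.1, hsw.2.trans hwz'⟩,
          mem_openAnc_of_openStep ⟨hvw, hv⟩ hwz'⟩
      · obtain ⟨t, ht, hwt⟩ := ih_out (hwc.resolve_right hcw) (hwZ fun h => hcw h.2)
        exact ⟨t, ht, mem_openAnc_of_openStep ⟨hvw, hv⟩ hwt.2⟩
    · have hwZ : w ∉ Z := hwZ fun h => hG.asymm hwv h.1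
      rcases hwc with hwc | hcw
      · obtain ⟨t, ht, hwt⟩ := ih_out hwc hwZ
        exact ⟨t, w, ht, hwt, mem_openAnc_of_openStep ⟨hwv, hwZ⟩ .refl⟩
      · obtain ⟨t, s, ht, hst, hsw⟩ := ih_in hcw
        exact ⟨t, s, ht, hst, hsw.1, hsw.2.tail ⟨hwv, hwZ⟩⟩

theorem isConnected_iff_exists_openWalk (hG : IsAcyclic G) (hXY : Disjoint X Y)
    (hXZ : Disjoint X Z) (hYZ : Disjoint Y Z) :
    IsConnected G X Y Z ↔ ∃ p, OpenWalk G Z p ∧ p.Nodup ∧ IsProperFromTo X Y p := by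
  constructor
  · intro h
    obtain ⟨x, hx, l, hl, hY⟩ := h.exists_openWalk hG hYZ
    exact hl.exists_nodup hG hx hY
  · rintro ⟨p, hp, -, hpXY⟩
    obtain ⟨u, v, l, rfl, hu, -, hY⟩ := hpXY.exists_eq_cons_cons hXY
    have huZ : u ∉ Z := Set.disjoint_left.1 hXZ hu
    obtain ⟨hout, hin⟩ := hp.exists_linked hG hYZ hY
    rcases (openWalk_cons_cons.1 hp).1 with huv | hvu
    · obtain ⟨t, ht, hut⟩ := hout huv huZ
      exact ⟨u, hu, t, u, ht, self_mem_openAnc huZ, hut⟩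
    · obtain ⟨t, s, ht, hst, hsu⟩ := hin hvu
      exact ⟨u, hu, t, s, ht, hsu, hst⟩

theorem exists_triple_infix_of_mem {p : List V} {v : V} (hv : v ∈ p) (hhead : v ∉ p.head?)
    (hlast : v ∉ p.getLast?) : ∃ u w, [u, v, w] <:+: p := by
  obtain ⟨s, t, rfl⟩ := List.append_of_mem hv
  rcases List.eq_nil_or_concat s with rfl | ⟨s, u, rfl⟩
  · exact absurd rfl hhead
  · cases t with
    | nil => exact absurd (by simp) hlast
    | cons w t => exact ⟨u, w, s, t, by simp⟩

theorem eq_of_triple_infix {p : List V} (hp : p.Nodup) {u v w u' w' : V} (h : [u, v, w] <:+: p)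
    (h' : [u', v, w'] <:+: p) : u = u' ∧ w = w' := by
  obtain ⟨s, t, rfl⟩ := h
  obtain ⟨s', t', heq⟩ := h'
  have hv : (s ++ [u, v, w] ++ t)[s.length + 1]? = some v := by simp
  have hv' : (s ++ [u, v, w] ++ t)[s'.length + 1]? = some v := by rw [← heq]; simp
  have hlen : s.length = s'.length :=
    Nat.succ_injective ((List.getElem?_inj (by simp) hp).1 (hv.trans hv'.symm))
  have htriple := (List.append_inj (by simpa using heq.symm) hlen).2
  simp only [List.cons.injEq] at htriple
  exact ⟨htriple.1, htriple.2.2.1⟩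

theorem IsPath.blocks_iff_not_openWalk {p : List V} (hp : IsPath G p)
    (hhead : ∀ v ∈ p.head?, v ∉ Z) (hlast : ∀ v ∈ p.getLast?, v ∉ Z) :
    Blocks G Z p ↔ ¬ OpenWalk G Z p := by
  constructor
  · rintro (⟨v, hv, hvc, hvZ⟩ | ⟨v, -, ⟨u, w, huvw, huv, hwv⟩, hd⟩) ⟨-, hopen⟩
    · obtain ⟨u, w, huvw⟩ := exists_triple_infix_of_mem hv (fun h => hhead v h hvZ)
        fun h => hlast v h hvZ
      exact (hopen u v w huvw).2 (fun h => hvc ⟨u, w, huvw, h.1, h.2⟩) hvZ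
    · obtain ⟨z, hz, hvz⟩ := (hopen u v w huvw).1 huv hwv
      exact hd z hvz hz
  · contrapose!
    intro hb
    simp only [Blocks, not_or, not_exists, not_and, not_forall, not_not] at hb
    refine ⟨hp.2.2, fun u v w huvw => ?_⟩
    have hv : v ∈ p := huvw.subset (by simp)
    refine ⟨fun huv hwv => ?_, fun hn => hb.1 v hv ?_⟩
    · obtain ⟨d, hd, hdZ⟩ := hb.2 v hv ⟨u, w, huvw, huv, hwv⟩
      exact ⟨d, hdZ, hd⟩
    · rintro ⟨u', w', huvw', hu', hw'⟩
      obtain ⟨rfl, rfl⟩ := eq_of_triple_infix hp.2.1 huvw huvw'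
      exact hn ⟨hu', hw'⟩

theorem IsPath.blocks_iff_not_openWalk_of_isProperFromTo (hXZ : Disjoint X Z)
    (hYZ : Disjoint Y Z) {p : List V} (hp : IsPath G p) (hpXY : IsProperFromTo X Y p) :
    Blocks G Z p ↔ ¬ OpenWalk G Z p := by
  obtain ⟨u, q, rfl, hu, -, y, hy, hyY⟩ := hpXY
  refine hp.blocks_iff_not_openWalk ?_ fun v hv => ?_
  · rintro _ ⟨rfl⟩
    exact Set.disjoint_left.1 hXZ hu
  · rw [Option.mem_unique hv hy]
    exact Set.disjoint_left.1 hYZ hyY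

theorem adjustmentCriterion_iff (hG : IsAcyclic G) (hXY : Disjoint X Y) (hXZ : Disjoint X Z)
    (hYZ : Disjoint Y Z) : AdjustmentCriterion G X Y Z ↔
      AvoidsForbidden G X Y Z ∧ ¬ IsConnected (backdoorGraph G X Y) X Y Z := by
  rw [AdjustmentCriterion, forbidden_inter_eq_empty_iff hG]
  refine and_congr_right fun hF => ?_
  rw [isConnected_iff_exists_openWalk (hG.mono backdoorGraph_le) hXY hXZ hYZ, not_exists]
  refine forall_congr' fun p => ⟨?_, ?_⟩
  · rintro h ⟨hopen, hnodup, hp⟩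
    obtain ⟨hopen, hnc⟩ := (hF.openWalk_backdoorGraph_iff hG hXY hp).1 hopen
    have hpath : IsPath G p :=
      ⟨hp.elim fun u ⟨q, hq, _⟩ => hq ▸ List.cons_ne_nil u q, hnodup, hopen.1⟩
    exact (hpath.blocks_iff_not_openWalk_of_isProperFromTo hXZ hYZ hp).1 (h ⟨hpath, hnc⟩ hp) hopen
  · rintro h ⟨hpath, hnc⟩ hp
    refine (hpath.blocks_iff_not_openWalk_of_isProperFromTo hXZ hYZ hp).2 fun hopen => ?_
    exact h ⟨(hF.openWalk_backdoorGraph_iff hG hXY hp).2 ⟨hopen, hnc⟩, hpath.2.1, hp⟩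

end Separation

/-! ### Sums over the values of finitely many variables -/

section Marginal

variable {V : Type*}

theorem IsAcyclic.exists_sink {G : Digraph V} (hG : IsAcyclic G) {F : Finset V}
    (hF : F.Nonempty) : ∃ v ∈ F, ∀ u ∈ F, ¬ G.Adj v u := by
  let r : F → F → Prop := fun u v => Relation.TransGen G.Adj v u
  have : IsTrans F r := ⟨fun _ _ _ huv hvw => hvw.trans huv⟩
  have : Std.Irrefl r := ⟨fun v => hG v⟩
  obtain ⟨v, -, hv⟩ := (Finite.wellFounded_of_trans_of_irrefl r).has_min Set.univ
    ⟨⟨hF.choose, hF.choose_spec⟩, trivial⟩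
  exact ⟨v, v.2, fun u hu hvu => hv ⟨u, hu⟩ trivial (.single hvu)⟩

theorem IsAcyclic.exists_source {G : Digraph V} (hG : IsAcyclic G) {F : Finset V}
    (hF : F.Nonempty) : ∃ v ∈ F, ∀ u ∈ F, ¬ G.Adj u v :=
  IsAcyclic.exists_sink (G := ⟨Function.swap G.Adj⟩)
    (fun v hv => hG v (Relation.transGen_swap.1 hv)) hF

variable {Ω : V → Type*}

theorem dependsOn_prod {ι M : Type*} [CommMonoid M] {s : Finset ι} {f : ι → (∀ v, Ω v) → M}
    {A : Set V} (hf : ∀ i ∈ s, DependsOn (f i) A) : DependsOn (fun η => ∏ i ∈ s, f i η) A :=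
  fun _ _ hA => Finset.prod_congr rfl fun i hi => hf i hi hA

theorem dependsOn_mul {M : Type*} [Mul M] {f g : (∀ v, Ω v) → M} {A : Set V}
    (hf : DependsOn f A) (hg : DependsOn g A) : DependsOn (fun η => f η * g η) A :=
  fun _ _ hA => congrArg₂ _ (hf hA) (hg hA)

variable [∀ v, MeasurableSpace (Ω v)]

theorem measurable_cylinderEvents_of_dependsOn {β : Type*} [MeasurableSpace β]
    [∀ v, Nonempty (Ω v)] {f : (∀ v, Ω v) → β} {A : Set V} (hf : Measurable f)
    (hA : DependsOn f A) : Measurable[cylinderEvents A] f := by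
  classical
  let ω₀ : ∀ v, Ω v := fun v => Classical.arbitrary _
  have hfA : f = f ∘ fun ω v => if v ∈ A then ω v else ω₀ v := by
    funext ω
    exact hA fun v hv => by simp [hv]
  rw [hfA]
  refine hf.comp (@measurable_pi_lambda _ _ _ (_) _ _ fun v => ?_)
  by_cases hv : v ∈ A
  · simpa [hv] using measurable_cylinderEvent_apply hv
  · simp [hv]

theorem dependsOn_of_measurableSet_cylinderEvents {B : Set (∀ v, Ω v)} {A : Set V}
    (hB : MeasurableSet[cylinderEvents A] B) : DependsOn (· ∈ B) A := by
  have hid : @Measurable _ _ (MeasurableSpace.comap (A.domRestrict (π := Ω)) MeasurableSpace.pi)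
      (cylinderEvents A) id :=
    measurable_cylinderEvents_iff.2 fun {v} hv =>
      (measurable_pi_apply (⟨v, hv⟩ : A)).comp (comap_measurable (A.domRestrict (π := Ω)))
  obtain ⟨C, -, hC : _ = B⟩ := hid hB
  subst hC
  intro η η' hA
  have hres : A.domRestrict η = A.domRestrict η' := funext fun v => hA v v.2
  simp only [Set.mem_preimage, hres]

variable [DecidableEq V]

theorem dependsOn_lmarginal {μ : ∀ v, Measure (Ω v)} {f : (∀ v, Ω v) → ℝ≥0∞} {A : Set V}
    {s : Finset V} (hf : DependsOn f A) : DependsOn (lmarginal μ s f) (A \ s) :=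
  fun _ _ hA => lintegral_congr fun w => hf.updateFinset w hA

theorem lmarginal_mul_of_dependsOn {μ : ∀ v, Measure (Ω v)} [∀ v, SigmaFinite (μ v)]
    {s : Finset V} {f g : (∀ v, Ω v) → ℝ≥0∞} (hf : Measurable f) (hg : DependsOn g {v | v ∉ s})
    (η : ∀ v, Ω v) : lmarginal μ s (fun η => f η * g η) η = lmarginal μ s f η * g η := by
  have hgη : ∀ w, g (Function.updateFinset η s w) = g η := fun w =>
    hg fun v (hv : v ∉ s) => by simp [Function.updateFinset, hv]
  simp only [lmarginal, hgη]
  exact lintegral_mul_const _ (hf.comp measurable_updateFinset)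

/-- The sum of `h · ∏ φ_v` over all values of the variables in `W`, as a function of the values of
all other variables. -/
noncomputable def margProd (φ : V → (∀ v, Ω v) → ℝ≥0∞) (W : Finset V) (h : (∀ v, Ω v) → ℝ≥0∞) :
    (∀ v, Ω v) → ℝ≥0∞ :=
  lmarginal (fun _ => Measure.count) W fun η => h η * ∏ v ∈ W, φ v η

/-- `φ v` is a conditional probability of the variable `v` given its parents in `G`. -/
structure IsFactorSystem (G : Digraph V) (φ : V → (∀ v, Ω v) → ℝ≥0∞) : Prop where
  measurable : ∀ v, Measurable (φ v)
  dependsOn : ∀ v, DependsOn (φ v) (insert v {u | G.Adj u v})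
  lintegral_eq_one : ∀ v η, ∫⁻ t, φ v (Function.update η v t) ∂Measure.count = 1

variable {G : Digraph V} {φ : V → (∀ v, Ω v) → ℝ≥0∞}

theorem IsFactorSystem.measurable_mul_prod (hφ : IsFactorSystem G φ) (W : Finset V)
    {h : (∀ v, Ω v) → ℝ≥0∞} (hh : Measurable h) : Measurable fun η => h η * ∏ v ∈ W, φ v η :=
  hh.mul (Finset.measurable_fun_prod _ fun v _ => hφ.measurable v)

variable [∀ v, DiscreteMeasurableSpace (Ω v)] [∀ v, Countable (Ω v)]

theorem lmarginal_count (s : Finset V) (f : (∀ v, Ω v) → ℝ≥0∞) (ω : ∀ v, Ω v) :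
    lmarginal (fun _ => Measure.count) s f ω
      = ∑' w : ∀ v : s, Ω v, f (Function.updateFinset ω s w) := by
  rw [lmarginal, lintegral_countable']
  refine tsum_congr fun w => ?_
  simp [Measure.pi_singleton]

theorem IsFactorSystem.measurable_margProd (hφ : IsFactorSystem G φ) (W : Finset V)
    {h : (∀ v, Ω v) → ℝ≥0∞} (hh : Measurable h) : Measurable (margProd φ W h) :=
  (hφ.measurable_mul_prod W hh).lmarginal _

theorem IsFactorSystem.margProd_erase_of_sink (hφ : IsFactorSystem G φ) {W : Finset V} {v : V}
    (hv : v ∈ W) (hsink : ∀ u ∈ W, ¬ G.Adj v u) {h : (∀ v, Ω v) → ℝ≥0∞} (hh : Measurable h)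
    (hdep : DependsOn h {v}ᶜ) : margProd φ (W.erase v) h = margProd φ W h := by
  unfold margProd
  rw [lmarginal_erase' _ (hφ.measurable_mul_prod W hh) hv]
  congr 1
  funext η
  have hφ_update : ∀ u ∈ W.erase v, ∀ t, φ u (Function.update η v t) = φ u η := fun u hu t =>
    hφ.dependsOn u fun i hi => Function.update_of_ne (by
      rintro rfl
      rcases hi with rfl | hi
      · exact Finset.notMem_erase _ _ hu
      · exact hsink u (Finset.mem_of_mem_erase hu) hi) _ _
  have hfactor : ∀ t, h (Function.update η v t) * ∏ u ∈ W, φ u (Function.update η v t)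
      = h η * (∏ u ∈ W.erase v, φ u η) * φ v (Function.update η v t) := fun t => by
    rw [← Finset.prod_erase_mul _ _ hv, ← mul_assoc,
      Finset.prod_congr rfl fun u hu => hφ_update u hu t,
      hdep fun i (hi : i ≠ v) => Function.update_of_ne hi t η]
  simp_rw [hfactor]
  rw [lintegral_const_mul _ Measurable.of_discrete, hφ.lintegral_eq_one, mul_one]

theorem IsFactorSystem.margProd_eq_of_subset (hG : IsAcyclic G) (hφ : IsFactorSystem G φ)
    {A W : Finset V} (hAW : A ⊆ W) (hA : ∀ u v, G.Adj u v → v ∈ A → u ∈ W → u ∈ A)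
    {h : (∀ v, Ω v) → ℝ≥0∞} (hh : Measurable h) (hdep : DependsOn h {v | v ∈ W → v ∈ A}) :
    margProd φ W h = margProd φ A h := by
  induction hn : (W \ A).card generalizing W with
  | zero =>
    rw [Finset.card_eq_zero, Finset.sdiff_eq_empty_iff_subset] at hn
    rw [hn.antisymm hAW]
  | succ n ih =>
    obtain ⟨v, hv, hsink⟩ := hG.exists_sink (F := W \ A) (Finset.card_pos.1 (by omega))
    obtain ⟨hvW, hvA⟩ := Finset.mem_sdiff.1 hv
    rw [← ih (W := W.erase v) (Finset.subset_erase.2 ⟨hAW, hvA⟩)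
      (fun u w huw hw hu => hA u w huw hw (Finset.mem_of_mem_erase hu))
      (hdep.mono fun u (hu : u ∈ W → u ∈ A) hu' => hu (Finset.mem_of_mem_erase hu'))
      (by rw [Finset.erase_sdiff_comm, Finset.card_erase_of_mem hv, hn]; rfl)]
    refine (hφ.margProd_erase_of_sink hvW (fun u hu hvu => ?_) hh (hdep.mono ?_)).symm
    · by_cases huA : u ∈ A
      · exact hvA (hA v u hvu huA hvW)
      · exact hsink u (Finset.mem_sdiff.2 ⟨hu, huA⟩) hvu
    · rintro u hu rfl
      exact hvA (hu hvW)

theorem IsFactorSystem.margProd_margProd (hφ : IsFactorSystem G φ) {W₁ W₂ : Finset V}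
    (hW : Disjoint W₁ W₂) (hG : ∀ u v, G.Adj u v → v ∈ W₁ → u ∉ W₂) {h : (∀ v, Ω v) → ℝ≥0∞}
    (hh : Measurable h) : margProd φ W₁ (margProd φ W₂ h) = margProd φ (W₁ ∪ W₂) h := by
  have hdep : DependsOn (fun η => ∏ v ∈ W₁, φ v η) {v | v ∉ W₂} :=
    dependsOn_prod fun v hv => (hφ.dependsOn v).mono <| by
      rintro u (rfl | hu)
      · exact Finset.disjoint_left.1 hW hv
      · exact hG u v hu hv
  unfold margProd
  rw [lmarginal_union _ _ (hφ.measurable_mul_prod _ hh) hW]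
  congr 1
  funext η
  rw [← lmarginal_mul_of_dependsOn (hφ.measurable_mul_prod W₂ hh) hdep]
  congr 1
  funext ω
  rw [Finset.prod_union hW]
  ring

end Marginal

/-! ### The law of a window of time, with and without interventions -/

section Window

variable {S : Type*}

theorem IsFTCG.mono {G H : Digraph (S × ℤ)} (hG : IsFTCG G) (hHG : H ≤ G) : IsFTCG H :=
  ⟨hG.acyclic.mono hHG, fun u v huv => hG.forward u v (hHG huv)⟩

/-- The graph `G` without the edges from `C v` to `v`. -/
def cutGraph (G : Digraph (S × ℤ)) (C : S × ℤ → Set (S × ℤ)) : Digraph (S × ℤ) where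
  Adj u v := G.Adj u v ∧ u ∉ C v

theorem cutGraph_le (G : Digraph (S × ℤ)) (C : S × ℤ → Set (S × ℤ)) : cutGraph G C ≤ G :=
  fun _ _ huv => huv.1

variable [Fintype S]

theorem mem_window {a b : ℤ} {v : S × ℤ} : v ∈ window (S := S) a b ↔ a ≤ v.2 ∧ v.2 ≤ b := by
  simp [window]

variable [DecidableEq S]

theorem window_union_window {a b c : ℤ} (hab : a ≤ b) (hbc : b ≤ c + 1) :
    window (S := S) a (b - 1) ∪ window b c = window a c := by
  ext v
  simp only [Finset.mem_union, mem_window]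
  omega

theorem subset_timeSpan (A : Finset (S × ℤ)) : A ⊆ timeSpan A := fun v hv => by
  simp only [timeSpan, Finset.mem_biUnion, mem_window]
  exact ⟨v, hv, v, hv, le_rfl, le_rfl⟩

theorem exists_timeSpan_eq_window {A : Finset (S × ℤ)} (hA : A.Nonempty) :
    ∃ u ∈ A, ∃ v ∈ A, timeSpan A = window u.2 v.2 := by
  obtain ⟨u, hu, hmin⟩ := A.exists_min_image Prod.snd hA
  obtain ⟨v, hv, hmax⟩ := A.exists_max_image Prod.snd hA
  refine ⟨u, hu, v, hv, ?_⟩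
  ext w
  simp only [timeSpan, Finset.mem_biUnion, mem_window]
  constructor
  · rintro ⟨u', hu', v', hv', huw, hwv⟩
    exact ⟨(hmin u' hu').trans huw, hwv.trans (hmax v' hv')⟩
  · exact fun hw => ⟨u, hu, v, hv, hw⟩

omit [DecidableEq S] in
theorem exists_subset_window (A : Finset (S × ℤ)) : ∃ a b, A ⊆ window a b := by
  classical
  rcases A.eq_empty_or_nonempty with rfl | hA
  · exact ⟨0, 0, Finset.empty_subset _⟩
  · obtain ⟨u, -, v, -, hAuv⟩ := exists_timeSpan_eq_window hA
    exact ⟨u.2, v.2, hAuv ▸ subset_timeSpan A⟩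

end Window

section Event

variable {S : Type*} {Ω : S × ℤ → Type*}

theorem mem_event_restrict {A : Finset (S × ℤ)} {ξ ω : ∀ v, Ω v} :
    (ω ∈ event A fun v => ξ v) ↔ ∀ v ∈ A, ω v = ξ v :=
  ⟨fun hω v hv => hω ⟨v, hv⟩, fun hω v => hω v v.2⟩

/-- The indicator function of the event that the variables in `A` have the values given by `ξ`. -/
noncomputable def eventInd (A : Finset (S × ℤ)) (ξ : ∀ v, Ω v) : (∀ v, Ω v) → ℝ≥0∞ :=
  (event A fun v => ξ v).indicator 1

open Classical in
theorem eventInd_apply {A : Finset (S × ℤ)} {ξ η : ∀ v, Ω v} :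
    eventInd A ξ η = if ∀ v ∈ A, η v = ξ v then 1 else 0 := by
  simp only [eventInd, Set.indicator_apply, mem_event_restrict, Pi.one_apply]

theorem dependsOn_eventInd (A : Finset (S × ℤ)) (ξ : ∀ v, Ω v) :
    DependsOn (eventInd A ξ) (A : Set (S × ℤ)) := by
  classical
  intro η η' hA
  have hiff : (∀ v ∈ A, η v = ξ v) ↔ ∀ v ∈ A, η' v = ξ v :=
    forall₂_congr fun v hv => by rw [hA v hv]
  simp only [eventInd_apply, hiff]

variable [∀ v, MeasurableSpace (Ω v)] [∀ v, DiscreteMeasurableSpace (Ω v)]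

theorem measurableSet_event (A : Finset (S × ℤ)) (a : ∀ v : A, Ω v) :
    MeasurableSet (event A a) := by
  simp only [event, Set.ofPred_forall]
  exact MeasurableSet.iInter fun v => measurable_pi_apply _ (measurableSet_singleton _)

theorem measurable_eventInd (A : Finset (S × ℤ)) (ξ : ∀ v, Ω v) : Measurable (eventInd A ξ) :=
  measurable_one.indicator (measurableSet_event _ _)

theorem lintegral_eventInd (P : Measure (∀ v, Ω v)) (A : Finset (S × ℤ)) (ξ : ∀ v, Ω v) :
    ∫⁻ ω, eventInd A ξ ω ∂P = P (event A fun v => ξ v) :=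
  lintegral_indicator_one (measurableSet_event _ _)

theorem tsum_setLIntegral_event [∀ v, Countable (Ω v)] (P : Measure (∀ v, Ω v))
    (W : Finset (S × ℤ)) (h : (∀ v, Ω v) → ℝ≥0∞) :
    ∑' w : ∀ v : W, Ω v, ∫⁻ ω in event W w, h ω ∂P = ∫⁻ ω, h ω ∂P := by
  have hdisj : Pairwise (Function.onFun Disjoint fun w : ∀ v : W, Ω v => event W w) :=
    fun w w' hne => Set.disjoint_left.2 fun ω hω hω' =>
      hne (funext fun v => (hω v).symm.trans (hω' v))
  have huniv : ⋃ w : ∀ v : W, Ω v, event W w = Set.univ :=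
    Set.eq_univ_of_forall fun ω => Set.mem_iUnion.2 ⟨fun v => ω v, fun _ => rfl⟩
  rw [← lintegral_iUnion (fun w => measurableSet_event W w) hdisj, huniv, setLIntegral_univ]

end Event

section Factor

variable {S : Type*} {Ω : S × ℤ → Type*} [∀ v, MeasurableSpace (Ω v)] {G : Digraph (S × ℤ)}

open Classical in
/-- The conditional probability of the value of `v` given its parents, where the parents in `C v`
are read off `ξ`. -/
noncomputable def factor (κ : Mechanisms G Ω) (ξ : ∀ v, Ω v) (C : S × ℤ → Set (S × ℤ)) (v : S × ℤ)
    (η : ∀ v, Ω v) : ℝ≥0∞ :=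
  κ v (fun u => if (u : S × ℤ) ∈ C v then ξ u else η u) {η v}

open Classical in
/-- The factors after the variables in `X` are set to their values in `ξ`. -/
noncomputable def doFactor (κ : Mechanisms G Ω) (ξ : ∀ v, Ω v) (X : Finset (S × ℤ))
    (C : S × ℤ → Set (S × ℤ)) (v : S × ℤ) (η : ∀ v, Ω v) : ℝ≥0∞ :=
  if v ∈ X then (if η v = ξ v then 1 else 0) else factor κ ξ C v η

theorem doFactor_of_notMem (κ : Mechanisms G Ω) (ξ : ∀ v, Ω v) {X : Finset (S × ℤ)}
    (C : S × ℤ → Set (S × ℤ)) {v : S × ℤ} (hv : v ∉ X) : doFactor κ ξ X C v = factor κ ξ C v :=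
  funext fun _ => if_neg hv

theorem doFactor_empty (κ : Mechanisms G Ω) (ξ : ∀ v, Ω v) (C : S × ℤ → Set (S × ℤ)) :
    doFactor κ ξ ∅ C = factor κ ξ C :=
  funext fun v => doFactor_of_notMem κ ξ C (Finset.notMem_empty v)

theorem prod_doFactor_updateFinset [DecidableEq S] (κ : Mechanisms G Ω) (ξ ω : ∀ v, Ω v)
    {X W : Finset (S × ℤ)} {w : ∀ v : W, Ω v} (hw : ∀ v : W, (v : S × ℤ) ∈ X → w v = ξ v) :
    ∏ v ∈ W, doFactor κ ξ X (fun _ => ∅) v (Function.updateFinset ω W w)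
      = factorProduct κ X W w ω := by
  rw [← Finset.prod_coe_sort]
  refine Finset.prod_congr rfl fun v _ => ?_
  have hv : Function.updateFinset ω W w v = w v := by simp [Function.updateFinset]
  by_cases hvX : (v : S × ℤ) ∈ X
  · simp only [doFactor, hvX, hv, hw v hvX, if_true]
  · simp only [doFactor, hvX, hv, factor, Set.mem_empty_iff_false, if_false]
    rfl

theorem eventInd_mul_prod_doFactor_updateFinset [DecidableEq S] (κ : Mechanisms G Ω)
    (ξ ξ' ω : ∀ v, Ω v) {X Y W : Finset (S × ℤ)} (hY : Y ⊆ W) (w : ∀ v : W, Ω v) :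
    eventInd Y ξ' (Function.updateFinset ω W w)
        * ∏ v ∈ W, doFactor κ ξ X (fun _ => ∅) v (Function.updateFinset ω W w)
      = {w : ∀ v : W, Ω v | (∀ v : W, (v : S × ℤ) ∈ X → w v = ξ v) ∧
          ∀ v : W, (v : S × ℤ) ∈ Y → w v = ξ' v}.indicator
          (fun w => factorProduct κ X W w ω) w := by
  classical
  have hw : ∀ v : W, Function.updateFinset ω W w v = w v := fun v => by
    simp [Function.updateFinset]
  by_cases hwX : ∀ v : W, (v : S × ℤ) ∈ X → w v = ξ v
  · have hiff : (∀ v ∈ Y, Function.updateFinset ω W w v = ξ' v)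
        ↔ ∀ v : W, (v : S × ℤ) ∈ Y → w v = ξ' v :=
      ⟨fun h v hv => (hw v).symm.trans (h v hv), fun h v hv => (hw ⟨v, hY hv⟩).trans (h _ hv)⟩
    rw [prod_doFactor_updateFinset κ ξ ω hwX, eventInd_apply, Set.indicator_apply]
    simp only [hiff, Set.mem_ofPred_eq, and_iff_right hwX, ite_mul, one_mul, zero_mul]
  · rw [Set.indicator_of_notMem fun hmem => hwX hmem.1]
    push Not at hwX
    obtain ⟨v, hvX, hne⟩ := hwX
    rw [Finset.prod_eq_zero v.2, mul_zero]
    rw [doFactor, if_pos hvX, hw, if_neg hne]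

variable [∀ v, DiscreteMeasurableSpace (Ω v)]

theorem measurable_factorProduct [DecidableEq S] (κ : Mechanisms G Ω) (X W : Finset (S × ℤ))
    (w : ∀ v : W, Ω v) : Measurable (factorProduct κ X W w) := by
  refine Finset.measurable_fun_prod _ fun v _ => ?_
  split_ifs
  · exact measurable_const
  · exact ((κ v).measurable_coe (measurableSet_singleton _)).comp (measurable_pi_lambda _ fun u =>
      (measurable_pi_apply (u : S × ℤ)).comp measurable_updateFinset_left)

variable [∀ v, Countable (Ω v)]

theorem measurable_factor (κ : Mechanisms G Ω) (ξ : ∀ v, Ω v) (C : S × ℤ → Set (S × ℤ))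
    (v : S × ℤ) : Measurable (factor κ ξ C v) := by
  classical
  have hpa : Measurable fun η : ∀ v, Ω v =>
      (fun u : {u // G.Adj u v} => if (u : S × ℤ) ∈ C v then ξ u else η u) := by
    refine measurable_pi_lambda _ fun u => ?_
    by_cases hu : (u : S × ℤ) ∈ C v
    · simp [hu]
    · simpa [hu] using measurable_pi_apply (u : S × ℤ)
  have hκ : Measurable fun p : (∀ u : {u // G.Adj u v}, Ω u) × Ω v => κ v p.1 {p.2} :=
    measurable_from_prod_countable_left fun t => (κ v).measurable_coe (measurableSet_singleton t)
  exact hκ.comp (hpa.prodMk (measurable_pi_apply v))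

theorem isFactorSystem_factor [DecidableEq S] (hG : IsAcyclic G) {κ : Mechanisms G Ω}
    (hκ : ∀ v, IsMarkovKernel (κ v)) (ξ : ∀ v, Ω v) (C : S × ℤ → Set (S × ℤ)) :
    IsFactorSystem (cutGraph G C) (factor κ ξ C) where
  measurable := measurable_factor κ ξ C
  dependsOn v η η' hv := by
    unfold factor
    rw [hv v (Set.mem_insert v _)]
    congr 2
    funext u
    split_ifs with hu
    · rfl
    · exact hv u (.inr ⟨u.2, hu⟩)
  lintegral_eq_one v η := by
    classical
    have hne : ∀ u : {u // G.Adj u v}, (u : S × ℤ) ≠ v := fun u huv =>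
      hG v (.single (by simpa only [huv] using u.2))
    have hupdate : ∀ t, factor κ ξ C v (Function.update η v t)
        = κ v (fun u => if (u : S × ℤ) ∈ C v then ξ u else η u) {t} := fun t => by
      simp only [factor, Function.update_self, Function.update_of_ne (hne _)]
    simp_rw [hupdate]
    have hsum := lintegral_countable' (μ := κ v fun u => if (u : S × ℤ) ∈ C v then ξ u else η u)
      fun _ => 1
    simp only [lintegral_one, measure_univ, one_mul] at hsum
    rw [lintegral_count, ← hsum]

theorem isFactorSystem_doFactor [DecidableEq S] (hG : IsAcyclic G) {κ : Mechanisms G Ω}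
    (hκ : ∀ v, IsMarkovKernel (κ v)) (ξ : ∀ v, Ω v) (X : Finset (S × ℤ))
    (C : S × ℤ → Set (S × ℤ)) :
    IsFactorSystem (cutGraph G C) (doFactor κ ξ X C) where
  measurable v := by
    classical
    by_cases hv : v ∈ X
    · unfold doFactor
      simp only [hv, if_true]
      exact Measurable.ite (measurable_pi_apply v (measurableSet_singleton (ξ v)))
        measurable_const measurable_const
    · exact doFactor_of_notMem κ ξ C hv ▸ measurable_factor κ ξ C v
  dependsOn v η η' hv := by
    unfold doFactor
    rw [(isFactorSystem_factor hG hκ ξ C).dependsOn v hv, hv v (Set.mem_insert v _)]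
  lintegral_eq_one v η := by
    classical
    by_cases hv : v ∈ X
    · simp only [doFactor, hv, if_true, Function.update_self]
      rw [lintegral_count, tsum_ite_eq]
    · exact doFactor_of_notMem κ ξ C hv ▸ (isFactorSystem_factor hG hκ ξ C).lintegral_eq_one v η

end Factor

section Law

variable {S : Type*} [DecidableEq S] [Fintype S] {Ω : S × ℤ → Type*} [∀ v, MeasurableSpace (Ω v)]
  {G : Digraph (S × ℤ)} {κ : Mechanisms G Ω} {P : Measure (∀ v, Ω v)}

theorem IsFactorSystem.dependsOn_margProd_window {φ : S × ℤ → (∀ v, Ω v) → ℝ≥0∞} (hG : IsFTCG G)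
    (hφ : IsFactorSystem G φ) {a b : ℤ} {h : (∀ v, Ω v) → ℝ≥0∞}
    (hdep : DependsOn h {v | v.2 ≤ b}) :
    DependsOn (margProd φ (window a b) h) {v | v.2 < a} := by
  refine (dependsOn_lmarginal (dependsOn_mul hdep
    (dependsOn_prod fun v hv => (hφ.dependsOn v).mono ?_))).mono ?_
  · rintro u (rfl | hu)
    · exact (mem_window.1 hv).2
    · exact (hG.forward u v hu).trans (mem_window.1 hv).2
  · rintro v ⟨hvb : v.2 ≤ b, hvW⟩
    exact not_le.1 fun hav => hvW (mem_window.2 ⟨hav, hvb⟩)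

variable [∀ v, DiscreteMeasurableSpace (Ω v)]

theorem IsCompatible.setLIntegral_event_window [∀ v, Nonempty (Ω v)]
    (hP : IsCompatible G κ P) (a b : ℤ) (w : ∀ v : window (S := S) a b, Ω v)
    {g : (∀ v, Ω v) → ℝ≥0∞} (hg : Measurable g) (hdep : DependsOn g {v | v.2 < a}) :
    ∫⁻ ω in event (window a b) w, g ω ∂P
      = ∫⁻ ω, g ω * factorProduct κ ∅ (window a b) w ω ∂P := by
  have hle : cylinderEvents (X := Ω) {v : S × ℤ | v.2 < a} ≤ MeasurableSpace.pi :=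
    cylinderEvents_le_pi
  have htrim : (P.restrict (event (window a b) w)).trim hle
      = (P.withDensity (factorProduct κ ∅ (window a b) w)).trim hle := by
    refine @Measure.ext _ (_) _ _ fun B hB => ?_
    rw [trim_measurableSet_eq hle hB, trim_measurableSet_eq hle hB,
      Measure.restrict_apply (hle _ hB), withDensity_apply _ (hle _ hB)]
    exact hP.factorization a b B hB w
  have hg' := measurable_cylinderEvents_of_dependsOn hg hdep
  rw [← lintegral_trim hle hg', htrim, lintegral_trim hle hg',
    lintegral_withDensity_eq_lintegral_mul _ (measurable_factorProduct κ ∅ _ w) hg]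
  exact lintegral_congr fun ω => mul_comm _ _

variable [∀ v, Countable (Ω v)]

theorem IsFactorSystem.margProd_window_eq {φ : S × ℤ → (∀ v, Ω v) → ℝ≥0∞} (hG : IsFTCG G)
    (hφ : IsFactorSystem G φ) {a b c : ℤ} (hbc : b ≤ c) {h : (∀ v, Ω v) → ℝ≥0∞}
    (hh : Measurable h) (hdep : DependsOn h {v | v.2 ≤ b}) :
    margProd φ (window a c) h = margProd φ (window a b) h := by
  refine hφ.margProd_eq_of_subset hG.acyclic (fun v hv => ?_) (fun u v huv hv hu => ?_) hh
    (hdep.mono fun v (hv : v.2 ≤ b) hvW => ?_)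
  · rw [mem_window] at hv ⊢
    omega
  · rw [mem_window] at hv hu ⊢
    exact ⟨hu.1, (hG.forward u v huv).trans hv.2⟩
  · exact mem_window.2 ⟨(mem_window.1 hvW).1, hv⟩

theorem IsFactorSystem.margProd_window_margProd_window {φ : S × ℤ → (∀ v, Ω v) → ℝ≥0∞}
    (hG : IsFTCG G) (hφ : IsFactorSystem G φ) {a b c : ℤ} (hab : a ≤ b) (hbc : b ≤ c + 1)
    {h : (∀ v, Ω v) → ℝ≥0∞} (hh : Measurable h) :
    margProd φ (window a (b - 1)) (margProd φ (window b c) h) = margProd φ (window a c) h := by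
  rw [hφ.margProd_margProd (Finset.disjoint_left.2 fun v hv hv' => ?_)
    (fun u v huv hv hu => ?_) hh, window_union_window hab hbc]
  · rw [mem_window] at hv hv'
    omega
  · rw [mem_window] at hv hu
    have := hG.forward u v huv
    omega

theorem doProb_eq_lintegral_margProd_timeSpan (hG : IsAcyclic G)
    (hκ : ∀ v, IsMarkovKernel (κ v)) (P : Measure (∀ v, Ω v)) (X Y : Finset (S × ℤ))
    (ξ ξ' : ∀ v, Ω v) :
    doProb κ P X Y (fun v => ξ v) (fun v => ξ' v)
      = ∫⁻ ω, margProd (doFactor κ ξ X fun _ => ∅) (timeSpan (X ∪ Y)) (eventInd Y ξ') ω ∂P := by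
  have hY := Finset.union_subset_right (subset_timeSpan (X ∪ Y))
  unfold doProb
  generalize timeSpan (X ∪ Y) = T at hY
  have hmeas : ∀ w : ∀ v : T, Ω v, Measurable fun ω : ∀ v, Ω v =>
      eventInd Y ξ' (Function.updateFinset ω T w) *
        ∏ v ∈ T, doFactor κ ξ X (fun _ => ∅) v (Function.updateFinset ω T w) := fun w =>
    ((isFactorSystem_doFactor hG hκ ξ X fun _ => ∅).measurable_mul_prod T
      (measurable_eventInd Y ξ')).comp measurable_updateFinset_left
  simp_rw [margProd, lmarginal_count]
  rw [lintegral_tsum fun w => (hmeas w).aemeasurable]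
  refine (tsum_subtype {w : ∀ v : T, Ω v | (∀ v : T, (v : S × ℤ) ∈ X → w v = ξ v) ∧
    ∀ v : T, (v : S × ℤ) ∈ Y → w v = ξ' v} fun w => ∫⁻ ω, factorProduct κ X T w ω ∂P).trans
    (tsum_congr fun w => ?_)
  simp_rw [eventInd_mul_prod_doFactor_updateFinset κ ξ ξ' _ hY]
  by_cases hw : w ∈ {w : ∀ v : T, Ω v | (∀ v : T, (v : S × ℤ) ∈ X → w v = ξ v) ∧
    ∀ v : T, (v : S × ℤ) ∈ Y → w v = ξ' v}
  · simp only [Set.indicator_of_mem hw]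
  · simp only [Set.indicator_of_notMem hw, lintegral_zero]

variable [∀ v, Nonempty (Ω v)]

theorem IsCompatible.lintegral_margProd_factor (hP : IsCompatible G κ P) (ξ : ∀ v, Ω v) (a b : ℤ)
    {h : (∀ v, Ω v) → ℝ≥0∞} (hh : Measurable h) (hdep : DependsOn h {v | v.2 ≤ b}) :
    ∫⁻ ω, margProd (factor κ ξ fun _ => ∅) (window a b) h ω ∂P = ∫⁻ ω, h ω ∂P := by
  have hh' : ∀ w : ∀ v : window (S := S) a b, Ω v,
      Measurable fun ω : ∀ v, Ω v => h (Function.updateFinset ω (window a b) w) := fun w =>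
    hh.comp measurable_updateFinset_left
  have hpast : ∀ w : ∀ v : window (S := S) a b, Ω v,
      DependsOn (fun ω : ∀ v, Ω v => h (Function.updateFinset ω (window a b) w))
        {v | v.2 < a} := fun w => (hdep.updateFinset w).mono <| by
    rintro v ⟨hv : v.2 ≤ b, hvW⟩
    exact not_le.1 fun hav => hvW (mem_window.2 ⟨hav, hv⟩)
  have hfix : ∀ w : ∀ v : window (S := S) a b, Ω v, Set.EqOn h
      (fun ω => h (Function.updateFinset ω (window a b) w)) (event (window a b) w) :=
    fun w ω hω => congrArg h <| funext fun v => by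
      simp only [Function.updateFinset]
      split_ifs with hv
      · exact hω ⟨v, hv⟩
      · rfl
  have hprod : ∀ (ω : ∀ v, Ω v) (w : ∀ v : window (S := S) a b, Ω v),
      ∏ v ∈ window a b, factor κ ξ (fun _ => ∅) v (Function.updateFinset ω (window a b) w)
        = factorProduct κ ∅ (window a b) w ω := fun ω w => by
    rw [← doFactor_empty, prod_doFactor_updateFinset κ ξ ω fun v hv => absurd hv (by simp)]
  simp_rw [margProd, lmarginal_count, hprod]
  rw [lintegral_tsum fun w => ((hh' w).fun_mul (measurable_factorProduct κ ∅ _ w)).aemeasurable,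
    ← tsum_setLIntegral_event P (window a b) h]
  refine tsum_congr fun w => ?_
  rw [setLIntegral_congr_fun (measurableSet_event _ _) (hfix w),
    hP.setLIntegral_event_window a b w (hh' w) (hpast w)]

theorem IsCompatible.lintegral_margProd_doFactor_window (hG : IsFTCG G) (hP : IsCompatible G κ P)
    (ξ : ∀ v, Ω v) {X : Finset (S × ℤ)} {a b c : ℤ} (hab : a ≤ b) (hbc : b ≤ c + 1)
    (hX : ∀ v ∈ X, b ≤ v.2) {h : (∀ v, Ω v) → ℝ≥0∞} (hh : Measurable h)
    (hdep : DependsOn h {v | v.2 ≤ c}) :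
    ∫⁻ ω, margProd (doFactor κ ξ X fun _ => ∅) (window a c) h ω ∂P
      = ∫⁻ ω, margProd (doFactor κ ξ X fun _ => ∅) (window b c) h ω ∂P := by
  have hφ := isFactorSystem_doFactor hG.acyclic hP.isMarkovKernel ξ X fun _ => ∅
  have hcut : IsFTCG (cutGraph G fun _ => ∅) := hG.mono (cutGraph_le G _)
  have hfactor : ∀ g, margProd (doFactor κ ξ X fun _ => ∅) (window a (b - 1)) g
      = margProd (factor κ ξ fun _ => ∅) (window a (b - 1)) g := fun g => by
    unfold margProd
    congr 1
    funext η
    congr 1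
    refine Finset.prod_congr rfl fun v hv => ?_
    rw [doFactor_of_notMem κ ξ _ fun hvX => ?_]
    have := (mem_window.1 hv).2
    have := hX v hvX
    omega
  rw [← hφ.margProd_window_margProd_window hcut hab hbc hh, hfactor]
  exact hP.lintegral_margProd_factor ξ a (b - 1) (hφ.measurable_margProd _ hh)
    ((hφ.dependsOn_margProd_window hcut hdep).mono fun v (hv : v.2 < b) => Int.le_sub_one_of_lt hv)

theorem IsCompatible.doProb_eq_lintegral_margProd_window (hG : IsFTCG G)
    (hP : IsCompatible G κ P) {X Y : Finset (S × ℤ)} (ξ ξ' : ∀ v, Ω v) {a b : ℤ}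
    (hX : X ⊆ window a b) (hY : Y ⊆ window a b) :
    doProb κ P X Y (fun v => ξ v) (fun v => ξ' v)
      = ∫⁻ ω, margProd (doFactor κ ξ X fun _ => ∅) (window a b) (eventInd Y ξ') ω ∂P := by
  have hφ := isFactorSystem_doFactor hG.acyclic hP.isMarkovKernel ξ X fun _ => ∅
  have hcut : IsFTCG (cutGraph G fun _ => ∅) := hG.mono (cutGraph_le G _)
  have hind := measurable_eventInd Y ξ'
  have hdep : DependsOn (eventInd Y ξ') {v | v.2 ≤ b} :=
    (dependsOn_eventInd Y ξ').mono fun v hv => (mem_window.1 (hY hv)).2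
  rw [doProb_eq_lintegral_margProd_timeSpan hG.acyclic hP.isMarkovKernel]
  rcases (X ∪ Y).eq_empty_or_nonempty with hempty | hne
  · have hYe : Y = ∅ := (Finset.union_eq_empty.1 hempty).2
    rw [hempty, hφ.margProd_eq_of_subset hcut.acyclic (A := timeSpan ∅) (W := window a b)
      (by simp [timeSpan]) (by simp [timeSpan]) hind
      ((dependsOn_eventInd Y ξ').mono fun v hv => by simp [hYe] at hv)]
  · obtain ⟨u, hu, v, hv, hspan⟩ := exists_timeSpan_eq_window hne
    have hmem : ∀ w ∈ X ∪ Y, u.2 ≤ w.2 ∧ w.2 ≤ v.2 := fun w hw =>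
      mem_window.1 (hspan ▸ subset_timeSpan _ hw)
    have hub := mem_window.1 (Finset.union_subset hX hY hu)
    have hvb := mem_window.1 (Finset.union_subset hX hY hv)
    rw [hspan, ← hφ.margProd_window_eq hcut hvb.2 hind ((dependsOn_eventInd Y ξ').mono
      fun w hw => (hmem w (Finset.mem_union_right X hw)).2)]
    exact (hP.lintegral_margProd_doFactor_window hG ξ hub.1 (by omega)
      (fun w hw => (hmem w (Finset.mem_union_left Y hw)).1) hind hdep).symm

end Law

/-! ### Separation implies the adjustment formula -/

section LinkedAncestors

variable {V : Type*} {G H : Digraph V} {X Y Z : Set V}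

/-- The ancestors of the vertices in `T`, including these. -/
def ancestors (G : Digraph V) (T : Set V) : Set V :=
  {v | ∃ t ∈ T, IsDescendant G v t}

/-- The open ancestors of the vertices that are linked to `Y`. -/
def linkedAnc (G : Digraph V) (Y Z : Set V) : Set V :=
  {v | ∃ t, Linked G Y Z t ∧ v ∈ openAnc G Z t}

theorem IsAncestral.mono {A : Set V} (hA : IsAncestral G A) (hHG : H ≤ G) : IsAncestral H A :=
  fun u v huv => hA u v (hHG huv)

theorem subset_ancestors (G : Digraph V) (T : Set V) : T ⊆ ancestors G T :=
  fun v hv => ⟨v, hv, .refl⟩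

theorem isAncestral_ancestors (G : Digraph V) (T : Set V) : IsAncestral G (ancestors G T) :=
  fun _ _ huv ⟨t, ht, hvt⟩ => ⟨t, ht, .head huv hvt⟩

theorem IsCausalNode.of_mem_ancestors_backdoorGraph (hXY : Disjoint X Y) {v : V}
    (hv : v ∈ ancestors (backdoorGraph G X Y) Y) : IsCausalNode G X Y v := by
  obtain ⟨y, hy, hvy⟩ := hv
  induction hvy using Relation.ReflTransGen.head_induction_on with
  | refl => exact ⟨fun hX => Set.disjoint_left.1 hXY hX hy, y, hy, .refl⟩
  | head huv _ ih =>
    refine ⟨fun hu => huv.2 ⟨hu, ih⟩, ?_⟩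
    obtain ⟨hvX, y', hy', hvy'⟩ := ih
    exact ⟨y', hy', .head ⟨huv.1, hvX⟩ hvy'⟩

theorem Linked.mem {t : V} (ht : Linked G Y Z t) : t ∈ Y ∪ Z := by
  cases ht with
  | base hY => exact .inl hY
  | step _ hZ _ _ => exact .inr hZ

theorem isDescendant_of_mem_openAnc {s t : V} (hst : s ∈ openAnc G Z t) : IsDescendant G s t :=
  hst.2.lift id fun _ _ huv => huv.1

theorem disjoint_linkedAnc : Disjoint (linkedAnc G Y Z) Z :=
  Set.disjoint_left.2 fun _ ⟨_, _, hv⟩ => hv.1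

theorem linkedAnc_subset_ancestors : linkedAnc G Y Z ⊆ ancestors G (X ∪ Y ∪ Z) := by
  rintro v ⟨t, ht, hv⟩
  exact ⟨t, Set.union_subset_union_left Z Set.subset_union_right ht.mem,
    isDescendant_of_mem_openAnc hv⟩

theorem subset_linkedAnc (hYZ : Disjoint Y Z) : Y ⊆ linkedAnc G Y Z := fun v hv =>
  ⟨v, .base hv, self_mem_openAnc (Set.disjoint_left.1 hYZ hv)⟩

theorem disjoint_linkedAnc_of_not_isConnected (hC : ¬ IsConnected G X Y Z) :
    Disjoint X (linkedAnc G Y Z) :=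
  Set.disjoint_left.2 fun v hv ⟨t, ht, hvt⟩ => hC ⟨v, hv, t, v, ht, self_mem_openAnc hvt.1, hvt⟩

theorem mem_linkedAnc_iff_of_adj (hC : ¬ IsConnected G X Y Z) {u v : V} (hu : u ∉ Z) (hv : v ∉ Z)
    (hanc : v ∈ ancestors G (X ∪ Y ∪ Z)) (huv : G.Adj u v) :
    u ∈ linkedAnc G Y Z ↔ v ∈ linkedAnc G Y Z := by
  constructor
  · rintro ⟨t, ht, hut⟩
    obtain ⟨s, hs, hvs⟩ := hanc
    obtain ⟨t', ht', hvt'⟩ := exists_reflTransGen_openStep Set.subset_union_right hs hvs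
    have hut' : u ∈ openAnc G Z t' := mem_openAnc_of_openStep ⟨huv, hu⟩ hvt'
    refine ⟨t', ?_, hv, hvt'⟩
    rcases ht' with (hX | hY) | hZ
    · exact absurd ⟨t', hX, t, u, ht, hut', hut⟩ hC
    · exact .base hY
    · exact .step ht hZ hut hut'
  · rintro ⟨t, ht, hvt⟩
    exact ⟨t, ht, mem_openAnc_of_openStep ⟨huv, hu⟩ hvt.2⟩

theorem mem_linkedAnc_of_adj_mem {u u' v : V} (hv : v ∈ Z) (hu' : u' ∉ Z) (huv : G.Adj u v)
    (hu'v : G.Adj u' v) (hu : u ∈ linkedAnc G Y Z) : u' ∈ linkedAnc G Y Z := by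
  obtain ⟨t, ht, hut⟩ := hu
  exact ⟨v, .step ht hv hut (mem_openAnc_of_openStep ⟨huv, hut.1⟩ .refl),
    mem_openAnc_of_openStep ⟨hu'v, hu'⟩ .refl⟩

theorem insert_parents_subset_linkedAnc_union (hC : ¬ IsConnected G X Y Z) {v : V}
    (hanc : v ∈ ancestors G (X ∪ Y ∪ Z))
    (hv : ¬ Disjoint (insert v {u | G.Adj u v}) (linkedAnc G Y Z)) :
    insert v {u | G.Adj u v} ⊆ linkedAnc G Y Z ∪ Z := by
  obtain ⟨w, hw, hwU⟩ := Set.not_disjoint_iff.1 hv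
  have hwZ : w ∉ Z := Set.disjoint_left.1 disjoint_linkedAnc hwU
  intro u hu
  by_cases huZ : u ∈ Z
  · exact .inr huZ
  refine .inl ?_
  by_cases hvZ : v ∈ Z
  · rcases hw with rfl | hw
    · exact absurd hvZ hwZ
    rcases hu with rfl | hu
    · exact absurd hvZ huZ
    exact mem_linkedAnc_of_adj_mem hvZ huZ hw hu hwU
  · have hvU : v ∈ linkedAnc G Y Z := by
      rcases hw with rfl | hw
      · exact hwU
      · exact (mem_linkedAnc_iff_of_adj hC hwZ hvZ hanc hw).1 hwU
    rcases hu with rfl | hu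
    · exact hvU
    · exact (mem_linkedAnc_iff_of_adj hC huZ hvZ hanc hu).2 hvU

/-- `Z` splits the ancestral set `N` into `U` and the rest: a vertex of `N` which is in `U` or has a
parent in `U` has no parents outside `U ∪ Z` and is itself in `U ∪ Z`. -/
structure IsSplit (G : Digraph V) (N U Z : Set V) : Prop where
  isAncestral : IsAncestral G N
  subset : U ⊆ N
  subset_right : Z ⊆ N
  disjoint : Disjoint U Z
  insert_parents_subset : ∀ v ∈ N, ¬ Disjoint (insert v {u | G.Adj u v}) U →
    insert v {u | G.Adj u v} ⊆ U ∪ Z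

theorem isSplit_linkedAnc (hC : ¬ IsConnected G X Y Z) :
    IsSplit G (ancestors G (X ∪ Y ∪ Z)) (linkedAnc G Y Z) Z where
  isAncestral := isAncestral_ancestors G _
  subset := linkedAnc_subset_ancestors
  subset_right := Set.subset_union_right.trans (subset_ancestors G _)
  disjoint := disjoint_linkedAnc
  insert_parents_subset _ := insert_parents_subset_linkedAnc_union hC

variable {N U W : Set V}

theorem IsSplit.insert_parents_subset_sdiff (hs : IsSplit G N U Z) {v : V} (hv : v ∈ N)
    (hvU : Disjoint (insert v {u | G.Adj u v}) U) : insert v {u | G.Adj u v} ⊆ N \ U :=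
  Set.subset_sdiff.2 ⟨Set.insert_subset hv fun u huv => hs.isAncestral u v huv hv, hvU⟩

theorem IsSplit.isAncestral_sdiff (hs : IsSplit H N U Z) (hZW : Z ⊆ W)
    (hpast : ∀ u v, G.Adj u v → v ∈ N \ W → H.Adj u v ∧ u ∉ W) : IsAncestral G (U \ W) := by
  rintro u v huv ⟨hvU, hvW⟩
  obtain ⟨huvH, huW⟩ := hpast u v huv ⟨hs.subset hvU, hvW⟩
  have hmeet := Set.not_disjoint_iff.2 ⟨v, Set.mem_insert v {u | H.Adj u v}, hvU⟩
  have huUZ := hs.insert_parents_subset v (hs.subset hvU) hmeet (.inr huvH)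
  exact ⟨huUZ.resolve_right fun huZ => huW (hZW huZ), huW⟩

theorem IsSplit.isAncestral_sdiff_sdiff (hs : IsSplit H N U Z) (hZW : Z ⊆ W)
    (hpast : ∀ u v, G.Adj u v → v ∈ N \ W → H.Adj u v ∧ u ∉ W) :
    IsAncestral G ((N \ U) \ W) := by
  rintro u v huv ⟨⟨hvN, hvU⟩, hvW⟩
  obtain ⟨huvH, huW⟩ := hpast u v huv ⟨hvN, hvW⟩
  refine ⟨⟨hs.isAncestral u v huvH hvN, fun huU => ?_⟩, huW⟩
  have hmeet : ¬ Disjoint (insert v {u | H.Adj u v}) U :=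
    Set.not_disjoint_iff.2 ⟨u, .inr huvH, huU⟩
  exact (hs.insert_parents_subset v hvN hmeet (Set.mem_insert _ _)).elim hvU
    fun hvZ => hvW (hZW hvZ)

end LinkedAncestors

section Marginalization

theorem lintegral_mul_of_indep_of_dependsOn {V : Type*} {Ω : V → Type*}
    [∀ v, MeasurableSpace (Ω v)] [∀ v, Nonempty (Ω v)] {P : Measure (∀ v, Ω v)} {A B : Set V}
    (hAB : Indep (cylinderEvents A) (cylinderEvents B) P) {f g : (∀ v, Ω v) → ℝ≥0∞}
    (hf : Measurable f) (hfA : DependsOn f A) (hg : Measurable g) (hgB : DependsOn g B) :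
    ∫⁻ ω, f ω * g ω ∂P = (∫⁻ ω, f ω ∂P) * ∫⁻ ω, g ω ∂P :=
  lintegral_mul_eq_lintegral_mul_lintegral_of_independent_measurableSpace cylinderEvents_le_pi
    cylinderEvents_le_pi hAB (measurable_cylinderEvents_of_dependsOn hf hfA)
    (measurable_cylinderEvents_of_dependsOn hg hgB)

variable {V : Type*} [DecidableEq V] {Ω : V → Type*} [∀ v, MeasurableSpace (Ω v)]
  [∀ v, DiscreteMeasurableSpace (Ω v)] [∀ v, Countable (Ω v)] {G H : Digraph V}
  {φ ψ : V → (∀ v, Ω v) → ℝ≥0∞}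

open Classical in
theorem IsFactorSystem.margProd_filter_of_isAncestral (hG : IsAcyclic G) (hφ : IsFactorSystem G φ)
    {N : Set V} (hN : IsAncestral G N) {h : (∀ v, Ω v) → ℝ≥0∞} (hh : Measurable h)
    (hdep : DependsOn h N) (W : Finset V) :
    margProd φ W h = margProd φ (W.filter (· ∈ N)) h :=
  hφ.margProd_eq_of_subset hG (Finset.filter_subset _ _)
    (fun u v huv hv hu => Finset.mem_filter.2 ⟨hu, hN u v huv (Finset.mem_filter.1 hv).2⟩) hh
    (hdep.mono fun _ hv hvW => Finset.mem_filter.2 ⟨hvW, hv⟩)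

theorem IsFactorSystem.margProd_congr_of_isAncestral (hG : IsAcyclic G) (hφ : IsFactorSystem G φ)
    (hH : IsAcyclic H) (hψ : IsFactorSystem H ψ) {N : Set V} (hGN : IsAncestral G N)
    (hHN : IsAncestral H N) (hφψ : ∀ v ∈ N, φ v = ψ v) {h : (∀ v, Ω v) → ℝ≥0∞}
    (hh : Measurable h) (hdep : DependsOn h N) (W : Finset V) :
    margProd φ W h = margProd ψ W h := by
  classical
  rw [hφ.margProd_filter_of_isAncestral hG hGN hh hdep,
    hψ.margProd_filter_of_isAncestral hH hHN hh hdep]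
  unfold margProd
  congr 1
  funext η
  rw [Finset.prod_congr rfl fun v hv => by rw [hφψ v (Finset.mem_filter.1 hv).2]]

end Marginalization

section PartialSum

variable {V : Type*} [DecidableEq V] {Ω : V → Type*} [∀ v, MeasurableSpace (Ω v)] {G : Digraph V}
  {φ : V → (∀ v, Ω v) → ℝ≥0∞}

/-- The sum of `h · ∏ v ∈ B, φ v` over all values of the variables in `A`, where the variables in
`Z` have their values in `ζ`. -/
noncomputable def partialSum (φ : V → (∀ v, Ω v) → ℝ≥0∞) (A B Z : Finset V) (ζ : ∀ v, Ω v)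
    (h : (∀ v, Ω v) → ℝ≥0∞) (ω : ∀ v, Ω v) : ℝ≥0∞ :=
  lmarginal (fun _ => Measure.count) A (fun η => h η * ∏ v ∈ B, φ v η)
    (Function.updateFinset ω Z fun v => ζ v)

theorem IsFactorSystem.dependsOn_mul_prod (hφ : IsFactorSystem G φ) {B : Finset V} {D : Set V}
    {h : (∀ v, Ω v) → ℝ≥0∞} (hdep : DependsOn h D)
    (hB : ∀ v ∈ B, insert v {u | G.Adj u v} ⊆ D) :
    DependsOn (fun η => h η * ∏ v ∈ B, φ v η) D :=
  dependsOn_mul hdep (dependsOn_prod fun v hv => (hφ.dependsOn v).mono (hB v hv))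

theorem IsFactorSystem.dependsOn_partialSum (hφ : IsFactorSystem G φ) (A : Finset V)
    {B : Finset V} (Z : Finset V) (ζ : ∀ v, Ω v) {D : Set V} {h : (∀ v, Ω v) → ℝ≥0∞}
    (hdep : DependsOn h D) (hB : ∀ v ∈ B, insert v {u | G.Adj u v} ⊆ D) :
    DependsOn (partialSum φ A B Z ζ h) ((D \ A) \ Z) :=
  (dependsOn_lmarginal (hφ.dependsOn_mul_prod hdep hB)).updateFinset _

theorem IsFactorSystem.measurable_partialSum [∀ v, DiscreteMeasurableSpace (Ω v)]
    [∀ v, Countable (Ω v)] (hφ : IsFactorSystem G φ) (A B Z : Finset V) (ζ : ∀ v, Ω v)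
    {h : (∀ v, Ω v) → ℝ≥0∞} (hh : Measurable h) : Measurable (partialSum φ A B Z ζ h) :=
  ((hφ.measurable_mul_prod B hh).lmarginal _).comp measurable_updateFinset_left

end PartialSum

section Factorization

variable {S : Type*} [DecidableEq S] {Ω : S × ℤ → Type*} [∀ v, MeasurableSpace (Ω v)]
  [∀ v, DiscreteMeasurableSpace (Ω v)] [∀ v, Countable (Ω v)]

theorem lmarginal_eventInd_mul (Z : Finset (S × ℤ)) (ζ : ∀ v, Ω v) (f : (∀ v, Ω v) → ℝ≥0∞)
    (ω : ∀ v, Ω v) :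
    lmarginal (fun _ => Measure.count) Z (fun η => eventInd Z ζ η * f η) ω
      = f (Function.updateFinset ω Z fun v => ζ v) := by
  classical
  rw [lmarginal_count, tsum_eq_single fun v : Z => ζ v]
  · rw [eventInd_apply, if_pos, one_mul]
    intro v hv
    simp [Function.updateFinset, hv]
  · intro w hw
    rw [eventInd_apply, if_neg, zero_mul]
    refine fun hζ => hw (funext fun v => ?_)
    rw [← hζ v v.2]
    simp [Function.updateFinset]

theorem lmarginal_eventInd_mul_mul {Z A₁ A₂ : Finset (S × ℤ)} (hZ : Disjoint Z (A₁ ∪ A₂))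
    (hA : Disjoint A₁ A₂) (ζ : ∀ v, Ω v) {f₁ f₂ : (∀ v, Ω v) → ℝ≥0∞} (hf₁ : Measurable f₁)
    (hf₂ : Measurable f₂) (hdep₁ : DependsOn f₁ {v | v ∉ A₂}) (hdep₂ : DependsOn f₂ {v | v ∉ A₁})
    (ω : ∀ v, Ω v) :
    lmarginal (fun _ => Measure.count) (Z ∪ (A₁ ∪ A₂))
        (fun η => eventInd Z ζ η * (f₁ η * f₂ η)) ω
      = lmarginal (fun _ => Measure.count) A₁ f₁ (Function.updateFinset ω Z fun v => ζ v) *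
        lmarginal (fun _ => Measure.count) A₂ f₂ (Function.updateFinset ω Z fun v => ζ v) := by
  have hind : lmarginal (fun _ => Measure.count) (A₁ ∪ A₂)
      (fun η => eventInd Z ζ η * (f₁ η * f₂ η)) = fun η => eventInd Z ζ η *
        lmarginal (fun _ => Measure.count) (A₁ ∪ A₂) (fun η => f₁ η * f₂ η) η := by
    funext η
    simp_rw [mul_comm (eventInd Z ζ _)]
    exact lmarginal_mul_of_dependsOn (hf₁.fun_mul hf₂)
      ((dependsOn_eventInd Z ζ).mono fun v hv => Finset.disjoint_left.1 hZ hv) η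
  have hinner : lmarginal (fun _ => Measure.count) A₂ (fun η => f₁ η * f₂ η)
      = fun η => f₁ η * lmarginal (fun _ => Measure.count) A₂ f₂ η := by
    funext η
    simp_rw [mul_comm (f₁ _)]
    exact lmarginal_mul_of_dependsOn hf₂ hdep₁ η
  rw [lmarginal_union _ _ ((measurable_eventInd Z ζ).fun_mul (hf₁.fun_mul hf₂)) hZ, hind,
    lmarginal_eventInd_mul, lmarginal_union _ _ (hf₁.fun_mul hf₂) hA, hinner,
    lmarginal_mul_of_dependsOn hf₁ ((dependsOn_lmarginal hdep₂).mono Set.sdiff_subset)]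

variable {H : Digraph (S × ℤ)} {φ : S × ℤ → (∀ v, Ω v) → ℝ≥0∞} {N U : Set (S × ℤ)}
  {W Z : Finset (S × ℤ)} {h₁ h₂ : (∀ v, Ω v) → ℝ≥0∞}

open Classical in
theorem IsSplit.filter_eq_union (hs : IsSplit H N U Z) (hZW : Z ⊆ W) :
    W.filter (· ∈ N) = Z ∪ (W.filter (· ∈ N \ (U ∪ Z)) ∪ W.filter (· ∈ U)) := by
  ext v
  have hUN := @hs.subset v
  have hZN := @hs.subset_right v
  have hZW := @hZW v
  simp only [Finset.mem_filter, Finset.mem_union, Set.mem_sdiff, Set.mem_union,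
    Finset.mem_coe] at hZN ⊢
  tauto

open Classical in
theorem IsSplit.disjoint_filter_union (hs : IsSplit H N U Z) (W : Finset (S × ℤ)) :
    Disjoint Z (W.filter (· ∈ N \ (U ∪ Z)) ∪ W.filter (· ∈ U)) := by
  refine Finset.disjoint_left.2 fun v hvZ hv => ?_
  rcases Finset.mem_union.1 hv with hv | hv
  · exact (Finset.mem_filter.1 hv).2.2 (.inr hvZ)
  · exact Set.disjoint_left.1 hs.disjoint (Finset.mem_filter.1 hv).2 hvZ

open Classical in
theorem IsFactorSystem.margProd_eventInd_mul_mul (hH : IsAcyclic H) (hφ : IsFactorSystem H φ)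
    (hs : IsSplit H N U Z) (hZW : Z ⊆ W) (ζ : ∀ v, Ω v) (hh₁ : Measurable h₁)
    (hh₂ : Measurable h₂) (hdep₁ : DependsOn h₁ (N \ U)) (hdep₂ : DependsOn h₂ U) :
    margProd φ W (fun η => eventInd Z ζ η * (h₁ η * h₂ η)) = fun ω =>
      partialSum φ (W.filter (· ∈ N \ (U ∪ Z)))
          (W.filter fun v => v ∈ N ∧ Disjoint (insert v {u | H.Adj u v}) U) Z ζ h₁ ω *
        partialSum φ (W.filter (· ∈ U))
          (W.filter fun v => v ∈ N ∧ ¬ Disjoint (insert v {u | H.Adj u v}) U) Z ζ h₂ ω := by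
  funext ω
  have hregroup : ∀ η, eventInd Z ζ η * (h₁ η * h₂ η) * ∏ v ∈ W.filter (· ∈ N), φ v η
      = eventInd Z ζ η *
        ((h₁ η * ∏ v ∈ W with v ∈ N ∧ Disjoint (insert v {u | H.Adj u v}) U, φ v η) *
          (h₂ η * ∏ v ∈ W with v ∈ N ∧ ¬ Disjoint (insert v {u | H.Adj u v}) U, φ v η)) := by
    intro η
    rw [← Finset.prod_filter_mul_prod_filter_not (W.filter (· ∈ N))
      fun v => Disjoint (insert v {u | H.Adj u v}) U, Finset.filter_filter, Finset.filter_filter]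
    ring
  rw [hφ.margProd_filter_of_isAncestral hH hs.isAncestral
    ((measurable_eventInd Z ζ).fun_mul (hh₁.fun_mul hh₂))
    (dependsOn_mul ((dependsOn_eventInd Z ζ).mono hs.subset_right)
      (dependsOn_mul (hdep₁.mono Set.sdiff_subset) (hdep₂.mono hs.subset)))]
  simp_rw [margProd, hregroup]
  rw [hs.filter_eq_union hZW, lmarginal_eventInd_mul_mul (hs.disjoint_filter_union W)
    (Finset.disjoint_filter.2 fun v _ hv hvU => hv.2 (.inl hvU)) ζ
    (hφ.measurable_mul_prod _ hh₁) (hφ.measurable_mul_prod _ hh₂)]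
  · rfl
  · refine (hφ.dependsOn_mul_prod hdep₁ fun v hv => ?_).mono fun v hv hvU =>
      hv.2 (Finset.mem_filter.1 hvU).2
    exact hs.insert_parents_subset_sdiff (Finset.mem_filter.1 hv).2.1 (Finset.mem_filter.1 hv).2.2
  · refine (hφ.dependsOn_mul_prod (hdep₂.mono Set.subset_union_left) fun v hv => ?_).mono
      fun v hv hvU => (Finset.mem_filter.1 hvU).2.2 hv
    exact hs.insert_parents_subset v (Finset.mem_filter.1 hv).2.1 (Finset.mem_filter.1 hv).2.2

open Classical in
theorem IsFactorSystem.lintegral_margProd_eventInd_mul_mul [∀ v, Nonempty (Ω v)]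
    {P : Measure (∀ v, Ω v)} (hH : IsAcyclic H) (hφ : IsFactorSystem H φ)
    (hs : IsSplit H N U Z) (hZW : Z ⊆ W)
    (hP : Indep (cylinderEvents ((N \ U) \ W)) (cylinderEvents (U \ W)) P) (ζ : ∀ v, Ω v)
    (hh₁ : Measurable h₁) (hh₂ : Measurable h₂) (hdep₁ : DependsOn h₁ (N \ U))
    (hdep₂ : DependsOn h₂ U) :
    ∫⁻ ω, margProd φ W (fun η => eventInd Z ζ η * (h₁ η * h₂ η)) ω ∂P
      = (∫⁻ ω, partialSum φ (W.filter (· ∈ N \ (U ∪ Z)))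
          (W.filter fun v => v ∈ N ∧ Disjoint (insert v {u | H.Adj u v}) U) Z ζ h₁ ω ∂P) *
        ∫⁻ ω, partialSum φ (W.filter (· ∈ U))
          (W.filter fun v => v ∈ N ∧ ¬ Disjoint (insert v {u | H.Adj u v}) U) Z ζ h₂ ω ∂P := by
  rw [hφ.margProd_eventInd_mul_mul hH hs hZW ζ hh₁ hh₂ hdep₁ hdep₂]
  refine lintegral_mul_of_indep_of_dependsOn hP (hφ.measurable_partialSum _ _ _ _ hh₁)
    ((hφ.dependsOn_partialSum _ _ ζ hdep₁ fun v hv => ?_).mono ?_)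
    (hφ.measurable_partialSum _ _ _ _ hh₂)
    ((hφ.dependsOn_partialSum (D := U ∪ Z) _ _ ζ (hdep₂.mono Set.subset_union_left)
      fun v hv => ?_).mono ?_)
  · exact hs.insert_parents_subset_sdiff (Finset.mem_filter.1 hv).2.1 (Finset.mem_filter.1 hv).2.2
  · rintro v ⟨⟨⟨hvN, hvU⟩, hvA⟩, hvZ⟩
    exact ⟨⟨hvN, hvU⟩, fun hvW => hvA (Finset.mem_filter.2 ⟨hvW, hvN, not_or.2 ⟨hvU, hvZ⟩⟩)⟩
  · exact hs.insert_parents_subset v (Finset.mem_filter.1 hv).2.1 (Finset.mem_filter.1 hv).2.2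
  · rintro v ⟨⟨hvUZ, hvA⟩, hvZ⟩
    have hvU : v ∈ U := hvUZ.resolve_right hvZ
    exact ⟨hvU, fun hvW => hvA (Finset.mem_filter.2 ⟨hvW, hvU⟩)⟩

omit [DecidableEq S] in
theorem IsFTCG.time_le_of_isDescendant {G : Digraph (S × ℤ)} (hG : IsFTCG G) {u v : S × ℤ}
    (huv : IsDescendant G u v) : u.2 ≤ v.2 := by
  induction huv with
  | refl => rfl
  | tail _ hbc ih => exact ih.trans (hG.forward _ _ hbc)

variable [Fintype S] [∀ v, Nonempty (Ω v)] {G : Digraph (S × ℤ)} {P : Measure (∀ v, Ω v)}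

theorem IsFactorSystem.exists_lintegral_margProd_eq_mul (hG : IsFTCG G) (hHG : H ≤ G)
    (hP : ∀ A B : Set (S × ℤ), IsAncestral G A → IsAncestral G B → Disjoint A B →
      Indep (cylinderEvents A) (cylinderEvents B) P)
    {X Y : Finset (S × ℤ)} {a b : ℤ} (hXYZ : X ∪ Y ∪ Z ⊆ window a b) (hYZ : Disjoint Y Z)
    (hpast : ∀ u v, G.Adj u v → u.2 < a → H.Adj u v)
    (hC : ¬ IsConnected H (X : Set (S × ℤ)) Y Z) (hφ : IsFactorSystem H φ) (ζ : ∀ v, Ω v) :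
    ∃ Φ Ψ : ((∀ v, Ω v) → ℝ≥0∞) → ℝ≥0∞, ∀ h₁ h₂, Measurable h₁ → Measurable h₂ →
      DependsOn h₁ (X : Set (S × ℤ)) → DependsOn h₂ (Y : Set (S × ℤ)) →
      ∫⁻ ω, margProd φ (window a b) (fun η => eventInd Z ζ η * (h₁ η * h₂ η)) ω ∂P
        = Φ h₁ * Ψ h₂ := by
  have hs := isSplit_linkedAnc hC
  have hZW : (Z : Set (S × ℤ)) ⊆ window (S := S) a b :=
    Finset.coe_subset.2 (Finset.union_subset_right hXYZ)
  have hanc_le : ∀ v ∈ ancestors H ((X : Set (S × ℤ)) ∪ Y ∪ Z), v.2 ≤ b := by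
    rintro v ⟨t, ht, hvt⟩
    have htW : t ∈ X ∪ Y ∪ Z := by exact_mod_cast ht
    exact (hG.time_le_of_isDescendant (hvt.mono hHG)).trans (mem_window.1 (hXYZ htW)).2
  have hout : ∀ u v, G.Adj u v →
      v ∈ ancestors H ((X : Set (S × ℤ)) ∪ Y ∪ Z) \ (window (S := S) a b : Set (S × ℤ)) →
      H.Adj u v ∧ u ∉ (window (S := S) a b : Set (S × ℤ)) := by
    rintro u v huv ⟨hv, hvW⟩
    have hva : v.2 < a := not_le.1 fun hav => hvW (mem_window.2 ⟨hav, hanc_le v hv⟩)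
    have hua : u.2 < a := (hG.forward u v huv).trans_lt hva
    exact ⟨hpast u v huv hua, fun huW => hua.not_ge (mem_window.1 huW).1⟩
  have hind := hP _ _ (hs.isAncestral_sdiff_sdiff hZW hout) (hs.isAncestral_sdiff hZW hout)
    (Set.disjoint_left.2 fun v hv hv' => hv.1.2 hv'.1)
  exact ⟨_, _, fun h₁ h₂ hh₁ hh₂ hdep₁ hdep₂ => hφ.lintegral_margProd_eventInd_mul_mul
    (hG.acyclic.mono hHG) hs hZW hind ζ hh₁ hh₂
    (hdep₁.mono (Set.subset_sdiff.2 ⟨(Set.subset_union_left.trans Set.subset_union_left).trans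
      (subset_ancestors H _), disjoint_linkedAnc_of_not_isConnected hC⟩))
    (hdep₂.mono (subset_linkedAnc (Finset.disjoint_coe.2 hYZ)))⟩

end Factorization

section Soundness

variable {S : Type*} {Ω : S × ℤ → Type*}

theorem event_eq_event_updateFinset [DecidableEq S] (ξ : ∀ v, Ω v) {A : Finset (S × ℤ)}
    (z : ∀ v : A, Ω v) : event A z = event A fun v => Function.updateFinset ξ A z v := by
  congr 1
  funext v
  simp [Function.updateFinset]

theorem exists_eq_restrict [∀ v, Nonempty (Ω v)] {A : Finset (S × ℤ)} (z : ∀ v : A, Ω v) :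
    ∃ ζ : ∀ v, Ω v, z = fun v : A => ζ v := by
  classical
  refine ⟨Function.updateFinset (fun v => Classical.arbitrary _) A z, ?_⟩
  funext v
  simp [Function.updateFinset]

theorem tsum_eventInd_updateFinset [DecidableEq S] (A : Finset (S × ℤ)) (ξ η : ∀ v, Ω v) :
    ∑' z : ∀ v : A, Ω v, eventInd A (Function.updateFinset ξ A z) η = 1 := by
  classical
  rw [tsum_eq_single fun v : A => η v]
  · rw [eventInd_apply, if_pos]
    intro v hv
    simp [Function.updateFinset, hv]
  · intro z hz
    rw [eventInd_apply, if_neg]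
    refine fun hη => hz (funext fun v => ?_)
    rw [hη v v.2]
    simp [Function.updateFinset]

variable [∀ v, MeasurableSpace (Ω v)]

section EventInd

variable [∀ v, DiscreteMeasurableSpace (Ω v)] (P : Measure (∀ v, Ω v)) (A B C : Finset (S × ℤ))
  (ξ υ ζ : ∀ v, Ω v)

theorem lintegral_eventInd_mul_eventInd :
    ∫⁻ ω, eventInd A ξ ω * eventInd B υ ω ∂P
      = P ((event A fun v => ξ v) ∩ event B fun v => υ v) := by
  rw [← lintegral_indicator_one ((measurableSet_event _ _).inter (measurableSet_event _ _)),
    Set.inter_indicator_one]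
  rfl

theorem lintegral_eventInd_mul_eventInd_mul_eventInd :
    ∫⁻ ω, eventInd A ξ ω * eventInd B υ ω * eventInd C ζ ω ∂P
      = P (((event A fun v => ξ v) ∩ event B fun v => υ v) ∩ event C fun v => ζ v) := by
  rw [← lintegral_indicator_one (((measurableSet_event _ _).inter (measurableSet_event _ _)).inter
    (measurableSet_event _ _)), Set.inter_indicator_one, Set.inter_indicator_one]
  rfl

end EventInd

variable {G : Digraph (S × ℤ)} {κ : Mechanisms G Ω} {P : Measure (∀ v, Ω v)}

/-- The parents in `X` through which proper causal paths from `X` to `Y` enter a variable. -/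
def backdoorCut (G : Digraph (S × ℤ)) (X Y : Set (S × ℤ)) (v : S × ℤ) : Set (S × ℤ) :=
  {u | u ∈ X ∧ IsCausalNode G X Y v}

theorem cutGraph_backdoorCut (G : Digraph (S × ℤ)) (X Y : Set (S × ℤ)) :
    cutGraph G (backdoorCut G X Y) = backdoorGraph G X Y :=
  rfl

theorem factor_eq_of_forall_eq (κ : Mechanisms G Ω) {ξ η : ∀ v, Ω v} {C : S × ℤ → Set (S × ℤ)}
    {v : S × ℤ} (hC : ∀ u, G.Adj u v → u ∈ C v → η u = ξ u) :
    factor κ ξ C v η = factor κ ξ (fun _ => ∅) v η := by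
  unfold factor
  congr 2
  funext u
  simp only [Set.mem_empty_iff_false, if_false]
  split_ifs with hu
  · exact (hC u u.2 hu).symm
  · rfl

variable [DecidableEq S]

theorem margProd_factor_mul_eventInd (κ : Mechanisms G Ω) (ξ : ∀ v, Ω v) {X : Finset (S × ℤ)}
    {C : S × ℤ → Set (S × ℤ)} (hC : ∀ v, C v ⊆ X) (W : Finset (S × ℤ))
    (h : (∀ v, Ω v) → ℝ≥0∞) :
    margProd (factor κ ξ C) W (fun η => h η * eventInd X ξ η)
      = margProd (factor κ ξ fun _ => ∅) W (fun η => h η * eventInd X ξ η) := by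
  unfold margProd
  congr 1
  funext η
  by_cases hη : ∀ u ∈ X, η u = ξ u
  · simp_rw [factor_eq_of_forall_eq κ fun u _ hu => hη u (hC _ hu)]
  · simp only [eventInd_apply, if_neg hη, mul_zero, zero_mul]

theorem margProd_doFactor_eq (κ : Mechanisms G Ω) (ξ : ∀ v, Ω v) {X W : Finset (S × ℤ)}
    (hX : X ⊆ W) {C : S × ℤ → Set (S × ℤ)} (hC : ∀ v, C v ⊆ X) (h : (∀ v, Ω v) → ℝ≥0∞) :
    margProd (doFactor κ ξ X C) W h = margProd (doFactor κ ξ X fun _ => ∅) W h := by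
  unfold margProd
  congr 1
  funext η
  congr 1
  by_cases hη : ∀ u ∈ X, η u = ξ u
  · refine Finset.prod_congr rfl fun v _ => ?_
    rw [doFactor, doFactor, factor_eq_of_forall_eq κ fun u _ hu => hη u (hC _ hu)]
  · push Not at hη
    obtain ⟨u, hu, hne⟩ := hη
    have hzero : ∀ C, ∏ v ∈ W, doFactor κ ξ X C v η = 0 := fun C =>
      Finset.prod_eq_zero (hX hu) (by rw [doFactor, if_pos hu, if_neg hne])
    rw [hzero, hzero]

theorem adjustedProb_eq_tsum [IsProbabilityMeasure P] (X Y Z : Finset (S × ℤ))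
    (x : ∀ v : X, Ω v) (y : ∀ v : Y, Ω v) :
    adjustedProb P X Y Z x y
      = ∑' z : ∀ v : Z, Ω v, cond P (event X x ∩ event Z z) (event Y y) * P (event Z z) := by
  unfold adjustedProb
  split_ifs with hZ
  · subst hZ
    have huniv : ∀ z : ∀ v : (∅ : Finset (S × ℤ)), Ω v, event ∅ z = Set.univ := fun z =>
      Set.eq_univ_of_forall fun ω v => absurd v.2 (Finset.notMem_empty _)
    simp only [huniv, Set.inter_univ, measure_univ, mul_one]
    rw [tsum_fintype, Fintype.sum_unique]
  · rfl

theorem inv_mul_mul_mul_cancel {a b c d : ℝ≥0∞} (hcb : c * b ≠ ⊤) (hpos : a * b ≠ 0 → c * b ≠ 0)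
    (hle : a * d ≤ a * b) : (c * b)⁻¹ * (c * d) * (a * b) = a * d := by
  by_cases hab : a * b = 0
  · rw [hab, mul_zero, eq_comm, ← nonpos_iff_eq_zero]
    exact hle.trans hab.le
  · calc (c * b)⁻¹ * (c * d) * (a * b) = (c * b)⁻¹ * (c * b) * (a * d) := by ring
      _ = a * d := by rw [ENNReal.inv_mul_cancel (hpos hab) hcb, one_mul]

variable [∀ v, DiscreteMeasurableSpace (Ω v)] [∀ v, Countable (Ω v)]

theorem IsFactorSystem.tsum_lintegral_margProd {H : Digraph (S × ℤ)}
    {φ : S × ℤ → (∀ v, Ω v) → ℝ≥0∞} (hφ : IsFactorSystem H φ) (P : Measure (∀ v, Ω v))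
    (W A : Finset (S × ℤ)) (ξ : ∀ v, Ω v) {h : (∀ v, Ω v) → ℝ≥0∞} (hh : Measurable h) :
    ∑' z : ∀ v : A, Ω v,
        ∫⁻ ω, margProd φ W (fun η => eventInd A (Function.updateFinset ξ A z) η * h η) ω ∂P
      = ∫⁻ ω, margProd φ W h ω ∂P := by
  rw [← lintegral_tsum fun z => (hφ.measurable_margProd W
    ((measurable_eventInd A _).fun_mul hh)).aemeasurable]
  refine lintegral_congr fun ω => ?_
  simp_rw [margProd, lmarginal_count]
  rw [ENNReal.tsum_comm]
  refine tsum_congr fun w => ?_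
  simp_rw [mul_assoc]
  rw [ENNReal.tsum_mul_right, tsum_eventInd_updateFinset, one_mul]

variable [Fintype S] [∀ v, Nonempty (Ω v)] {X Y Z : Finset (S × ℤ)} {a b : ℤ}

theorem IsCompatible.doProb_eq_lintegral_margProd_backdoor (hG : IsFTCG G)
    (hP : IsCompatible G κ P) (hXY : Disjoint X Y) (hX : X ⊆ window a b) (hY : Y ⊆ window a b)
    (ξ υ : ∀ v, Ω v) :
    doProb κ P X Y (fun v => ξ v) (fun v => υ v)
      = ∫⁻ ω, margProd (factor κ ξ (backdoorCut G X Y)) (window a b) (eventInd Y υ) ω ∂P := by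
  have hcut : IsAcyclic (cutGraph G (backdoorCut G X Y)) := hG.acyclic.mono (cutGraph_le G _)
  have hanc := isAncestral_ancestors (cutGraph G (backdoorCut G X Y)) Y
  rw [hP.doProb_eq_lintegral_margProd_window hG ξ υ hX hY,
    ← margProd_doFactor_eq κ ξ hX (C := backdoorCut G X Y) fun v u hu => hu.1,
    (isFactorSystem_doFactor hG.acyclic hP.isMarkovKernel ξ X _).margProd_congr_of_isAncestral hcut
      hcut (isFactorSystem_factor hG.acyclic hP.isMarkovKernel ξ _) hanc hanc (fun v hv => ?_)
      (measurable_eventInd Y υ) ((dependsOn_eventInd Y υ).mono (subset_ancestors _ _))]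
  rw [cutGraph_backdoorCut] at hv
  exact doFactor_of_notMem κ ξ _
    (IsCausalNode.of_mem_ancestors_backdoorGraph (Finset.disjoint_coe.2 hXY) hv).1

theorem IsCompatible.measure_event_eq_lintegral_margProd_backdoor (hG : IsFTCG G)
    (hP : IsCompatible G κ P) (hF : AvoidsForbidden G (X : Set (S × ℤ)) Y Z)
    (hZ : Z ⊆ window a b) (ξ ζ : ∀ v, Ω v) :
    P (event Z fun v => ζ v)
      = ∫⁻ ω, margProd (factor κ ξ (backdoorCut G X Y)) (window a b) (eventInd Z ζ) ω ∂P := by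
  have hcut : ∀ C, IsAcyclic (cutGraph G C) := fun C => hG.acyclic.mono (cutGraph_le G C)
  have hfac := isFactorSystem_factor hG.acyclic hP.isMarkovKernel ξ
  have hanc : ∀ C, IsAncestral (cutGraph G C) (ancestors G Z) := fun C =>
    (isAncestral_ancestors G _).mono (cutGraph_le G C)
  rw [← lintegral_eventInd, ← hP.lintegral_margProd_factor ξ a b (measurable_eventInd Z ζ)
      ((dependsOn_eventInd Z ζ).mono fun v hv => (mem_window.1 (hZ hv)).2),
    (hfac _).margProd_congr_of_isAncestral (hcut _) (hcut _) (hfac (backdoorCut G X Y)) (hanc _)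
      (hanc _) (fun v hv => ?_) (measurable_eventInd Z ζ)
      ((dependsOn_eventInd Z ζ).mono (subset_ancestors _ _))]
  obtain ⟨z, hz, hvz⟩ := hv
  funext η
  exact (factor_eq_of_forall_eq κ fun u huv hu => absurd hvz (hF u hu.1 v huv hu.2 z hz)).symm

theorem IsCompatible.lintegral_margProd_factor_mul_eventInd (hP : IsCompatible G κ P)
    (ξ : ∀ v, Ω v) {C : S × ℤ → Set (S × ℤ)} (hC : ∀ v, C v ⊆ X) (hX : X ⊆ window a b)
    {h : (∀ v, Ω v) → ℝ≥0∞} (hh : Measurable h) (hdep : DependsOn h (window (S := S) a b)) :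
    ∫⁻ ω, margProd (factor κ ξ C) (window a b) (fun η => h η * eventInd X ξ η) ω ∂P
      = ∫⁻ ω, h ω * eventInd X ξ ω ∂P := by
  rw [margProd_factor_mul_eventInd κ ξ hC, hP.lintegral_margProd_factor ξ a b
    (hh.fun_mul (measurable_eventInd X ξ))
    ((dependsOn_mul hdep ((dependsOn_eventInd X ξ).mono hX)).mono fun v hv =>
      (mem_window.1 hv).2)]

theorem IsCompatible.measure_event_inter_eq_lintegral_margProd_backdoor (hP : IsCompatible G κ P)
    (hX : X ⊆ window a b) (hZ : Z ⊆ window a b) (ξ ζ : ∀ v, Ω v) :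
    P ((event X fun v => ξ v) ∩ event Z fun v => ζ v)
      = ∫⁻ ω, margProd (factor κ ξ (backdoorCut G X Y)) (window a b)
          (fun η => eventInd Z ζ η * eventInd X ξ η) ω ∂P := by
  rw [hP.lintegral_margProd_factor_mul_eventInd ξ (fun v u hu => hu.1) hX
    (measurable_eventInd Z ζ) ((dependsOn_eventInd Z ζ).mono hZ), lintegral_eventInd_mul_eventInd,
    Set.inter_comm]

theorem IsCompatible.measure_event_inter_inter_eq_lintegral_margProd_backdoor
    (hP : IsCompatible G κ P) (hX : X ⊆ window a b) (hY : Y ⊆ window a b)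
    (hZ : Z ⊆ window a b) (ξ υ ζ : ∀ v, Ω v) :
    P (((event X fun v => ξ v) ∩ event Z fun v => ζ v) ∩ event Y fun v => υ v)
      = ∫⁻ ω, margProd (factor κ ξ (backdoorCut G X Y)) (window a b)
          (fun η => eventInd Z ζ η * (eventInd X ξ η * eventInd Y υ η)) ω ∂P := by
  simp only [mul_comm (eventInd X ξ _), ← mul_assoc]
  rw [hP.lintegral_margProd_factor_mul_eventInd ξ (fun v u hu => hu.1) hX
    ((measurable_eventInd Z ζ).fun_mul (measurable_eventInd Y υ))
    (dependsOn_mul ((dependsOn_eventInd Z ζ).mono hZ) ((dependsOn_eventInd Y υ).mono hY)),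
    lintegral_eventInd_mul_eventInd_mul_eventInd, Set.inter_assoc, Set.inter_comm]

theorem IsCompatible.cond_mul_measure_event (hG : IsFTCG G) (hP : IsCompatible G κ P)
    (hYZ : Disjoint Y Z) (hF : AvoidsForbidden G (X : Set (S × ℤ)) Y Z)
    (hC : ¬ IsConnected (backdoorGraph G (X : Set (S × ℤ)) Y) (X : Set (S × ℤ)) Y Z)
    (hX : X ⊆ window a b) (hY : Y ⊆ window a b) (hZ : Z ⊆ window a b) {ξ υ ζ : ∀ v, Ω v}
    (hadm : P (event Z fun v => ζ v) ≠ 0 →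
      P ((event X fun v => ξ v) ∩ event Z fun v => ζ v) ≠ 0) :
    cond P ((event X fun v => ξ v) ∩ event Z fun v => ζ v) (event Y fun v => υ v) *
        P (event Z fun v => ζ v)
      = ∫⁻ ω, margProd (factor κ ξ (backdoorCut G X Y)) (window a b)
          (fun η => eventInd Z ζ η * eventInd Y υ η) ω ∂P := by
  have := hP.isProbabilityMeasure
  obtain ⟨Φ, Ψ, hΦΨ⟩ := IsFactorSystem.exists_lintegral_margProd_eq_mul hG backdoorGraph_le
    hP.indep_of_disjoint (Finset.union_subset (Finset.union_subset hX hY) hZ) hYZ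
    (fun u v huv hu => ⟨huv, fun hcut => hu.not_ge (mem_window.1 (hX hcut.1)).1⟩) hC
    (isFactorSystem_factor hG.acyclic hP.isMarkovKernel ξ (backdoorCut G X Y)) ζ
  have hmX := measurable_eventInd X ξ
  have hmY := measurable_eventInd Y υ
  have hdX := dependsOn_eventInd X ξ
  have hdY := dependsOn_eventInd Y υ
  have hdep_one : ∀ A : Set (S × ℤ), DependsOn (1 : (∀ v, Ω v) → ℝ≥0∞) A := fun _ _ _ _ => rfl
  have hΦΨ_one : ∀ h, Measurable h → DependsOn h (Y : Set (S × ℤ)) → _ = Φ 1 * Ψ h :=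
    fun h hh hdep => hΦΨ 1 h measurable_one hh (hdep_one _) hdep
  simp only [Pi.one_apply, one_mul] at hΦΨ_one
  have hz : P (event Z fun v => ζ v) = Φ 1 * Ψ 1 := by
    rw [hP.measure_event_eq_lintegral_margProd_backdoor hG hF hZ ξ ζ,
      ← hΦΨ_one 1 measurable_one (hdep_one _)]
    simp only [Pi.one_apply, mul_one]
  have hxz : P ((event X fun v => ξ v) ∩ event Z fun v => ζ v) = Φ (eventInd X ξ) * Ψ 1 := by
    rw [hP.measure_event_inter_eq_lintegral_margProd_backdoor (Y := Y) hX hZ,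
      ← hΦΨ _ 1 hmX measurable_one hdX (hdep_one _)]
    simp only [Pi.one_apply, mul_one]
  rw [cond_apply ((measurableSet_event _ _).inter (measurableSet_event _ _)),
    hP.measure_event_inter_inter_eq_lintegral_margProd_backdoor hX hY hZ,
    hΦΨ _ _ hmX hmY hdX hdY, hxz, hz, hΦΨ_one _ hmY hdY]
  refine inv_mul_mul_mul_cancel (hxz ▸ measure_ne_top _ _) (hxz ▸ hz ▸ hadm) ?_
  rw [← hΦΨ_one _ hmY hdY, ← hΦΨ_one _ measurable_one (hdep_one _)]
  refine lintegral_mono fun ω => lmarginal_mono (fun η => ?_) ω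
  dsimp only
  gcongr
  exact Set.indicator_le_self' (fun _ _ => zero_le) η

theorem IsCompatible.doProb_eq_adjustedProb (hG : IsFTCG G) (hP : IsCompatible G κ P)
    (hXY : Disjoint X Y) (hYZ : Disjoint Y Z) (hF : AvoidsForbidden G (X : Set (S × ℤ)) Y Z)
    (hC : ¬ IsConnected (backdoorGraph G (X : Set (S × ℤ)) Y) (X : Set (S × ℤ)) Y Z)
    (x : ∀ v : X, Ω v) (y : ∀ v : Y, Ω v) (hx : IsAdmissible P X Z x) :
    doProb κ P X Y x y = adjustedProb P X Y Z x y := by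
  have := hP.isProbabilityMeasure
  obtain ⟨ξ, rfl⟩ := exists_eq_restrict x
  obtain ⟨υ, rfl⟩ := exists_eq_restrict y
  obtain ⟨a, b, hW⟩ := exists_subset_window (X ∪ Y ∪ Z)
  have hX : X ⊆ window a b := Finset.union_subset_left (Finset.union_subset_left hW)
  have hY : Y ⊆ window a b := Finset.union_subset_right (Finset.union_subset_left hW)
  have hZ : Z ⊆ window a b := Finset.union_subset_right hW
  rw [hP.doProb_eq_lintegral_margProd_backdoor hG hXY hX hY ξ υ, adjustedProb_eq_tsum,
    ← (isFactorSystem_factor hG.acyclic hP.isMarkovKernel ξ _).tsum_lintegral_margProd P _ Z ξ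
      (measurable_eventInd Y υ)]
  refine tsum_congr fun z => ?_
  have hadm := hx z
  rw [event_eq_event_updateFinset ξ z] at hadm ⊢
  exact (hP.cond_mul_measure_event hG hYZ hF hC hX hY hZ hadm).symm

end Soundness

/-! ### Linear models over the field with two elements -/

section InfiniteProduct

variable {V : Type*} [DecidableEq V] {Ω : V → Type*} [∀ v, MeasurableSpace (Ω v)]

omit [∀ v, MeasurableSpace (Ω v)] in
theorem preimage_updateFinset_pi (W s : Finset V) (t : ∀ v, Set (Ω v)) :
    (fun p : (∀ v, Ω v) × (∀ v : W, Ω v) => Function.updateFinset p.1 W p.2) ⁻¹'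
        (s : Set V).pi t
      = ((s.filter (· ∉ W) : Finset V) : Set V).pi t ×ˢ
        ((s.subtype (· ∈ W) : Finset W) : Set W).pi fun v => t v := by
  ext p
  simp only [Set.mem_preimage, Set.mem_pi, Set.mem_prod, Finset.mem_coe, Finset.mem_filter,
    Finset.mem_subtype]
  refine ⟨fun hp => ⟨fun v hv => ?_, fun v hv => ?_⟩, fun hp v hv => ?_⟩
  · simpa [Function.updateFinset, hv.2] using hp v hv.1
  · simpa [Function.updateFinset] using hp v hv
  · by_cases hvW : v ∈ W
    · simpa [Function.updateFinset, hvW] using hp.2 ⟨v, hvW⟩ hv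
    · simpa [Function.updateFinset, hvW] using hp.1 v ⟨hv, hvW⟩

variable (μ : ∀ v, Measure (Ω v)) [∀ v, IsProbabilityMeasure (μ v)]

theorem map_updateFinset_infinitePi (W : Finset V) :
    ((Measure.infinitePi μ).prod (Measure.pi fun v : W => μ v)).map
      (fun p => Function.updateFinset p.1 W p.2) = Measure.infinitePi μ := by
  refine Measure.eq_infinitePi μ fun s t ht => ?_
  rw [Measure.map_apply measurable_updateFinset'
      (MeasurableSet.pi s.countable_toSet fun v _ => ht v), preimage_updateFinset_pi,
    Measure.prod_prod, ← Measure.infinitePi_eq_pi, Measure.infinitePi_pi _ fun v _ => ht v,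
    Measure.infinitePi_pi (fun v : W => μ v) (t := fun v => t v) fun v _ => ht v,
    Finset.prod_subtype_eq_prod_filter fun v => μ v (t v), mul_comm,
    Finset.prod_filter_mul_prod_filter_not]

theorem infinitePi_apply_eq_lintegral (W : Finset V) {T : Set (∀ v, Ω v)} (hT : MeasurableSet T) :
    Measure.infinitePi μ T
      = ∫⁻ n, Measure.pi (fun v : W => μ v) {m | Function.updateFinset n W m ∈ T}
          ∂Measure.infinitePi μ := by
  conv_lhs => rw [← map_updateFinset_infinitePi μ W]
  rw [Measure.map_apply measurable_updateFinset' hT,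
    Measure.prod_apply (measurable_updateFinset' hT)]
  rfl

end InfiniteProduct

noncomputable section Noise

variable {V : Type*}

/-- The law of a noise bit: `1` with probability `1/4`. -/
def noiseBit : Measure (ZMod 2) :=
  (3 / 4 : ℝ≥0∞) • Measure.dirac 0 + (1 / 4 : ℝ≥0∞) • Measure.dirac 1

theorem noiseBit_singleton_zero : noiseBit {0} = 3 / 4 := by
  simp [noiseBit]

theorem noiseBit_singleton_one : noiseBit {1} = 1 / 4 := by
  simp [noiseBit]

theorem noiseBit_singleton_ne_zero (b : ZMod 2) : noiseBit {b} ≠ 0 := by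
  obtain rfl | rfl : b = 0 ∨ b = 1 := by decide +revert
  · simp [noiseBit_singleton_zero]
  · simp [noiseBit_singleton_one]

instance : IsProbabilityMeasure noiseBit := by
  constructor
  simp only [noiseBit, Measure.coe_add, Measure.coe_smul, Pi.add_apply, Pi.smul_apply,
    measure_univ, smul_eq_mul, mul_one]
  rw [← ENNReal.add_div, show (3 : ℝ≥0∞) + 1 = 4 by norm_num]
  exact ENNReal.div_self (by simp) (by simp)

/-- The law of a family of independent noise bits. -/
def noise (V : Type*) : Measure (V → ZMod 2) := Measure.infinitePi fun _ => noiseBit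

instance : IsProbabilityMeasure (noise V) := by unfold noise; infer_instance

theorem noise_setOf_forall_mem_eq (F : Finset V) (n : V → ZMod 2) :
    noise V {m | ∀ v ∈ F, m v = n v} = ∏ v ∈ F, noiseBit {n v} := by
  rw [noise, ← Measure.infinitePi_pi _ fun _ _ => MeasurableSet.of_discrete]
  congr 1

theorem noise_setOf_forall_mem_eq_ne_zero (F : Finset V) (n : V → ZMod 2) :
    noise V {m | ∀ v ∈ F, m v = n v} ≠ 0 := by
  rw [noise_setOf_forall_mem_eq]
  exact Finset.prod_ne_zero_iff.2 fun v _ => noiseBit_singleton_ne_zero _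

theorem noise_setOf_eq (v : V) (b : ZMod 2) : noise V {n | n v = b} = noiseBit {b} := by
  simpa using noise_setOf_forall_mem_eq {v} fun _ => b

theorem noise_setOf_eq_and_eq {u v : V} (huv : u ≠ v) (b c : ZMod 2) :
    noise V {n | n u = b ∧ n v = c} = noiseBit {b} * noiseBit {c} := by
  classical
  simpa [Finset.prod_pair huv, huv.symm] using
    noise_setOf_forall_mem_eq {u, v} fun w => if w = u then b else c

end Noise

noncomputable section LinearModel

/-- The encoding of a bit as one of two distinct elements of `α`. -/
def enc (α : Type*) [Nontrivial α] (b : ZMod 2) : α :=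
  if b = 0 then (exists_pair_ne α).choose else (exists_pair_ne α).choose_spec.choose

open Classical in
/-- The bit that an element of `α` encodes; `0` for the elements that encode no bit. -/
def dec (α : Type*) [Nontrivial α] (o : α) : ZMod 2 := if o = enc α 1 then 1 else 0

theorem dec_enc {α : Type*} [Nontrivial α] (b : ZMod 2) : dec α (enc α b) = b := by
  have h : enc α 0 ≠ enc α 1 := by
    simpa [enc] using (exists_pair_ne α).choose_spec.choose_spec
  obtain rfl | rfl : b = 0 ∨ b = 1 := by decide +revert
  · simp [dec, h]
  · simp [dec]

theorem enc_injective {α : Type*} [Nontrivial α] : Function.Injective (enc α) :=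
  Function.LeftInverse.injective dec_enc

variable {V : Type*} {G : Digraph V}

open Classical in
/-- A linear structural equation model over `ZMod 2` with its solution `sol`: each variable `v` is
the sum of the variables in `par v` and, if `v` is noisy, of its noise bit. -/
structure LinearModel (G : Digraph V) where
  par : V → Finset V
  noisy : Set V
  sol : (V → ZMod 2) → V → ZMod 2
  adj_of_mem : ∀ {u v}, u ∈ par v → G.Adj u v
  measurable_sol : ∀ v, Measurable fun n => sol n v
  sol_eq : ∀ n v, sol n v = ∑ u ∈ par v, sol n u + if v ∈ noisy then n v else 0
  dependsOn_sol : ∀ v, DependsOn (fun n => sol n v) {u | IsDescendant G u v}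

theorem IsAncestral.mem_of_isDescendant {A : Set V} (hA : IsAncestral G A) {u v : V}
    (huv : IsDescendant G u v) (hv : v ∈ A) : u ∈ A := by
  induction huv using Relation.ReflTransGen.head_induction_on with
  | refl => exact hv
  | head huw _ hw => exact hA _ _ huw hw

namespace LinearModel

section Law

variable (M : LinearModel G) {Ω : V → Type*} [∀ v, Nontrivial (Ω v)]

open Classical in
/-- The value of `v` as a function of the values of its parents and of its noise bit. -/
def eqn (v : V) (η : ∀ v, Ω v) (b : ZMod 2) : Ω v :=
  enc (Ω v) (∑ u ∈ M.par v, dec (Ω u) (η u) + if v ∈ M.noisy then b else 0)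

/-- The configuration that solves the equations for the given noise. -/
def config (n : V → ZMod 2) (v : V) : Ω v := enc (Ω v) (M.sol n v)

theorem eqn_congr {v : V} {η η' : ∀ v, Ω v} (hη : ∀ u ∈ M.par v, η u = η' u) (b : ZMod 2) :
    M.eqn v η b = M.eqn v η' b := by
  unfold eqn
  rw [Finset.sum_congr rfl fun u hu => by rw [hη u hu]]

theorem config_eq_eqn (n : V → ZMod 2) (v : V) :
    M.config (Ω := Ω) n v = M.eqn v (M.config n) (n v) := by
  simp only [config, eqn, dec_enc, ← M.sol_eq]

variable [∀ v, MeasurableSpace (Ω v)]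

/-- The joint law of the variables. -/
def law (Ω : V → Type*) [∀ v, MeasurableSpace (Ω v)] [∀ v, Nontrivial (Ω v)] :
    Measure (∀ v, Ω v) :=
  (noise V).map M.config

theorem measurable_config : Measurable (M.config (Ω := Ω)) :=
  measurable_pi_lambda _ fun v => Measurable.of_discrete.comp (M.measurable_sol v)

theorem isProbabilityMeasure_law : IsProbabilityMeasure (M.law Ω) :=
  Measure.isProbabilityMeasure_map M.measurable_config.aemeasurable

theorem law_apply {B : Set (∀ v, Ω v)} (hB : MeasurableSet B) :
    M.law Ω B = noise V {n | M.config n ∈ B} :=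
  Measure.map_apply M.measurable_config hB

theorem measurable_config_cylinderEvents {A : Set V} (hA : IsAncestral G A) :
    Measurable[cylinderEvents (X := fun _ => ZMod 2) A, cylinderEvents A]
      (M.config (Ω := Ω)) := by
  rw [@measurable_cylinderEvents_iff]
  exact fun v hv => Measurable.of_discrete.comp <|
    measurable_cylinderEvents_of_dependsOn (M.measurable_sol v)
      ((M.dependsOn_sol v).mono fun u huv => hA.mem_of_isDescendant huv hv)

theorem indep_cylinderEvents_law {A B : Set V} (hA : IsAncestral G A) (hB : IsAncestral G B)
    (hAB : Disjoint A B) : Indep (cylinderEvents A) (cylinderEvents B) (M.law Ω) := by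
  have hnoise : Indep (cylinderEvents A) (cylinderEvents B) (noise V) :=
    indep_iSup_of_disjoint (fun v => (measurable_pi_apply v).comap_le)
      (iIndepFun_infinitePi (P := fun _ : V => noiseBit) (X := fun _ => id)
        fun _ => measurable_id) hAB
  rw [Indep_iff] at hnoise ⊢
  intro s t hs ht
  have hs' := cylinderEvents_le_pi _ hs
  have ht' := cylinderEvents_le_pi _ ht
  rw [M.law_apply (hs'.inter ht'), M.law_apply hs', M.law_apply ht']
  exact hnoise _ _ (M.measurable_config_cylinderEvents hA hs)
    (M.measurable_config_cylinderEvents hB ht)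

end Law

variable {S : Type*} {G : Digraph (S × ℤ)} (M : LinearModel G) {Ω : S × ℤ → Type*}
  [∀ v, Nontrivial (Ω v)]

section Resample

variable [DecidableEq S]

theorem config_updateFinset_of_time_lt (hG : IsFTCG G) {W : Finset (S × ℤ)} {v : S × ℤ}
    (hW : ∀ u ∈ W, v.2 < u.2) (n : S × ℤ → ZMod 2) (m : W → ZMod 2) :
    M.config (Ω := Ω) (Function.updateFinset n W m) v = M.config n v :=
  congrArg (enc (Ω v)) <| M.dependsOn_sol v fun u (huv : IsDescendant G u v) =>
    dif_neg fun hu => (hG.time_le_of_isDescendant huv).not_gt (hW u hu)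

variable [Fintype S]

theorem config_updateFinset_window (hG : IsFTCG G) {a b : ℤ}
    {w : ∀ v : (window a b : Finset (S × ℤ)), Ω v} {n : S × ℤ → ZMod 2}
    {m : ↥(window (S := S) a b) → ZMod 2} (v : (window a b : Finset (S × ℤ)))
    (hpar : ∀ u : (window a b : Finset (S × ℤ)), ↑u ∈ M.par v →
      M.config (Function.updateFinset n (window a b) m) u = w u) :
    M.config (Function.updateFinset n (window a b) m) v
      = M.eqn v (splice (window a b) w (M.config n)) (m v) := by
  have hmv : Function.updateFinset n (window a b) m v = m v := by simp [Function.updateFinset]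
  rw [M.config_eq_eqn, hmv]
  refine M.eqn_congr (fun u hu => ?_) _
  unfold splice
  split_ifs with huW
  · exact hpar ⟨u, huW⟩ hu
  · have huv := hG.forward u v (M.adj_of_mem hu)
    have hv := mem_window.1 v.2
    rw [mem_window] at huW
    refine M.config_updateFinset_of_time_lt hG (fun u' hu' => ?_) n m
    have hu' := mem_window.1 hu'
    omega

theorem config_updateFinset_window_mem_event (hG : IsFTCG G) {a b : ℤ}
    {w : ∀ v : (window a b : Finset (S × ℤ)), Ω v} {n : S × ℤ → ZMod 2}
    {m : ↥(window (S := S) a b) → ZMod 2} :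
    M.config (Function.updateFinset n (window a b) m) ∈ event (window a b) w
      ↔ ∀ v : (window a b : Finset (S × ℤ)),
        M.eqn v (splice (window a b) w (M.config n)) (m v) = w v := by
  classical
  refine ⟨fun hw v => ?_, fun hw v => ?_⟩
  · rw [← M.config_updateFinset_window hG v fun u _ => hw u]
    exact hw v
  by_contra hv
  let deviating : Finset (S × ℤ) := {v ∈ window a b | ∃ hv : v ∈ window a b,
    M.config (Function.updateFinset n (window a b) m) v ≠ w ⟨v, hv⟩}
  obtain ⟨u, hu, hsource⟩ := hG.acyclic.exists_source (F := deviating)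
    ⟨v, Finset.mem_filter.2 ⟨v.2, v.2, hv⟩⟩
  obtain ⟨-, huW, hu⟩ := Finset.mem_filter.1 hu
  refine hu ((M.config_updateFinset_window hG ⟨u, huW⟩ fun u' hu' => ?_).trans (hw ⟨u, huW⟩))
  by_contra hne
  exact hsource u' (Finset.mem_filter.2 ⟨u'.2, u'.2, hne⟩) (M.adj_of_mem hu')

end Resample

variable [∀ v, MeasurableSpace (Ω v)] [∀ v, DiscreteMeasurableSpace (Ω v)]

open Classical in
/-- The conditional distributions of the variables given their parents. -/
def mechanisms (Ω : S × ℤ → Type*) [∀ v, MeasurableSpace (Ω v)]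
    [∀ v, DiscreteMeasurableSpace (Ω v)] [∀ v, Nontrivial (Ω v)] : Mechanisms G Ω := fun v =>
  (Kernel.ofFunOfCountable fun s : ZMod 2 =>
      noiseBit.map fun b => enc (Ω v) (s + if v ∈ M.noisy then b else 0)).comap
    (fun η => ∑ u ∈ (M.par v).attach, dec (Ω u) (η ⟨u, M.adj_of_mem u.2⟩))
    (Finset.measurable_fun_sum _ fun u _ => (Measurable.of_discrete (f := dec (Ω u))).comp
      (measurable_pi_apply (⟨u, M.adj_of_mem u.2⟩ : {u // G.Adj u v})))

instance isMarkovKernel_mechanisms (v : S × ℤ) : IsMarkovKernel (M.mechanisms Ω v) :=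
  ⟨fun _ => Measure.isProbabilityMeasure_map Measurable.of_discrete.aemeasurable⟩

theorem mechanisms_singleton (v : S × ℤ) (η : ∀ v, Ω v) (o : Ω v) :
    M.mechanisms Ω v (fun u => η u) {o} = noiseBit {b | M.eqn v η b = o} := by
  change noiseBit.map _ _ = _
  rw [Measure.map_apply Measurable.of_discrete (measurableSet_singleton _)]
  unfold eqn
  rw [← Finset.sum_attach (M.par v) fun u => dec (Ω u) (η u)]
  rfl

variable [DecidableEq S] [Fintype S]

theorem pi_noiseBit_config_updateFinset_mem_event (hG : IsFTCG G) (a b : ℤ)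
    (w : ∀ v : (window a b : Finset (S × ℤ)), Ω v) (n : S × ℤ → ZMod 2) :
    Measure.pi (fun _ => noiseBit)
        {m | M.config (Function.updateFinset n (window a b) m) ∈ event (window a b) w}
      = factorProduct (M.mechanisms Ω) ∅ (window a b) w (M.config n) := by
  have hset : {m | M.config (Function.updateFinset n (window a b) m) ∈ event (window a b) w}
      = Set.univ.pi fun v : (window a b : Finset (S × ℤ)) =>
        {c | M.eqn v (splice (window a b) w (M.config n)) c = w v} := by
    ext m
    simp [M.config_updateFinset_window_mem_event hG]
  simp only [hset, Measure.pi_pi, factorProduct, Finset.notMem_empty, if_false,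
    M.mechanisms_singleton]

theorem law_inter_event_window (hG : IsFTCG G) (a b : ℤ) {B : Set (∀ v, Ω v)}
    (hB : MeasurableSet[cylinderEvents {v : S × ℤ | v.2 < a}] B)
    (w : ∀ v : (window a b : Finset (S × ℤ)), Ω v) :
    M.law Ω (B ∩ event (window a b) w)
      = ∫⁻ ω in B, factorProduct (M.mechanisms Ω) ∅ (window a b) w ω ∂(M.law Ω) := by
  have hB' := cylinderEvents_le_pi _ hB
  have hBw := hB'.inter (measurableSet_event (window a b) w)
  have hpast : ∀ n m, M.config (Function.updateFinset n (window a b) m) ∈ B ↔ M.config n ∈ B :=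
    fun n m => iff_of_eq <| dependsOn_of_measurableSet_cylinderEvents hB fun v (hv : v.2 < a) =>
      M.config_updateFinset_of_time_lt hG
        (fun u hu => hv.trans_le (mem_window.1 hu).1) n m
  rw [M.law_apply hBw, noise,
    infinitePi_apply_eq_lintegral _ (window a b) (by exact M.measurable_config hBw), ← noise, law,
    setLIntegral_map hB' (measurable_factorProduct _ ∅ _ w) M.measurable_config,
    ← lintegral_indicator (M.measurable_config hB')]
  refine lintegral_congr fun n => ?_
  simp only [Set.mem_ofPred_eq, Set.mem_inter_iff, hpast]
  by_cases hn : M.config n ∈ B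
  · rw [Set.indicator_of_mem (by exact hn), ← M.pi_noiseBit_config_updateFinset_mem_event hG a b]
    simp only [hn, true_and]
  · rw [Set.indicator_of_notMem (by exact hn)]
    simp only [hn, false_and, Set.ofPred_false, measure_empty]

theorem isCompatible (hG : IsFTCG G) : IsCompatible G (M.mechanisms Ω) (M.law Ω) where
  isProbabilityMeasure := M.isProbabilityMeasure_law
  isMarkovKernel := M.isMarkovKernel_mechanisms
  factorization a b _ hB w := M.law_inter_event_window hG a b hB w
  indep_of_disjoint _ _ := M.indep_cylinderEvents_law

end LinearModel

end LinearModel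

/-! ### A shortest chain of common ancestors -/

noncomputable section ShortestPath

open Relation

variable {V : Type*} {R : V → V → Prop}

/-- There is a walk of length `n` from `a` to `b`. -/
def StepN (R : V → V → Prop) : ℕ → V → V → Prop
  | 0, a, b => a = b
  | n + 1, a, b => ∃ c, R a c ∧ StepN R n c b

/-- The length of a shortest walk from `a` to `b`. It is `0` if there is no walk. -/
def stepDist (R : V → V → Prop) (a b : V) : ℕ :=
  sInf {n | StepN R n a b}

open Classical in
/-- The second vertex of a shortest walk from `v` to `t`. It is `v` if there is no such vertex. -/
def nextToward (R : V → V → Prop) (t v : V) : V :=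
  if h : ∃ c, R v c ∧ ReflTransGen R c t ∧ stepDist R v t = stepDist R c t + 1
  then h.choose else v

/-- The vertices on a shortest walk from `s` to `t`. The walk is chosen by `nextToward`, so that the
walks towards one target are compatible with each other. -/
def leg (R : V → V → Prop) (s t : V) : Set V :=
  {v | ∃ m ≤ stepDist R s t, v = (nextToward R t)^[m] s}

theorem exists_stepN {a b : V} (hab : ReflTransGen R a b) : ∃ n, StepN R n a b := by
  induction hab using ReflTransGen.head_induction_on with
  | refl => exact ⟨0, rfl⟩
  | head hac _ ih =>
    obtain ⟨n, hn⟩ := ih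
    exact ⟨n + 1, _, hac, hn⟩

theorem StepN.reflTransGen {n : ℕ} {a b : V} (hab : StepN R n a b) : ReflTransGen R a b := by
  induction n generalizing a with
  | zero => cases hab; exact .refl
  | succ n ih =>
    obtain ⟨c, hac, hcb⟩ := hab
    exact .head hac (ih hcb)

theorem stepN_stepDist {a b : V} (hab : ReflTransGen R a b) : StepN R (stepDist R a b) a b :=
  Nat.sInf_mem (s := {n | StepN R n a b}) (exists_stepN hab)

theorem StepN.stepDist_le {n : ℕ} {a b : V} (hab : StepN R n a b) : stepDist R a b ≤ n :=
  Nat.sInf_le hab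

theorem stepDist_self (a : V) : stepDist R a a = 0 :=
  Nat.le_zero.1 (StepN.stepDist_le (n := 0) rfl)

theorem eq_of_stepDist_eq_zero {a b : V} (hab : ReflTransGen R a b) (h0 : stepDist R a b = 0) :
    a = b := by
  have hwalk := stepN_stepDist hab
  rwa [h0] at hwalk

theorem exists_stepDist_eq_add_one {v t : V} (hvt : ReflTransGen R v t) (hne : v ≠ t) :
    ∃ c, R v c ∧ ReflTransGen R c t ∧ stepDist R v t = stepDist R c t + 1 := by
  have hwalk := stepN_stepDist hvt
  obtain ⟨n, hn⟩ : ∃ n, stepDist R v t = n + 1 :=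
    Nat.exists_eq_succ_of_ne_zero fun h0 => hne (eq_of_stepDist_eq_zero hvt h0)
  rw [hn] at hwalk
  obtain ⟨c, hvc, hct⟩ := hwalk
  have hle : stepDist R v t ≤ stepDist R c t + 1 :=
    StepN.stepDist_le ⟨c, hvc, stepN_stepDist hct.reflTransGen⟩
  have hge := hct.stepDist_le
  exact ⟨c, hvc, hct.reflTransGen, by lia⟩

theorem nextToward_spec {v t : V} (hvt : ReflTransGen R v t) (hne : v ≠ t) :
    R v (nextToward R t v) ∧ ReflTransGen R (nextToward R t v) t ∧
      stepDist R v t = stepDist R (nextToward R t v) t + 1 := by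
  have hex := exists_stepDist_eq_add_one hvt hne
  rw [nextToward, dif_pos hex]
  exact hex.choose_spec

theorem iterate_nextToward_spec {s t : V} (hst : ReflTransGen R s t) {m : ℕ}
    (hm : m ≤ stepDist R s t) :
    ReflTransGen R ((nextToward R t)^[m] s) t ∧ StepN R m s ((nextToward R t)^[m] s) ∧
      stepDist R ((nextToward R t)^[m] s) t + m = stepDist R s t := by
  induction m generalizing s with
  | zero => exact ⟨hst, rfl, rfl⟩
  | succ m ih =>
    have hne : s ≠ t := by
      rintro rfl
      rw [stepDist_self] at hm
      lia
    obtain ⟨hstep, hreach, hdist⟩ := nextToward_spec hst hne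
    obtain ⟨hreach', hwalk, hdist'⟩ := ih hreach (by lia)
    exact ⟨hreach', ⟨_, hstep, hwalk⟩, by rw [Function.iterate_succ_apply]; lia⟩

theorem finite_leg (s t : V) : (leg R s t).Finite := by
  refine ((Set.finite_Iic (stepDist R s t)).image fun m => (nextToward R t)^[m] s).subset ?_
  rintro v ⟨m, hm, rfl⟩
  exact ⟨m, hm, rfl⟩

theorem left_mem_leg (s t : V) : s ∈ leg R s t :=
  ⟨0, Nat.zero_le _, rfl⟩

theorem right_mem_leg {s t : V} (hst : ReflTransGen R s t) : t ∈ leg R s t := by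
  obtain ⟨hreach, -, hdist⟩ := iterate_nextToward_spec hst le_rfl
  exact ⟨_, le_rfl, (eq_of_stepDist_eq_zero hreach (by lia)).symm⟩

theorem reflTransGen_left_of_mem_leg {s t v : V} (hst : ReflTransGen R s t) (hv : v ∈ leg R s t) :
    ReflTransGen R s v := by
  obtain ⟨m, hm, rfl⟩ := hv
  exact (iterate_nextToward_spec hst hm).2.1.reflTransGen

theorem reflTransGen_right_of_mem_leg {s t v : V} (hst : ReflTransGen R s t) (hv : v ∈ leg R s t) :
    ReflTransGen R v t := by
  obtain ⟨m, hm, rfl⟩ := hv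
  exact (iterate_nextToward_spec hst hm).1

theorem stepDist_add_le_of_mem_leg {s t v : V} (hst : ReflTransGen R s t) (hv : v ∈ leg R s t) :
    stepDist R s v + stepDist R v t ≤ stepDist R s t := by
  obtain ⟨m, hm, rfl⟩ := hv
  obtain ⟨-, hwalk, hdist⟩ := iterate_nextToward_spec hst hm
  have hle := hwalk.stepDist_le
  lia

theorem stepDist_nextToward_of_mem_leg {s t u : V} (hst : ReflTransGen R s t) (hu : u ∈ leg R s t)
    (hut : u ≠ t) : stepDist R u t = stepDist R (nextToward R t u) t + 1 :=
  (nextToward_spec (reflTransGen_right_of_mem_leg hst hu) hut).2.2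

theorem nextToward_mem_leg {s t v : V} (hst : ReflTransGen R s t) (hv : v ∈ leg R s t)
    (hne : v ≠ t) : nextToward R t v ∈ leg R s t := by
  have hnext := stepDist_nextToward_of_mem_leg hst hv hne
  obtain ⟨m, hm, rfl⟩ := hv
  obtain ⟨-, -, hdist⟩ := iterate_nextToward_spec hst hm
  exact ⟨m + 1, by lia, (Function.iterate_succ_apply' _ _ _).symm⟩

theorem exists_nextToward_eq_of_mem_leg {s t v : V} (hst : ReflTransGen R s t)
    (hv : v ∈ leg R s t) (hne : v ≠ s) : ∃ u ∈ leg R s t, u ≠ t ∧ nextToward R t u = v := by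
  obtain ⟨_ | m, hm, rfl⟩ := hv
  · exact absurd rfl hne
  · refine ⟨(nextToward R t)^[m] s, ⟨m, by lia, rfl⟩, fun heq => ?_,
      (Function.iterate_succ_apply' _ _ _).symm⟩
    obtain ⟨-, -, hdist⟩ := iterate_nextToward_spec hst (m := m) (by lia)
    rw [heq, stepDist_self] at hdist
    lia

theorem injOn_nextToward_leg {s t : V} (hst : ReflTransGen R s t) :
    Set.InjOn (nextToward R t) (leg R s t \ {t}) := by
  rintro u ⟨hu, hut⟩ u' ⟨hu', hut'⟩ heq
  have hnext := stepDist_nextToward_of_mem_leg hst hu hut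
  have hnext' := stepDist_nextToward_of_mem_leg hst hu' hut'
  obtain ⟨m, hm, rfl⟩ := hu
  obtain ⟨m', hm', rfl⟩ := hu'
  have hdist := (iterate_nextToward_spec hst hm).2.2
  have hdist' := (iterate_nextToward_spec hst hm').2.2
  rw [heq] at hnext
  obtain rfl : m = m' := by lia
  rfl

theorem nextToward_ne_left {s t u : V} (hst : ReflTransGen R s t) (hu : u ∈ leg R s t)
    (hut : u ≠ t) : nextToward R t u ≠ s := by
  intro heq
  have hnext := stepDist_nextToward_of_mem_leg hst hu hut
  have hle := stepDist_add_le_of_mem_leg hst hu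
  rw [heq] at hnext
  lia

end ShortestPath

section ShortestChain

variable {V : Type*} {H : Digraph V} {X Y Z : Set V} {k : ℕ} {t s : ℕ → V}

/-- The vertices `t 0 ∈ Y`, `t 1, …, t k ∈ Z`, `t (k + 1) ∈ X`, of which any two successive ones
have a common open ancestor. The values of `t` beyond `k + 1` play no role. -/
structure IsChainSeq (H : Digraph V) (X Y Z : Set V) (k : ℕ) (t : ℕ → V) : Prop where
  zero_mem : t 0 ∈ Y
  mem : ∀ i, 1 ≤ i → i ≤ k → t i ∈ Z
  last_mem : t (k + 1) ∈ X
  nonempty : ∀ i ≤ k, (openAnc H Z (t i) ∩ openAnc H Z (t (i + 1))).Nonempty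

/-- The sum of the lengths of shortest open paths from `s` to two targets. -/
noncomputable def pairDist (H : Digraph V) (Z : Set V) (t t' s : V) : ℕ :=
  stepDist (OpenStep H Z) s t + stepDist (OpenStep H Z) s t'

/-- A shortest chain `t` together with common open ancestors `s i` of `t i` and `t (i + 1)` at
minimal distance. -/
structure IsShortestChain (H : Digraph V) (X Y Z : Set V) (k : ℕ) (t s : ℕ → V) : Prop
    extends IsChainSeq H X Y Z k t where
  disjoint : ∀ a b, a + 2 ≤ b → b ≤ k + 1 → Disjoint (openAnc H Z (t a)) (openAnc H Z (t b))
  disjoint_of_mem : ∀ x ∈ X, ∀ b < k, Disjoint (openAnc H Z x) (openAnc H Z (t b))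
  source_left : ∀ i ≤ k, s i ∈ openAnc H Z (t i)
  source_right : ∀ i ≤ k, s i ∈ openAnc H Z (t (i + 1))
  pairDist_le : ∀ i ≤ k, ∀ v, v ∈ openAnc H Z (t i) → v ∈ openAnc H Z (t (i + 1)) →
    pairDist H Z (t i) (t (i + 1)) (s i) ≤ pairDist H Z (t i) (t (i + 1)) v
  pairDist_le_of_mem : ∀ x ∈ X, ∀ v, v ∈ openAnc H Z (t k) → v ∈ openAnc H Z x →
    pairDist H Z (t k) (t (k + 1)) (s k) ≤ pairDist H Z (t k) x v

theorem Linked.exists_seq {t' : V} (ht' : Linked H Y Z t') : ∃ k, ∃ t : ℕ → V, t 0 ∈ Y ∧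
    (∀ i, 1 ≤ i → i ≤ k → t i ∈ Z) ∧ t k = t' ∧
      ∀ i < k, (openAnc H Z (t i) ∩ openAnc H Z (t (i + 1))).Nonempty := by
  induction ht' with
  | @base t' ht' => exact ⟨0, fun _ => t', ht', fun i _ _ => by lia, rfl, fun i _ => by lia⟩
  | @step t₁ t₂ s _ ht₂ hs₁ hs₂ ih =>
    obtain ⟨k, t, hzero, hmem, rfl, hne⟩ := ih
    refine ⟨k + 1, fun i => if i ≤ k then t i else t₂, by simpa using hzero,
      fun i hi _ => ?_, by simp, fun i hi => ?_⟩
    · dsimp only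
      split_ifs with hik'
      · exact hmem i hi hik'
      · exact ht₂
    · rcases (Nat.lt_succ_iff.1 hi).lt_or_eq with hik | rfl
      · simpa [hik.le, Nat.succ_le_iff.2 hik] using hne i hik
      · simpa using ⟨s, hs₁, hs₂⟩

theorem IsConnected.exists_isChainSeq (hC : IsConnected H X Y Z) :
    ∃ k t, IsChainSeq H X Y Z k t := by
  obtain ⟨x, hx, t', s, ht', hsx, hst⟩ := hC
  obtain ⟨k, t, hzero, hmem, rfl, hne⟩ := ht'.exists_seq
  refine ⟨k, fun i => if i ≤ k then t i else x, by simpa using hzero,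
    fun i hi hik => by simpa [hik] using hmem i hi hik, by simpa using hx, fun i hik => ?_⟩
  rcases hik.lt_or_eq with hik | rfl
  · simpa [hik.le, Nat.succ_le_iff.2 hik] using hne i hik
  · simpa using ⟨s, hst, hsx⟩

theorem IsChainSeq.replace_tail (ht : IsChainSeq H X Y Z k t) {b : ℕ} (hb : b ≤ k) {x v : V}
    (hx : x ∈ X) (hvb : v ∈ openAnc H Z (t b)) (hvx : v ∈ openAnc H Z x) :
    IsChainSeq H X Y Z b (fun i => if i ≤ b then t i else x) where
  zero_mem := by simpa using ht.zero_mem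
  mem i hi hib := by simpa [hib] using ht.mem i hi (hib.trans hb)
  last_mem := by simpa using hx
  nonempty i hib := by
    rcases hib.lt_or_eq with hib | rfl
    · simpa [hib.le, Nat.succ_le_iff.2 hib] using ht.nonempty i (hib.le.trans hb)
    · simpa using ⟨v, hvb, hvx⟩

theorem IsChainSeq.shortcut (ht : IsChainSeq H X Y Z k t) {a b : ℕ} (hab : a + 1 ≤ b)
    (hb : b ≤ k + 1) {v : V} (hva : v ∈ openAnc H Z (t a)) (hvb : v ∈ openAnc H Z (t b)) :
    IsChainSeq H X Y Z (k - (b - a - 1)) (fun i => if i ≤ a then t i else t (i + (b - a - 1)))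
    where
  zero_mem := by simpa using ht.zero_mem
  mem i hi hik := by
    split_ifs with hia
    · exact ht.mem i hi (by lia)
    · exact ht.mem _ (by lia) (by lia)
  last_mem := by
    rw [if_neg (by lia), show k - (b - a - 1) + 1 + (b - a - 1) = k + 1 by lia]
    exact ht.last_mem
  nonempty i hik := by
    rcases lt_trichotomy i a with hia | rfl | hai
    · rw [if_pos hia.le, if_pos (by lia)]
      exact ht.nonempty i (by lia)
    · rw [if_pos le_rfl, if_neg (by lia), show i + 1 + (b - i - 1) = b by lia]
      exact ⟨v, hva, hvb⟩
    · rw [if_neg (by lia), if_neg (by lia),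
        show i + 1 + (b - a - 1) = i + (b - a - 1) + 1 by lia]
      exact ht.nonempty _ (by lia)

theorem IsChainSeq.exists_source (ht : IsChainSeq H X Y Z k t) {i : ℕ} (hi : i ≤ k) :
    ∃ v, (v ∈ openAnc H Z (t i) ∧ v ∈ openAnc H Z (t (i + 1))) ∧
      ∀ w, w ∈ openAnc H Z (t i) → w ∈ openAnc H Z (t (i + 1)) →
        pairDist H Z (t i) (t (i + 1)) v ≤ pairDist H Z (t i) (t (i + 1)) w :=
  ⟨_, Function.argminOn_mem (pairDist H Z (t i) (t (i + 1))) _ (ht.nonempty i hi),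
    fun _ hw hw' => Function.argminOn_le (pairDist H Z (t i) (t (i + 1))) _ (Set.mem_inter hw hw')⟩

theorem IsConnected.exists_isShortestChain (hC : IsConnected H X Y Z) :
    ∃ k t s, IsShortestChain H X Y Z k t s := by
  classical
  have hex := hC.exists_isChainSeq
  let k := Nat.find hex
  have hmin : ∀ k' < k, ∀ t, ¬ IsChainSeq H X Y Z k' t := fun k' hk' t ht =>
    Nat.find_min hex hk' ⟨t, ht⟩
  let chains : Set ((ℕ → V) × V) := {p | IsChainSeq H X Y Z k p.1 ∧
    p.2 ∈ openAnc H Z (p.1 k) ∧ p.2 ∈ openAnc H Z (p.1 (k + 1))}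
  have hchains : chains.Nonempty := by
    obtain ⟨t, ht⟩ := Nat.find_spec hex
    obtain ⟨s, hs⟩ := ht.nonempty k le_rfl
    exact ⟨(t, s), ht, hs⟩
  let lastDist : (ℕ → V) × V → ℕ := fun p => pairDist H Z (p.1 k) (p.1 (k + 1)) p.2
  obtain ⟨⟨t, r⟩, ⟨ht, hrk, hrk'⟩, htmin⟩ : ∃ p ∈ chains, ∀ q ∈ chains, lastDist p ≤ lastDist q :=
    ⟨_, Function.argminOn_mem lastDist _ hchains, fun _ => Function.argminOn_le lastDist _⟩
  have hsource := fun i (hi : i ≤ k) => ht.exists_source hi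
  have : Nonempty V := ⟨r⟩
  choose! s hs hsmin using hsource
  refine ⟨k, t, s, { ht with
    disjoint := fun a b hab hb => Set.disjoint_left.2 fun v hva hvb =>
      hmin _ (by lia) _ (ht.shortcut (by lia) hb hva hvb)
    disjoint_of_mem := fun x hx b hb => Set.disjoint_left.2 fun v hvx hvb =>
      hmin b hb _ (ht.replace_tail hb.le hx hvb hvx)
    source_left := fun i hi => (hs i hi).1
    source_right := fun i hi => (hs i hi).2
    pairDist_le := hsmin
    pairDist_le_of_mem := fun x hx v hvk hvx => ?_ }⟩
  refine (hsmin k le_rfl r hrk hrk').trans ?_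
  simpa [lastDist] using htmin (fun i => if i ≤ k then t i else x, v)
    ⟨ht.replace_tail le_rfl hx hvk hvx, by simpa using ⟨hvk, hvx⟩⟩

end ShortestChain

/-! ### The linear model of a shortest chain -/

namespace IsShortestChain

open Relation

variable {V : Type*} {G H : Digraph V} {X Y Z : Set V} {k : ℕ} {t s : ℕ → V}

/-- The vertex `v` is on one of the two chosen paths from the source `s i`. -/
def OnLegs (H : Digraph V) (Z : Set V) (t s : ℕ → V) (i : ℕ) (v : V) : Prop :=
  ∃ j, (j = i ∨ j = i + 1) ∧ v ∈ leg (OpenStep H Z) (s i) (t j)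

/-- The edge from `u` to `v` is on the chosen path from the source `s i` to the target `t j`. -/
def IsLegEdge (H : Digraph V) (Z : Set V) (t s : ℕ → V) (i j : ℕ) (u v : V) : Prop :=
  u ∈ leg (OpenStep H Z) (s i) (t j) ∧ u ≠ t j ∧ nextToward (OpenStep H Z) (t j) u = v

/-- The edge from `u` to `v` is on one of the chosen paths from the sources to the targets. -/
def LegEdge (H : Digraph V) (Z : Set V) (k : ℕ) (t s : ℕ → V) (u v : V) : Prop :=
  ∃ i ≤ k, ∃ j, (j = i ∨ j = i + 1) ∧ IsLegEdge H Z t s i j u v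

theorem finite_legEdge (v : V) : {u | LegEdge H Z k t s u v}.Finite := by
  refine (((Set.finite_Iic k).prod (Set.finite_Iic (k + 1))).biUnion
    fun p _ => finite_leg (R := OpenStep H Z) (s p.1) (t p.2)).subset ?_
  rintro u ⟨i, hi, j, hj, hu, -⟩
  exact Set.mem_biUnion (x := (i, j)) ⟨hi, by simp only [Set.mem_Iic]; lia⟩ hu

/-- The vertices from which an edge of the chosen paths leads to `v`. -/
noncomputable def legParents (H : Digraph V) (Z : Set V) (k : ℕ) (t s : ℕ → V) (v : V) : Finset V :=
  (finite_legEdge (H := H) (Z := Z) (k := k) (t := t) (s := s) v).toFinset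

theorem mem_legParents {u v : V} : u ∈ legParents H Z k t s v ↔ LegEdge H Z k t s u v :=
  Set.Finite.mem_toFinset _

theorem notMem_or_eq_of_mem_leg {a b v : V} (hab : ReflTransGen (OpenStep H Z) a b)
    (hv : v ∈ leg (OpenStep H Z) a b) : v ∉ Z ∨ v = b := by
  rcases (reflTransGen_right_of_mem_leg hab hv).cases_head with hvb | ⟨w, hvw, -⟩
  · exact .inr hvb
  · exact .inl hvw.2

theorem source_mem (c : IsShortestChain H X Y Z k t s) {i j : ℕ} (hi : i ≤ k)
    (hj : j = i ∨ j = i + 1) : s i ∈ openAnc H Z (t j) := by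
  rcases hj with rfl | rfl
  · exact c.source_left _ hi
  · exact c.source_right _ hi

theorem mem_openAnc_of_mem_leg (c : IsShortestChain H X Y Z k t s) {i j : ℕ} (hi : i ≤ k)
    (hj : j = i ∨ j = i + 1) {v : V} (hv : v ∈ leg (OpenStep H Z) (s i) (t j)) (hvZ : v ∉ Z) :
    v ∈ openAnc H Z (t j) :=
  ⟨hvZ, reflTransGen_right_of_mem_leg (c.source_mem hi hj).2 hv⟩

theorem target_ne_of_lt (c : IsShortestChain H X Y Z k t s) (hXY : Disjoint X Y) {j j' : ℕ}
    (hj' : j' ≤ k + 1) (hlt : j < j') : t j ≠ t j' := by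
  intro heq
  have hmeet : ∀ a b v, a + 2 ≤ b → b ≤ k + 1 → v ∈ openAnc H Z (t a) → v ∉ openAnc H Z (t b) :=
    fun a b _ hab hb hva => Set.disjoint_left.1 (c.disjoint a b hab hb) hva
  rcases Nat.lt_or_ge (j + 1) j' with hfar | hnear
  · have hs := c.source_left j (by lia)
    exact hmeet j j' _ hfar hj' hs (heq ▸ hs)
  obtain rfl : j' = j + 1 := by lia
  rcases Nat.eq_zero_or_pos j with rfl | hpos
  · rcases Nat.eq_zero_or_pos k with rfl | hk
    · exact Set.disjoint_left.1 hXY c.last_mem (heq ▸ c.zero_mem)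
    · have hs : s 1 ∈ openAnc H Z (t 0) := by
        rw [heq]
        exact c.source_left 1 hk
      exact hmeet 0 2 _ le_rfl (by lia) hs (c.source_right 1 hk)
  · have hs : s (j - 1) ∈ openAnc H Z (t (j + 1)) := by
      rw [← heq]
      exact c.source_mem (by lia) (by lia)
    exact hmeet (j - 1) (j + 1) _ (by lia) hj' (c.source_left _ (by lia)) hs

theorem eq_source_of_mem_leg_of_mem_leg_succ (c : IsShortestChain H X Y Z k t s) {i : ℕ}
    (hi : i ≤ k) {v : V} (hvZ : v ∉ Z) (hv : v ∈ leg (OpenStep H Z) (s i) (t i))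
    (hv' : v ∈ leg (OpenStep H Z) (s i) (t (i + 1))) : v = s i := by
  have hs := (c.source_left i hi).2
  have hs' := (c.source_right i hi).2
  have hmin := c.pairDist_le i hi v (c.mem_openAnc_of_mem_leg hi (.inl rfl) hv hvZ)
    (c.mem_openAnc_of_mem_leg hi (.inr rfl) hv' hvZ)
  have hadd := stepDist_add_le_of_mem_leg hs hv
  have hadd' := stepDist_add_le_of_mem_leg hs' hv'
  unfold pairDist at hmin
  exact (eq_of_stepDist_eq_zero (reflTransGen_left_of_mem_leg hs hv) (by lia)).symm

theorem eq_source_of_mem_leg_of_lt (c : IsShortestChain H X Y Z k t s) (hXY : Disjoint X Y)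
    {i j i' j' : ℕ} (hi : i ≤ k) (hi' : i' ≤ k) (hj : j = i ∨ j = i + 1)
    (hj' : j' = i' ∨ j' = i' + 1) (hlt : j < j') {v : V}
    (hv : v ∈ leg (OpenStep H Z) (s i) (t j)) (hv' : v ∈ leg (OpenStep H Z) (s i') (t j')) :
    i = i' ∧ v = s i := by
  have hs := c.source_mem hi hj
  have hs' := c.source_mem hi' hj'
  have hmeet : ∀ a b w, b ≤ k + 1 → w ∈ openAnc H Z (t a) → w ∈ openAnc H Z (t b) → b < a + 2 :=
    fun a b w hb ha hwb => by
      by_contra! hab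
      exact Set.disjoint_left.1 (c.disjoint a b hab hb) ha hwb
  have hvZ : v ∉ Z := by
    intro hvZ
    have hvt := (notMem_or_eq_of_mem_leg hs.2 hv).resolve_left (not_not.2 hvZ)
    have hvt' := (notMem_or_eq_of_mem_leg hs'.2 hv').resolve_left (not_not.2 hvZ)
    exact c.target_ne_of_lt hXY (by lia) hlt (hvt.symm.trans hvt')
  have hvj := c.mem_openAnc_of_mem_leg hi hj hv hvZ
  have hvj' := c.mem_openAnc_of_mem_leg hi' hj' hv' hvZ
  have hadj := hmeet j j' v (by lia) hvj hvj'
  have hsj' : s i ∈ openAnc H Z (t j') :=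
    ⟨hs.1, (reflTransGen_left_of_mem_leg hs.2 hv).trans hvj'.2⟩
  have hs'j : s i' ∈ openAnc H Z (t j) :=
    ⟨hs'.1, (reflTransGen_left_of_mem_leg hs'.2 hv').trans hvj.2⟩
  have hij' := hmeet i j' _ (by lia) (c.source_left i hi) hsj'
  have hij := hmeet j (i' + 1) _ (by lia) hs'j (c.source_right i' hi')
  obtain rfl : j = i := by lia
  obtain rfl : i' = j := by lia
  obtain rfl : j' = i' + 1 := by lia
  exact ⟨rfl, c.eq_source_of_mem_leg_of_mem_leg_succ hi hvZ hv hv'⟩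

-- Otherwise the chain could be shortened, or the common source replaced by a closer one.
theorem eq_or_of_mem_leg (c : IsShortestChain H X Y Z k t s) (hXY : Disjoint X Y)
    {i j i' j' : ℕ} (hi : i ≤ k) (hi' : i' ≤ k) (hj : j = i ∨ j = i + 1)
    (hj' : j' = i' ∨ j' = i' + 1) {v : V} (hv : v ∈ leg (OpenStep H Z) (s i) (t j))
    (hv' : v ∈ leg (OpenStep H Z) (s i') (t j')) : j = j' ∨ i = i' ∧ v = s i := by
  rcases lt_trichotomy j j' with hlt | heq | hlt
  · exact .inr (c.eq_source_of_mem_leg_of_lt hXY hi hi' hj hj' hlt hv hv')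
  · exact .inl heq
  · obtain ⟨rfl, hvs⟩ := c.eq_source_of_mem_leg_of_lt hXY hi' hi hj' hj hlt hv' hv
    exact .inr ⟨rfl, hvs⟩

theorem IsLegEdge.mem_leg (c : IsShortestChain H X Y Z k t s) {i j : ℕ} (hi : i ≤ k)
    (hj : j = i ∨ j = i + 1) {u v : V} (huv : IsLegEdge H Z t s i j u v) :
    v ∈ leg (OpenStep H Z) (s i) (t j) :=
  huv.2.2 ▸ nextToward_mem_leg (c.source_mem hi hj).2 huv.1 huv.2.1

theorem onLegs_source (c : IsShortestChain H X Y Z k t s) (hXY : Disjoint X Y)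
    {i i' : ℕ} (hi : i ≤ k) (hi' : i' ≤ k) : OnLegs H Z t s i (s i') ↔ i = i' := by
  refine ⟨?_, ?_⟩
  · rintro ⟨j, hj, hmem⟩
    have hleft := c.eq_or_of_mem_leg hXY hi hi' hj (.inl rfl) hmem (left_mem_leg _ _)
    have hright := c.eq_or_of_mem_leg hXY hi hi' hj (.inr rfl) hmem (left_mem_leg _ _)
    lia
  · rintro rfl
    exact ⟨i, .inl rfl, left_mem_leg _ _⟩

theorem onLegs_target_iff (c : IsShortestChain H X Y Z k t s) (hXY : Disjoint X Y)
    {i j : ℕ} (hi : i ≤ k) (hj : j ≤ k + 1) : OnLegs H Z t s i (t j) ↔ j = i ∨ j = i + 1 := by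
  refine ⟨?_, fun hij => ⟨j, hij, right_mem_leg (c.source_mem hi hij).2⟩⟩
  rintro ⟨j', hj', hmem⟩
  have hsame : ∀ i' ≤ k, (j = i' ∨ j = i' + 1) → j' = j ∨ i = i' ∧ t j = s i := fun i' hi' hij =>
    c.eq_or_of_mem_leg hXY hi hi' hj' hij hmem (right_mem_leg (c.source_mem hi' hij).2)
  rcases Nat.lt_or_ge k j with hk | hk
  · have hjk := hsame k le_rfl (by lia)
    lia
  · have hjj := hsame j hk (.inl rfl)
    lia

theorem isDescendant_of_onLegs (c : IsShortestChain H X Y Z k t s) {i : ℕ} (hi : i ≤ k) {v : V}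
    (hv : OnLegs H Z t s i v) : IsDescendant H (s i) v := by
  obtain ⟨j, hj, hmem⟩ := hv
  exact ReflTransGen.mono (fun _ _ huv => huv.1) _ _
    (reflTransGen_left_of_mem_leg (c.source_mem hi hj).2 hmem)

theorem not_legEdge_source (c : IsShortestChain H X Y Z k t s) (hXY : Disjoint X Y)
    {i : ℕ} (hi : i ≤ k) {u : V} : ¬ LegEdge H Z k t s u (s i) := by
  rintro ⟨i', hi', j, hj, huv⟩
  obtain rfl := (c.onLegs_source hXY hi' hi).1 ⟨j, hj, huv.mem_leg c hi' hj⟩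
  exact nextToward_ne_left (c.source_mem hi' hj).2 huv.1 huv.2.1 huv.2.2

theorem exists_isLegEdge_of_legEdge (c : IsShortestChain H X Y Z k t s) (hXY : Disjoint X Y)
    {i : ℕ} (hi : i ≤ k) {u v : V} (huv : LegEdge H Z k t s u v) (hu : OnLegs H Z t s i u) :
    ∃ j, (j = i ∨ j = i + 1) ∧ IsLegEdge H Z t s i j u v := by
  obtain ⟨i', hi', j', hj', huv⟩ := huv
  obtain ⟨j, hj, hu⟩ := hu
  rcases c.eq_or_of_mem_leg hXY hi hi' hj hj' hu huv.1 with rfl | ⟨rfl, -⟩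
  · exact ⟨j, hj, hu, huv.2⟩
  · exact ⟨j', hj', huv⟩

theorem onLegs_of_legEdge (c : IsShortestChain H X Y Z k t s) (hXY : Disjoint X Y)
    {i : ℕ} (hi : i ≤ k) {u v : V} (huv : LegEdge H Z k t s u v) (hu : OnLegs H Z t s i u) :
    OnLegs H Z t s i v := by
  obtain ⟨j, hj, huv⟩ := c.exists_isLegEdge_of_legEdge hXY hi huv hu
  exact ⟨j, hj, huv.mem_leg c hi hj⟩

theorem existsUnique_onLegs_parent (c : IsShortestChain H X Y Z k t s) (hXY : Disjoint X Y)
    {i : ℕ} (hi : i ≤ k) {v : V} (hvs : v ≠ s i) (hv : OnLegs H Z t s i v) :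
    ∃! u, LegEdge H Z k t s u v ∧ OnLegs H Z t s i u := by
  obtain ⟨j, hj, hvj⟩ := hv
  have hs := c.source_mem hi hj
  obtain ⟨u, hu, hut, huv⟩ := exists_nextToward_eq_of_mem_leg hs.2 hvj hvs
  refine ⟨u, ⟨⟨i, hi, j, hj, hu, hut, huv⟩, j, hj, hu⟩, ?_⟩
  rintro u' ⟨hedge, hon⟩
  obtain ⟨j', hj', hu'v⟩ := c.exists_isLegEdge_of_legEdge hXY hi hedge hon
  rcases c.eq_or_of_mem_leg hXY hi hi hj hj' hvj (hu'v.mem_leg c hi hj') with rfl | ⟨-, heq⟩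
  · exact injOn_nextToward_leg hs.2 ⟨hu'v.1, hu'v.2.1⟩ ⟨hu, hut⟩ (hu'v.2.2.trans huv.symm)
  · exact absurd heq hvs

open Classical in
theorem sum_legParents_onLegs (c : IsShortestChain H X Y Z k t s) (hXY : Disjoint X Y)
    {i : ℕ} (hi : i ≤ k) {v : V} (hvs : v ≠ s i) (b : ZMod 2) :
    ∑ u ∈ legParents H Z k t s v, (if OnLegs H Z t s i u then b else 0)
      = if OnLegs H Z t s i v then b else 0 := by
  split_ifs with hv
  · obtain ⟨u, ⟨huv, hu⟩, huniq⟩ := c.existsUnique_onLegs_parent hXY hi hvs hv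
    rw [Finset.sum_eq_single_of_mem u (mem_legParents.2 huv) fun u' hu' hne =>
      if_neg fun hon => hne (huniq u' ⟨mem_legParents.1 hu', hon⟩), if_pos hu]
  · exact Finset.sum_eq_zero fun u hu =>
      if_neg fun hon => hv (c.onLegs_of_legEdge hXY hi (mem_legParents.1 hu) hon)

theorem not_onLegs_of_mem_ne_target (c : IsShortestChain H X Y Z k t s) (hXZ : Disjoint X Z)
    {x : V} (hx : x ∈ X) (hne : x ≠ t (k + 1)) {i : ℕ} (hi : i ≤ k) : ¬ OnLegs H Z t s i x := by
  rintro ⟨j, hj, hxj⟩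
  have hs := c.source_mem hi hj
  have hsx : s i ∈ openAnc H Z x := ⟨hs.1, reflTransGen_left_of_mem_leg hs.2 hxj⟩
  have hxt := reflTransGen_right_of_mem_leg hs.2 hxj
  obtain rfl : i = k := by
    by_contra hik
    exact Set.disjoint_left.1 (c.disjoint_of_mem x hx i (by lia)) hsx (c.source_left i hi)
  have hadd := stepDist_add_le_of_mem_leg hs.2 hxj
  have hclosest := c.pairDist_le_of_mem x hx (s i) (c.source_left i hi) hsx
  unfold pairDist at hclosest
  rcases hj with rfl | rfl
  · have hxZ : x ∉ Z := Set.disjoint_left.1 hXZ hx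
    have hself := c.pairDist_le_of_mem x hx x ⟨hxZ, hxt⟩ (self_mem_openAnc hxZ)
    unfold pairDist at hself
    rw [stepDist_self] at hself
    have hsx_eq := eq_of_stepDist_eq_zero hsx.2 (by lia)
    have hst_eq := eq_of_stepDist_eq_zero (c.source_right j hi).2 (by lia)
    exact hne (hsx_eq.symm.trans hst_eq)
  · exact hne (eq_of_stepDist_eq_zero hxt (by lia))

open Classical in
/-- The model in which each source is a noise bit that is passed on along the two chosen paths from
the source. -/
noncomputable def linearModel (c : IsShortestChain H X Y Z k t s) (hHG : H ≤ G)
    (hXY : Disjoint X Y) : LinearModel G where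
  par := legParents H Z k t s
  noisy := {v | ∃ i ≤ k, v = s i}
  sol n v := ∑ i ∈ Finset.range (k + 1), if OnLegs H Z t s i v then n (s i) else 0
  adj_of_mem := by
    intro u v huv
    obtain ⟨i, hi, j, hj, hu, hut, rfl⟩ := mem_legParents.1 huv
    exact hHG (nextToward_spec
      (reflTransGen_right_of_mem_leg (c.source_mem hi hj).2 hu) hut).1.1
  measurable_sol v := by
    refine Finset.measurable_fun_sum _ fun i _ => ?_
    split_ifs
    · exact measurable_pi_apply _
    · exact measurable_const
  sol_eq n v := by
    by_cases hv : ∃ i ≤ k, v = s i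
    · obtain ⟨i, hi, rfl⟩ := hv
      rw [if_pos ⟨i, hi, rfl⟩, Finset.sum_eq_zero (s := legParents H Z k t s (s i))
        fun u hu => absurd (mem_legParents.1 hu) (c.not_legEdge_source hXY hi), zero_add,
        Finset.sum_eq_single_of_mem i (Finset.mem_range.2 (by lia)) fun i' hi' hne => if_neg ?_,
        if_pos ((c.onLegs_source hXY hi hi).2 rfl)]
      rwa [c.onLegs_source hXY (Finset.mem_range_succ_iff.1 hi') hi]
    · rw [if_neg (show v ∉ {v | ∃ i ≤ k, v = s i} from hv), add_zero, Finset.sum_comm]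
      push Not at hv
      exact Finset.sum_congr rfl fun i hi =>
        have hi := Finset.mem_range_succ_iff.1 hi
        (c.sum_legParents_onLegs hXY hi (hv i hi) _).symm
  dependsOn_sol v := by
    intro n n' hn
    refine Finset.sum_congr rfl fun i hi => ?_
    split_ifs with hon
    · exact hn _ ((c.isDescendant_of_onLegs (Finset.mem_range_succ_iff.1 hi) hon).mono hHG)
    · rfl

section Solution

variable (c : IsShortestChain H X Y Z k t s) (hHG : H ≤ G) (hXY : Disjoint X Y)

theorem sol_congr {n n' : V → ZMod 2} (hn : ∀ i ≤ k, n (s i) = n' (s i)) (v : V) :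
    (c.linearModel hHG hXY).sol n v = (c.linearModel hHG hXY).sol n' v :=
  Finset.sum_congr (s₁ := Finset.range (k + 1)) rfl fun i hi => by
    rw [hn i (Finset.mem_range_succ_iff.1 hi)]

theorem sol_target (n : V → ZMod 2) {j : ℕ} (hj : j ≤ k + 1) :
    (c.linearModel hHG hXY).sol n (t j)
      = ∑ i ∈ Finset.range (k + 1), if j = i ∨ j = i + 1 then n (s i) else 0 := by
  classical
  refine Finset.sum_congr (s₁ := Finset.range (k + 1)) rfl fun i hi => ?_
  exact if_congr (c.onLegs_target_iff hXY (Finset.mem_range_succ_iff.1 hi) hj) rfl rfl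

theorem sol_zero (n : V → ZMod 2) : (c.linearModel hHG hXY).sol n (t 0) = n (s 0) := by
  rw [c.sol_target hHG hXY n (Nat.zero_le _), Finset.sum_eq_single_of_mem 0 (by simp)]
  · simp
  · exact fun i _ hi => if_neg (by lia)

theorem sol_last (n : V → ZMod 2) : (c.linearModel hHG hXY).sol n (t (k + 1)) = n (s k) := by
  rw [c.sol_target hHG hXY n le_rfl, Finset.sum_eq_single_of_mem k (by simp)]
  · simp
  · exact fun i hi hne => if_neg (by have := Finset.mem_range.1 hi; lia)

theorem sol_succ (n : V → ZMod 2) {j : ℕ} (hj : j < k) :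
    (c.linearModel hHG hXY).sol n (t (j + 1)) = n (s j) + n (s (j + 1)) := by
  have hsub : {j, j + 1} ⊆ Finset.range (k + 1) := by
    intro i hi
    simp only [Finset.mem_insert, Finset.mem_singleton] at hi
    exact Finset.mem_range.2 (by lia)
  rw [c.sol_target hHG hXY n (by lia), ← Finset.sum_subset hsub fun i _ hi => ?_,
    Finset.sum_pair (by lia), if_pos (.inr rfl), if_pos (.inl rfl)]
  simp only [Finset.mem_insert, Finset.mem_singleton] at hi
  exact if_neg (by lia)

theorem sum_sol_succ (n : V → ZMod 2) :
    ∑ j ∈ Finset.range k, (c.linearModel hHG hXY).sol n (t (j + 1)) = n (s 0) + n (s k) := by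
  rw [← CharTwo.sub_eq_add, ← Finset.sum_range_sub' (fun j => n (s j)) k]
  exact Finset.sum_congr rfl fun j hj => by
    rw [c.sol_succ hHG hXY n (Finset.mem_range.1 hj), CharTwo.sub_eq_add]

theorem sol_eq_zero_of_mem (hXZ : Disjoint X Z) (n : V → ZMod 2) {x : V} (hx : x ∈ X)
    (hne : x ≠ t (k + 1)) : (c.linearModel hHG hXY).sol n x = 0 :=
  Finset.sum_eq_zero (s := Finset.range (k + 1)) fun _ hi =>
    if_neg (c.not_onLegs_of_mem_ne_target hXZ hx hne (Finset.mem_range_succ_iff.1 hi))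

theorem sol_add_one (hXZ : Disjoint X Z) (hYZ : Disjoint Y Z) (n : V → ZMod 2) {z : V}
    (hz : z ∈ Z) :
    (c.linearModel hHG hXY).sol (n + 1) z = (c.linearModel hHG hXY).sol n z := by
  by_cases hon : ∃ i ≤ k, OnLegs H Z t s i z
  · obtain ⟨i, hi, j, hj, hzj⟩ := hon
    obtain rfl := (notMem_or_eq_of_mem_leg (c.source_mem hi hj).2 hzj).resolve_left
      (not_not.2 hz)
    obtain _ | j := j
    · exact absurd hz (Set.disjoint_left.1 hYZ c.zero_mem)
    have hjk : j < k := by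
      by_contra hjk
      obtain rfl : j = k := by lia
      exact Set.disjoint_left.1 hXZ c.last_mem hz
    rw [c.sol_succ hHG hXY _ hjk, c.sol_succ hHG hXY _ hjk]
    have htwo := CharTwo.add_self_eq_zero (1 : ZMod 2)
    simp only [Pi.add_apply, Pi.one_apply]
    linear_combination htwo
  · have hzero : ∀ n, (c.linearModel hHG hXY).sol n z = 0 := fun n =>
      Finset.sum_eq_zero (s := Finset.range (k + 1)) fun i hi =>
        if_neg fun hi' => hon ⟨i, Finset.mem_range_succ_iff.1 hi, hi'⟩
    rw [hzero, hzero]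

theorem mem_leg_of_mem_par {u v : V} (huv : u ∈ (c.linearModel hHG hXY).par v)
    (hv : v ∈ leg (OpenStep H Z) (s 0) (t 0)) : u ∈ leg (OpenStep H Z) (s 0) (t 0) := by
  have hedge : LegEdge H Z k t s u v := mem_legParents.1 huv
  obtain ⟨i, hi, j, hj, huv⟩ := id hedge
  rcases c.eq_or_of_mem_leg hXY hi (Nat.zero_le k) hj (.inl rfl) (huv.mem_leg c hi hj) hv with
    rfl | ⟨rfl, rfl⟩
  · obtain rfl : i = 0 := by lia
    exact huv.1
  · exact absurd hedge (c.not_legEdge_source hXY hi)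

end Solution

end IsShortestChain

/-! ### Adjustment sets and the adjustment formula in linear models -/

section AdjustmentSet

variable {S : Type*} [DecidableEq S] {Ω : S × ℤ → Type*} [∀ v, MeasurableSpace (Ω v)]
  {G : Digraph (S × ℤ)} {X Y Z : Finset (S × ℤ)}

/-- `Z` is an adjustment set relative to `X` and `Y` in `G`: the adjustment formula holds for all
distributions compatible with `G`. -/
def IsAdjustmentSet [Fintype S] (Ω : S × ℤ → Type*) [∀ v, MeasurableSpace (Ω v)]
    (G : Digraph (S × ℤ)) (X Y Z : Finset (S × ℤ)) : Prop :=
  ∀ (κ : Mechanisms G Ω) (P : Measure (∀ v, Ω v)), IsCompatible G κ P →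
    ∀ (x : ∀ v : X, Ω v) (y : ∀ v : Y, Ω v), IsAdmissible P X Z x →
      doProb κ P X Y x y = adjustedProb P X Y Z x y

omit [∀ v, MeasurableSpace (Ω v)] in
theorem event_updateFinset_sdiff {Y' : Finset (S × ℤ)} (hY' : Y' ⊆ Y) (υ : ∀ v, Ω v)
    (w : ∀ v : ↥(Y \ Y'), Ω v) :
    (event Y fun v => Function.updateFinset υ (Y \ Y') w v)
      = event (Y \ Y') w ∩ event Y' fun v => υ v := by
  rw [event_eq_event_updateFinset υ w]
  ext ω
  simp only [Set.mem_inter_iff, mem_event_restrict]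
  have hout : ∀ v ∈ Y', Function.updateFinset υ (Y \ Y') w v = υ v := fun v hv =>
    dif_neg fun hmem => (Finset.mem_sdiff.1 hmem).2 hv
  refine ⟨fun hω => ⟨fun v hv => hω v (Finset.sdiff_subset hv), fun v hv =>
    (hω v (hY' hv)).trans (hout v hv)⟩, fun ⟨hω, hω'⟩ v hv => ?_⟩
  by_cases hvY' : v ∈ Y'
  · exact (hω' v hvY').trans (hout v hvY').symm
  · exact hω v (Finset.mem_sdiff.2 ⟨hv, hvY'⟩)

variable [∀ v, DiscreteMeasurableSpace (Ω v)] [∀ v, Countable (Ω v)]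

omit [DecidableEq S] in
theorem tsum_measure_event_inter (P : Measure (∀ v, Ω v)) (A : Finset (S × ℤ))
    {B : Set (∀ v, Ω v)} (hB : MeasurableSet B) :
    ∑' z : ∀ v : A, Ω v, P (event A z ∩ B) = P B := by
  have hterm : ∀ z : ∀ v : A, Ω v,
      ∫⁻ ω in event A z, B.indicator 1 ω ∂P = P (event A z ∩ B) := fun z => by
    rw [lintegral_indicator_one hB, Measure.restrict_apply hB, Set.inter_comm]
  rw [tsum_congr fun z => (hterm z).symm, tsum_setLIntegral_event, lintegral_indicator_one hB]

theorem tsum_adjustedProb_updateFinset {P : Measure (∀ v, Ω v)} [IsProbabilityMeasure P]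
    {Y' : Finset (S × ℤ)} (hY' : Y' ⊆ Y) (x : ∀ v : X, Ω v) (υ : ∀ v, Ω v) :
    ∑' w : ∀ v : ↥(Y \ Y'), Ω v,
        adjustedProb P X Y Z x (fun v => Function.updateFinset υ (Y \ Y') w v)
      = adjustedProb P X Y' Z x fun v => υ v := by
  simp only [adjustedProb_eq_tsum, event_updateFinset_sdiff hY']
  rw [ENNReal.tsum_comm]
  refine tsum_congr fun z => ?_
  rw [ENNReal.tsum_mul_right, tsum_measure_event_inter _ _ (measurableSet_event _ _)]

theorem adjustedProb_eq_measure {P : Measure (∀ v, Ω v)} [IsProbabilityMeasure P]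
    {x : ∀ v : X, Ω v} {y : ∀ v : Y, Ω v} (hx : IsAdmissible P X Z x) {D : Set (∀ v, Ω v)}
    (hD : MeasurableSet D) (hDZ : DependsOn (· ∈ D) (Z : Set (S × ℤ)))
    (hYD : ∀ᵐ ω ∂P, ω ∈ event X x → (ω ∈ event Y y ↔ ω ∈ D)) :
    adjustedProb P X Y Z x y = P D := by
  rw [adjustedProb_eq_tsum, ← tsum_measure_event_inter P Z hD]
  refine tsum_congr fun z => ?_
  by_cases hz : P (event Z z) = 0
  · rw [hz, mul_zero, measure_mono_null Set.inter_subset_left hz]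
  have hcongr : P (event X x ∩ event Z z ∩ event Y y) = P (event X x ∩ event Z z ∩ D) := by
    refine measure_congr ?_
    filter_upwards [hYD] with ω hω
    exact propext (and_congr_right fun hωXZ => hω hωXZ.1)
  have hconst : ∀ ω ∈ event Z z, ∀ ω' ∈ event Z z, ω ∈ D → ω' ∈ D := fun ω hω ω' hω' hωD =>
    (iff_of_eq (hDZ fun v hv => (hω ⟨v, hv⟩).trans (hω' ⟨v, hv⟩).symm)).1 hωD
  rw [cond_apply ((measurableSet_event X x).inter (measurableSet_event Z z)), hcongr]
  by_cases hne : ∃ ω ∈ event Z z, ω ∈ D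
  · obtain ⟨ω, hω, hωD⟩ := hne
    have hZD : event Z z ⊆ D := fun ω' hω' => hconst ω hω ω' hω' hωD
    rw [Set.inter_eq_left.2 hZD, Set.inter_eq_left.2 (Set.inter_subset_right.trans hZD),
      ENNReal.inv_mul_cancel (hx z hz) (measure_ne_top _ _), one_mul]
  · push Not at hne
    have hZD : Disjoint (event Z z) D := Set.disjoint_left.2 hne
    rw [hZD.inter_eq, (hZD.mono_left Set.inter_subset_right).inter_eq, measure_empty, mul_zero,
      zero_mul]

variable [Fintype S] [∀ v, Nonempty (Ω v)] {κ : Mechanisms G Ω} {P : Measure (∀ v, Ω v)}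

theorem IsCompatible.tsum_doProb_updateFinset (hG : IsFTCG G) (hP : IsCompatible G κ P)
    {Y' : Finset (S × ℤ)} (hY' : Y' ⊆ Y) (ξ υ : ∀ v, Ω v) :
    ∑' w : ∀ v : ↥(Y \ Y'), Ω v,
        doProb κ P X Y (fun v => ξ v) (fun v => Function.updateFinset υ (Y \ Y') w v)
      = doProb κ P X Y' (fun v => ξ v) fun v => υ v := by
  obtain ⟨a, b, hW⟩ := exists_subset_window (X ∪ Y)
  obtain ⟨hX, hY⟩ := Finset.union_subset_iff.1 hW
  have hφ := isFactorSystem_doFactor hG.acyclic hP.isMarkovKernel ξ X fun _ => ∅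
  have hind : ∀ w : ∀ v : ↥(Y \ Y'), Ω v, eventInd Y (Function.updateFinset υ (Y \ Y') w)
      = fun η => eventInd (Y \ Y') (Function.updateFinset υ (Y \ Y') w) η
        * eventInd Y' υ η := fun w => by
    unfold eventInd
    rw [event_updateFinset_sdiff hY', ← event_eq_event_updateFinset,
      Set.inter_indicator_one]
    rfl
  simp only [hP.doProb_eq_lintegral_margProd_window hG _ _ hX hY,
    hP.doProb_eq_lintegral_margProd_window hG _ _ hX (hY'.trans hY), hind,
    hφ.tsum_lintegral_margProd P _ _ υ (measurable_eventInd Y' υ)]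

theorem IsAdjustmentSet.mono (hG : IsFTCG G) (h : IsAdjustmentSet Ω G X Y Z)
    {Y' : Finset (S × ℤ)} (hY' : Y' ⊆ Y) : IsAdjustmentSet Ω G X Y' Z := by
  intro κ P hP x y hx
  have := hP.isProbabilityMeasure
  obtain ⟨ξ, rfl⟩ := exists_eq_restrict x
  obtain ⟨υ, rfl⟩ := exists_eq_restrict y
  rw [← hP.tsum_doProb_updateFinset hG hY', ← tsum_adjustedProb_updateFinset hY']
  exact tsum_congr fun w => h κ P hP _ _ hx

end AdjustmentSet

noncomputable section Evaluation

variable {S : Type*} {Ω : S × ℤ → Type*} [∀ v, MeasurableSpace (Ω v)]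
  [∀ v, DiscreteMeasurableSpace (Ω v)] [∀ v, Nontrivial (Ω v)] {G : Digraph (S × ℤ)}

namespace LinearModel

/-- The graph of the equations of the model, a subgraph of `G`. -/
def parGraph {V : Type*} {G : Digraph V} (M : LinearModel G) : Digraph V where
  Adj u v := u ∈ M.par v

variable (M : LinearModel G)

theorem parGraph_le : M.parGraph ≤ G := fun _ _ => M.adj_of_mem

theorem factor_mechanisms (ξ : ∀ v, Ω v) (v : S × ℤ) (η : ∀ v, Ω v) :
    factor (M.mechanisms Ω) ξ (fun _ => ∅) v η = noiseBit {b | M.eqn v η b = η v} := by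
  simp only [factor, Set.mem_empty_iff_false, if_false]
  exact M.mechanisms_singleton v η (η v)

theorem dependsOn_factor_mechanisms (ξ : ∀ v, Ω v) (v : S × ℤ) :
    DependsOn (factor (M.mechanisms Ω) ξ (fun _ => ∅) v)
      (insert v {u | M.parGraph.Adj u v}) := by
  intro η η' hη
  simp only [M.factor_mechanisms, hη v (Set.mem_insert v _),
    M.eqn_congr fun u hu => hη u (Set.mem_insert_of_mem v hu)]

theorem factor_mechanisms_of_par_eq_empty {ξ : ∀ v, Ω v} {v : S × ℤ} (hpar : M.par v = ∅)
    (hnoisy : v ∈ M.noisy) {η : ∀ v, Ω v} {b : ZMod 2} (hη : η v = enc (Ω v) b) :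
    factor (M.mechanisms Ω) ξ (fun _ => ∅) v η = noiseBit {b} := by
  simp only [M.factor_mechanisms, eqn, hpar, hnoisy, hη, Finset.sum_empty, if_true, zero_add,
    enc_injective.eq_iff, Set.ofPred_eq_eq_singleton]

theorem eventInd_mul_prod_factor {X W : Finset (S × ℤ)} {x : S × ℤ} (hxX : x ∈ X) (hxW : x ∈ W)
    (hX : ∀ v ∈ W, v ∈ X → v = x) (hpar : M.par x = ∅) (hnoisy : x ∈ M.noisy) {ξ : ∀ v, Ω v}
    {b : ZMod 2} (hξ : ξ x = enc (Ω x) b) (η : ∀ v, Ω v) :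
    eventInd {x} ξ η * ∏ v ∈ W, factor (M.mechanisms Ω) ξ (fun _ => ∅) v η
      = noiseBit {b} * ∏ v ∈ W, doFactor (M.mechanisms Ω) ξ X (fun _ => ∅) v η := by
  classical
  have herase : ∏ v ∈ W.erase x, doFactor (M.mechanisms Ω) ξ X (fun _ => ∅) v η
      = ∏ v ∈ W.erase x, factor (M.mechanisms Ω) ξ (fun _ => ∅) v η :=
    Finset.prod_congr rfl fun v hv => by
      obtain ⟨hne, hvW⟩ := Finset.mem_erase.1 hv
      rw [doFactor_of_notMem _ _ _ fun hvX => hne (hX v hvW hvX)]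
  rw [← Finset.mul_prod_erase _ _ hxW, ← Finset.mul_prod_erase _ _ hxW, herase, doFactor,
    if_pos hxX, eventInd_apply]
  simp only [Finset.mem_singleton, forall_eq]
  split_ifs with hηx
  · rw [M.factor_mechanisms_of_par_eq_empty hpar hnoisy (hηx.trans hξ), one_mul, one_mul]
  · rw [zero_mul, zero_mul, mul_zero]

omit [∀ v, MeasurableSpace (Ω v)] [∀ v, DiscreteMeasurableSpace (Ω v)] in
theorem config_mem_event_enc {n f : S × ℤ → ZMod 2} {F : Finset (S × ℤ)} :
    M.config n ∈ (event F fun v => enc (Ω v) (f v)) ↔ ∀ v ∈ F, M.sol n v = f v := by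
  rw [mem_event_restrict (ξ := fun v => enc (Ω v) (f v))]
  simp only [config, enc_injective.eq_iff]

omit [∀ v, MeasurableSpace (Ω v)] [∀ v, DiscreteMeasurableSpace (Ω v)] in
theorem config_mem_event_singleton {n : S × ℤ → ZMod 2} {ξ : ∀ v, Ω v} {v : S × ℤ} {b : ZMod 2}
    (hξ : ξ v = enc (Ω v) b) : M.config n ∈ (event {v} fun u => ξ u) ↔ M.sol n v = b := by
  rw [mem_event_restrict]
  simp only [Finset.mem_singleton, forall_eq, hξ, config, enc_injective.eq_iff]

theorem isAdmissible_law {X Z F : Finset (S × ℤ)} {a : S × ℤ} {f : S × ℤ → ZMod 2}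
    (hF : DependsOn M.sol (F : Set (S × ℤ))) (hX : ∀ n, n a = 1 → ∀ v ∈ X, M.sol n v = f v)
    (hZ : ∀ n, ∀ v ∈ Z, M.sol (n + 1) v = M.sol n v) :
    IsAdmissible (M.law Ω) X Z fun v => enc (Ω v) (f v) := by
  intro z hz
  rw [M.law_apply (measurableSet_event _ _)] at hz
  rw [M.law_apply ((measurableSet_event _ _).inter (measurableSet_event _ _))]
  obtain ⟨n, hn⟩ := nonempty_of_measure_ne_zero hz
  obtain ⟨n', hn', hnZ⟩ : ∃ n' : S × ℤ → ZMod 2, n' a = 1 ∧ ∀ v ∈ Z, M.sol n' v = M.sol n v := by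
    obtain h | h : n a = 1 ∨ n a + 1 = 1 := by
      generalize n a = b
      decide +revert
    · exact ⟨n, h, fun _ _ => rfl⟩
    · exact ⟨n + 1, h, hZ n⟩
  refine fun hnull => noise_setOf_forall_mem_eq_ne_zero F n' (measure_mono_null ?_ hnull)
  intro m hm
  have hsol : M.sol m = M.sol n' := hF hm
  refine ⟨M.config_mem_event_enc.2 fun v hv => ?_, fun v => ?_⟩
  · rw [hsol, hX n' hn' v hv]
  · rw [← hn v, config, config, hsol, hnZ v v.2]

variable [DecidableEq S] [∀ v, Countable (Ω v)]

theorem adjustedProb_law {X Y Z : Finset (S × ℤ)} {x : ∀ v : X, Ω v} {y : ∀ v : Y, Ω v}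
    (hx : IsAdmissible (M.law Ω) X Z x) {D : Set (∀ v, Ω v)} (hD : MeasurableSet D)
    (hDZ : DependsOn (· ∈ D) (Z : Set (S × ℤ)))
    (hYD : ∀ n, M.config n ∈ event X x → (M.config n ∈ event Y y ↔ M.config n ∈ D)) :
    adjustedProb (M.law Ω) X Y Z x y = noise (S × ℤ) {n | M.config n ∈ D} := by
  have := M.isProbabilityMeasure_law (Ω := Ω)
  have hmeas : MeasurableSet {ω | ω ∈ event X x → (ω ∈ event Y y ↔ ω ∈ D)} :=
    (measurableSet_event X x).imp ((measurableSet_event Y y).iff hD)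
  rw [← M.law_apply hD]
  exact adjustedProb_eq_measure hx hD hDZ <|
    (ae_map_iff M.measurable_config.aemeasurable hmeas).2 (ae_of_all _ hYD)

theorem isFactorSystem_factor (hG : IsAcyclic G) (ξ : ∀ v, Ω v) :
    IsFactorSystem M.parGraph (factor (M.mechanisms Ω) ξ fun _ => ∅) :=
  { SCGAdjustment.isFactorSystem_factor hG M.isMarkovKernel_mechanisms ξ fun _ => ∅ with
    dependsOn := M.dependsOn_factor_mechanisms ξ }

theorem isFactorSystem_doFactor (hG : IsAcyclic G) (ξ : ∀ v, Ω v) (X : Finset (S × ℤ)) :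
    IsFactorSystem M.parGraph (doFactor (M.mechanisms Ω) ξ X fun _ => ∅) :=
  { SCGAdjustment.isFactorSystem_doFactor hG M.isMarkovKernel_mechanisms ξ X fun _ => ∅ with
    dependsOn := fun v η η' hη => by
      unfold doFactor
      rw [M.dependsOn_factor_mechanisms ξ v hη, hη v (Set.mem_insert _ _)] }

theorem margProd_factor_eventInd_mul (hG : IsAcyclic G) {X W : Finset (S × ℤ)} {A : Set (S × ℤ)}
    (hA : IsAncestral M.parGraph A) {x : S × ℤ} (hxX : x ∈ X) (hxW : x ∈ W) (hxA : x ∈ A)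
    (hAX : ∀ v ∈ A, v ∈ X → v = x) (hpar : M.par x = ∅) (hnoisy : x ∈ M.noisy) {ξ : ∀ v, Ω v}
    {b : ZMod 2} (hξ : ξ x = enc (Ω x) b) {h : (∀ v, Ω v) → ℝ≥0∞} (hh : Measurable h)
    (hdep : DependsOn h A) (ω : ∀ v, Ω v) :
    margProd (factor (M.mechanisms Ω) ξ fun _ => ∅) W (fun η => eventInd {x} ξ η * h η) ω
      = noiseBit {b} * margProd (doFactor (M.mechanisms Ω) ξ X fun _ => ∅) W h ω := by
  classical
  have hacyclic : IsAcyclic M.parGraph := hG.mono M.parGraph_le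
  have hdepx : DependsOn (eventInd {x} ξ) A :=
    (dependsOn_eventInd {x} ξ).mono (by simpa using hxA)
  rw [(M.isFactorSystem_factor hG ξ).margProd_filter_of_isAncestral hacyclic hA
      ((measurable_eventInd {x} ξ).fun_mul hh) (dependsOn_mul hdepx hdep),
    (M.isFactorSystem_doFactor hG ξ X).margProd_filter_of_isAncestral hacyclic hA hh hdep]
  simp only [margProd, lmarginal_count, ← ENNReal.tsum_mul_left]
  refine tsum_congr fun w => ?_
  rw [mul_right_comm, M.eventInd_mul_prod_factor hxX (Finset.mem_filter.2 ⟨hxW, hxA⟩)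
    (fun v hv => hAX v (Finset.mem_filter.1 hv).2) hpar hnoisy hξ]
  ring

variable [Fintype S]

theorem doProb_eq_of_disjoint (hG : IsFTCG G) {X Y : Finset (S × ℤ)} {A : Set (S × ℤ)}
    (hA : IsAncestral M.parGraph A) (hAX : ∀ v ∈ A, v ∉ X) (hYA : ↑Y ⊆ A) (ξ υ : ∀ v, Ω v) :
    doProb (M.mechanisms Ω) (M.law Ω) X Y (fun v => ξ v) (fun v => υ v)
      = M.law Ω (event Y fun v => υ v) := by
  obtain ⟨a, b, hW⟩ := exists_subset_window (X ∪ Y)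
  obtain ⟨hX, hY⟩ := Finset.union_subset_iff.1 hW
  have hacyclic : IsAcyclic M.parGraph := hG.acyclic.mono M.parGraph_le
  rw [(M.isCompatible hG).doProb_eq_lintegral_margProd_window hG ξ υ hX hY,
    (M.isFactorSystem_doFactor hG.acyclic ξ X).margProd_congr_of_isAncestral hacyclic hacyclic
      (M.isFactorSystem_factor hG.acyclic ξ) hA hA
      (fun v hv => doFactor_of_notMem _ _ _ (hAX v hv)) (measurable_eventInd Y υ)
      ((dependsOn_eventInd Y υ).mono hYA),
    (M.isCompatible hG).lintegral_margProd_factor ξ a b (measurable_eventInd Y υ)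
      ((dependsOn_eventInd Y υ).mono fun v hv => (mem_window.1 (hY hv)).2), lintegral_eventInd]

theorem law_event_inter_event (hG : IsFTCG G) {X Y : Finset (S × ℤ)} {A : Set (S × ℤ)}
    (hA : IsAncestral M.parGraph A) {x : S × ℤ} (hxX : x ∈ X) (hxA : x ∈ A)
    (hAX : ∀ v ∈ A, v ∈ X → v = x) (hYA : ↑Y ⊆ A) (hpar : M.par x = ∅) (hnoisy : x ∈ M.noisy)
    {ξ : ∀ v, Ω v} {b : ZMod 2} (hξ : ξ x = enc (Ω x) b) (υ : ∀ v, Ω v) :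
    M.law Ω ((event {x} fun v => ξ v) ∩ event Y fun v => υ v)
      = noiseBit {b} * doProb (M.mechanisms Ω) (M.law Ω) X Y (fun v => ξ v) fun v => υ v := by
  obtain ⟨a, c, hW⟩ := exists_subset_window (X ∪ Y)
  obtain ⟨hX, hY⟩ := Finset.union_subset_iff.1 hW
  have hmeas := measurable_eventInd Y υ
  have hdep : DependsOn (fun η => eventInd {x} ξ η * eventInd Y υ η) {v | v.2 ≤ c} :=
    dependsOn_mul
      ((dependsOn_eventInd {x} ξ).mono (by simpa using (mem_window.1 (hX hxX)).2))
      ((dependsOn_eventInd Y υ).mono fun v hv => (mem_window.1 (hY hv)).2)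
  rw [(M.isCompatible hG).doProb_eq_lintegral_margProd_window hG ξ υ hX hY,
    ← lintegral_eventInd_mul_eventInd,
    ← (M.isCompatible hG).lintegral_margProd_factor ξ a c
      ((measurable_eventInd {x} ξ).fun_mul hmeas) hdep,
    ← lintegral_const_mul _
      ((M.isFactorSystem_doFactor hG.acyclic ξ X).measurable_margProd _ hmeas)]
  exact lintegral_congr fun ω => M.margProd_factor_eventInd_mul hG.acyclic hA hxX (hX hxX) hxA
    hAX hpar hnoisy hξ hmeas ((dependsOn_eventInd Y υ).mono hYA) ω

end LinearModel

end Evaluation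

/-! ### Necessity of the adjustment criterion -/

section NoiseSum

variable {V : Type*}

theorem noise_setOf_add_eq_one_le (u v : V) : noise V {n | n u + n v = 1} ≤ 1 / 2 := by
  have hsub : {n : V → ZMod 2 | n u + n v = 1} ⊆ {n | n u = 1} ∪ {n | n v = 1} := by
    intro n
    simp only [Set.mem_union, Set.mem_ofPred_eq]
    generalize n u = a
    generalize n v = b
    decide +revert
  calc noise V {n | n u + n v = 1}
      ≤ noise V {n | n u = 1} + noise V {n | n v = 1} :=
        (measure_mono hsub).trans (measure_union_le _ _)
    _ = (1 + 1) / 4 := by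
        rw [noise_setOf_eq, noise_setOf_eq, noiseBit_singleton_one, ENNReal.add_div]
    _ = 1 / 2 := by
        rw [← ENNReal.toReal_eq_toReal_iff' (by finiteness) (by finiteness)]
        norm_num

theorem one_half_le_noise_setOf_add_eq_zero (u v : V) :
    1 / 2 ≤ noise V {n | n u + n v = 0} := by
  have hcompl : {n : V → ZMod 2 | n u + n v = 1}ᶜ = {n | n u + n v = 0} := by
    ext n
    simp only [Set.mem_compl_iff, Set.mem_ofPred_eq]
    generalize n u + n v = a
    decide +revert
  have htotal := measure_univ_le_add_compl (μ := noise V) {n | n u + n v = 1}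
  rw [measure_univ, hcompl] at htotal
  rw [← ENNReal.sub_half ENNReal.one_ne_top, tsub_le_iff_left]
  exact htotal.trans (add_le_add_left (noise_setOf_add_eq_one_le u v) _)

end NoiseSum

noncomputable section CausalModel

open Relation

variable {V : Type*} {G : Digraph V} {X Y Z : Set V} {w : V}

/-- The vertices to which a directed path that avoids `X` leads from `w`. -/
def avoidingDesc (G : Digraph V) (X : Set V) (w : V) : Set V :=
  {v | ReflTransGen (AvoidingStep G X) w v}

theorem notMem_of_mem_avoidingDesc (hw : w ∉ X) {v : V} (hv : v ∈ avoidingDesc G X w) :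
    v ∉ X := by
  rcases ReflTransGen.cases_tail hv with rfl | ⟨_, _, huv⟩
  · exact hw
  · exact huv.2

theorem isDescendant_of_mem_avoidingDesc {v : V} (hv : v ∈ avoidingDesc G X w) :
    IsDescendant G w v :=
  ReflTransGen.mono (fun _ _ huv => huv.1) _ _ hv

theorem exists_parent_of_mem_avoidingDesc {v : V} (hv : v ∈ avoidingDesc G X w) (hne : v ≠ w) :
    ∃ u ∈ avoidingDesc G X w, G.Adj u v := by
  rcases ReflTransGen.cases_tail hv with rfl | ⟨u, hu, huv⟩
  · exact absurd rfl hne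
  · exact ⟨u, hu, huv.1⟩

theorem exists_mem_avoidingDesc_or_exists_reflTransGen {a z : V} (haz : IsDescendant G a z)
    (hz : z ∈ Z) (ha : a ∉ X) :
    (∃ z' ∈ Z, z' ∈ avoidingDesc G X a) ∨
      ∃ x ∈ X, ReflTransGen (OpenStep (backdoorGraph G X Y) Z) a x := by
  induction haz using ReflTransGen.head_induction_on with
  | refl => exact .inl ⟨z, hz, .refl⟩
  | @head a b hab _ ih =>
    by_cases haZ : a ∈ Z
    · exact .inl ⟨a, haZ, .refl⟩
    have hstep : OpenStep (backdoorGraph G X Y) Z a b := ⟨⟨hab, fun h => ha h.1⟩, haZ⟩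
    by_cases hb : b ∈ X
    · exact .inr ⟨b, hb, .single hstep⟩
    · rcases ih hb with ⟨z', hz', hbz'⟩ | ⟨x, hx, hbx⟩
      · exact .inl ⟨z', hz', .head ⟨hab, hb⟩ hbz'⟩
      · exact .inr ⟨x, hx, .head hstep hbx⟩

theorem reflTransGen_openStep_of_mem_avoidingDesc (hw : w ∉ X)
    (hZ : ∀ z ∈ Z, z ∉ avoidingDesc G X w) {v : V} (hv : v ∈ avoidingDesc G X w) :
    ReflTransGen (OpenStep (backdoorGraph G X Y) Z) w v := by
  induction hv with
  | refl => exact .refl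
  | tail hwb hbc ih =>
    exact ih.tail ⟨⟨hbc.1, fun h => notMem_of_mem_avoidingDesc hw hwb h.1⟩, fun h => hZ _ h hwb⟩

theorem exists_mem_avoidingDesc (hC : ¬ IsConnected (backdoorGraph G X Y) X Y Z)
    (hw : IsCausalNode G X Y w) {z : V} (hz : z ∈ Z) (hwz : IsDescendant G w z) :
    ∃ z' ∈ Z, z' ∈ avoidingDesc G X w := by
  obtain ⟨hwX, y, hy, hwy⟩ := hw
  rcases exists_mem_avoidingDesc_or_exists_reflTransGen hwz hz hwX with hZ | ⟨x, hx, hwx⟩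
  · exact hZ
  by_contra! hZ
  have hwZ : w ∉ Z := fun h => hZ w h .refl
  exact hC ⟨x, hx, y, w, .base hy, ⟨hwZ, hwx⟩,
    ⟨hwZ, reflTransGen_openStep_of_mem_avoidingDesc hwX hZ hwy⟩⟩

variable {x : V} (hx : x ∈ X) (hxw : G.Adj x w) (hw : w ∉ X)

open Classical in
/-- The model in which `x` is a noise bit, and `x` plus a second noise bit is passed on from `w` to
all vertices to which a directed path that avoids `X` leads from `w`. -/
def causalModel : LinearModel G where
  par v := if hv : v ∈ avoidingDesc G X w then
      if hne : v ≠ w then {(exists_parent_of_mem_avoidingDesc hv hne).choose} else {x}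
    else ∅
  noisy := {x, w}
  sol n v := if v ∈ avoidingDesc G X w then n x + n w else if v = x then n x else 0
  adj_of_mem := by
    intro u v hu
    split_ifs at hu with hv hne
    · rw [Finset.mem_singleton.1 hu]
      exact (exists_parent_of_mem_avoidingDesc hv hne).choose_spec.2
    · rw [Finset.mem_singleton.1 hu, not_not.1 hne]
      exact hxw
    · exact absurd hu (Finset.notMem_empty _)
  measurable_sol v := by
    split_ifs
    · fun_prop
    · exact measurable_pi_apply x
    · exact measurable_const
  sol_eq n v := by
    have hxD : x ∉ avoidingDesc G X w := fun h => notMem_of_mem_avoidingDesc hw h hx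
    by_cases hv : v ∈ avoidingDesc G X w
    · have hvx : v ≠ x := fun h => hxD (h ▸ hv)
      by_cases hne : v = w
      · subst hne
        simp [hv, hxD]
      · simp [hv, hne, hvx, (exists_parent_of_mem_avoidingDesc hv hne).choose_spec.1]
    · have hvw : v ≠ w := fun h => hv (h ▸ .refl)
      by_cases hvx : v = x <;> simp [hv, hvw, hvx, hxD]
  dependsOn_sol v := by
    intro n n' hn
    dsimp only
    split_ifs with hv hvx
    · have hwv := isDescendant_of_mem_avoidingDesc hv
      rw [hn x (.head hxw hwv), hn w hwv]
    · subst hvx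
      exact hn v .refl
    · rfl

theorem causalModel_sol_of_mem (n : V → ZMod 2) {v : V} (hv : v ∈ avoidingDesc G X w) :
    (causalModel hx hxw hw).sol n v = n x + n w :=
  if_pos hv

theorem causalModel_sol_self (n : V → ZMod 2) : (causalModel hx hxw hw).sol n x = n x :=
  (if_neg fun h => notMem_of_mem_avoidingDesc hw h hx).trans (if_pos rfl)

theorem causalModel_sol_eq_zero (n : V → ZMod 2) {v : V} (hv : v ∉ avoidingDesc G X w)
    (hvx : v ≠ x) : (causalModel hx hxw hw).sol n v = 0 :=
  (if_neg hv).trans (if_neg hvx)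

theorem dependsOn_causalModel_sol : DependsOn (causalModel hx hxw hw).sol {x, w} := by
  intro n n' hn
  ext v
  simp only [causalModel, hn x (Set.mem_insert x _), hn w (Set.mem_insert_of_mem x rfl)]

theorem causalModel_par_self : (causalModel hx hxw hw).par x = ∅ :=
  dif_neg fun h => notMem_of_mem_avoidingDesc hw h hx

theorem isAncestral_parGraph_causalModel :
    IsAncestral (causalModel hx hxw hw).parGraph (insert x (avoidingDesc G X w)) := by
  rintro u v (huv : u ∈ (causalModel hx hxw hw).par v) (rfl | hv)
  · rw [causalModel_par_self] at huv
    exact absurd huv (Finset.notMem_empty _)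
  · simp only [causalModel, hv, dite_true] at huv
    split_ifs at huv with hne
    · rw [Finset.mem_singleton.1 huv]
      exact .inr (exists_parent_of_mem_avoidingDesc hv hne).choose_spec.1
    · exact .inl (Finset.mem_singleton.1 huv)

end CausalModel

noncomputable section Necessity

variable {S : Type*} {Ω : S × ℤ → Type*} [∀ v, MeasurableSpace (Ω v)]
  [∀ v, DiscreteMeasurableSpace (Ω v)] [∀ v, Nontrivial (Ω v)] {G : Digraph (S × ℤ)}
  {X Y Z : Finset (S × ℤ)}

section CausalModel

variable [DecidableEq S] {x w : S × ℤ} (hx : x ∈ (X : Set (S × ℤ))) (hxw : G.Adj x w)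
  (hw : w ∉ (X : Set (S × ℤ)))

theorem isAdmissible_law_causalModel (hXZ : Disjoint X Z) :
    IsAdmissible ((causalModel hx hxw hw).law Ω) X Z
      fun v => enc (Ω v) ((Pi.single x 1 : S × ℤ → ZMod 2) v) := by
  refine LinearModel.isAdmissible_law (F := {x, w}) (a := x) _ ?_ (fun n hn v hv => ?_)
    fun n v hv => ?_
  · simpa using dependsOn_causalModel_sol hx hxw hw
  · by_cases hvx : v = x
    · rw [hvx, causalModel_sol_self, hn, Pi.single_eq_same]
    · rw [causalModel_sol_eq_zero hx hxw hw n (fun h => notMem_of_mem_avoidingDesc hw h hv) hvx,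
        Pi.single_eq_of_ne hvx]
  · by_cases hvD : v ∈ avoidingDesc G (X : Set (S × ℤ)) w
    · rw [causalModel_sol_of_mem _ _ _ _ hvD, causalModel_sol_of_mem _ _ _ _ hvD, Pi.add_apply,
        Pi.add_apply, Pi.one_apply, Pi.one_apply]
      linear_combination CharTwo.add_self_eq_zero (1 : ZMod 2)
    · have hvx : v ≠ x := fun h => Finset.disjoint_left.1 hXZ hx (h ▸ hv)
      rw [causalModel_sol_eq_zero _ _ _ _ hvD hvx, causalModel_sol_eq_zero _ _ _ _ hvD hvx]

theorem law_causalModel_inter {y : S × ℤ} (hyD : y ∈ avoidingDesc G (X : Set (S × ℤ)) w) :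
    (causalModel hx hxw hw).law Ω
        ((event {x} fun v => enc (Ω v) ((Pi.single x 1 : S × ℤ → ZMod 2) v))
          ∩ event {y} fun v => enc (Ω v) 1)
      = noiseBit {1} * noiseBit {0} := by
  rw [LinearModel.law_apply _ ((measurableSet_event _ _).inter (measurableSet_event _ _)),
    ← noise_setOf_eq_and_eq fun h : x = w => hw (h ▸ hx)]
  congr 1
  ext n
  rw [Set.mem_ofPred_eq, Set.mem_inter_iff,
    LinearModel.config_mem_event_singleton _
      (ξ := fun v => enc (Ω v) ((Pi.single x 1 : S × ℤ → ZMod 2) v)) (b := 1)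
      (by simp only [Pi.single_eq_same]),
    LinearModel.config_mem_event_singleton _ (ξ := fun v => enc (Ω v) 1) rfl,
    causalModel_sol_self, causalModel_sol_of_mem _ _ _ _ hyD, Set.mem_ofPred_eq]
  generalize n x = a
  generalize n w = b
  revert a b
  decide

variable [∀ v, Countable (Ω v)]

theorem adjustedProb_causalModel (hXZ : Disjoint X Z) {y z : S × ℤ} (hz : z ∈ Z)
    (hyD : y ∈ avoidingDesc G (X : Set (S × ℤ)) w)
    (hzD : z ∈ avoidingDesc G (X : Set (S × ℤ)) w) :
    adjustedProb ((causalModel hx hxw hw).law Ω) X {y} Z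
        (fun v => enc (Ω v) ((Pi.single x 1 : S × ℤ → ZMod 2) v)) (fun v => enc (Ω v) 1)
      = noise (S × ℤ) {n | n x + n w = 1} := by
  have hevent : ∀ (n : S × ℤ → ZMod 2), ∀ v ∈ avoidingDesc G (X : Set (S × ℤ)) w,
      ((causalModel hx hxw hw).config n ∈ event {v} fun v => enc (Ω v) 1) ↔ n x + n w = 1 :=
    fun n v hv => by
      rw [LinearModel.config_mem_event_singleton _ (ξ := fun v => enc (Ω v) 1) rfl,
        causalModel_sol_of_mem _ _ _ _ hv]
  rw [LinearModel.adjustedProb_law _ (isAdmissible_law_causalModel hx hxw hw hXZ)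
    (D := event {z} fun v => enc (Ω v) 1) (measurableSet_event _ _)]
  · simp only [hevent _ z hzD]
  · intro ω ω' hω
    simp only [mem_event_restrict (ξ := fun v => enc (Ω v) 1), Finset.mem_singleton, forall_eq,
      hω z hz]
  · exact fun n _ => (hevent n y hyD).trans (hevent n z hzD).symm

theorem doProb_causalModel [Fintype S] (hG : IsFTCG G) {y : S × ℤ}
    (hyD : y ∈ avoidingDesc G (X : Set (S × ℤ)) w) :
    doProb ((causalModel hx hxw hw).mechanisms Ω) ((causalModel hx hxw hw).law Ω) X {y}
        (fun v => enc (Ω v) ((Pi.single x 1 : S × ℤ → ZMod 2) v)) (fun v => enc (Ω v) 1)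
      = 3 / 4 := by
  have hlaw := LinearModel.law_event_inter_event (Ω := Ω) (X := X) (Y := {y}) (b := 1)
    (ξ := fun v => enc (Ω v) ((Pi.single x 1 : S × ℤ → ZMod 2) v)) _ hG
    (isAncestral_parGraph_causalModel hx hxw hw) hx (Set.mem_insert x _)
    (fun v hv hvX => hv.resolve_right fun h => notMem_of_mem_avoidingDesc hw h hvX)
    (by simpa using .inr hyD) (causalModel_par_self hx hxw hw) (.inl rfl)
    (by simp only [Pi.single_eq_same]) fun v => enc (Ω v) 1
  rw [law_causalModel_inter hx hxw hw hyD] at hlaw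
  rw [← noiseBit_singleton_zero]
  exact ((ENNReal.mul_right_inj (noiseBit_singleton_ne_zero 1) (measure_ne_top _ _)).1 hlaw).symm

theorem IsAdjustmentSet.avoidsForbidden [Fintype S] (hG : IsFTCG G) (hXZ : Disjoint X Z)
    (hC : ¬ IsConnected (backdoorGraph G (X : Set (S × ℤ)) Y) (X : Set (S × ℤ)) Y Z)
    (h : IsAdjustmentSet Ω G X Y Z) : AvoidsForbidden G (X : Set (S × ℤ)) Y Z := by
  intro x hx w hxw hw z hz hwz
  obtain ⟨z', hz', hzD⟩ := exists_mem_avoidingDesc hC hw hz hwz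
  obtain ⟨hwX, y, hy, hyD⟩ := hw
  have hformula := h.mono hG (Finset.singleton_subset_iff.2 hy) _ _
    ((causalModel hx hxw hwX).isCompatible hG) _ (fun v => enc (Ω v) 1)
    (isAdmissible_law_causalModel hx hxw hwX hXZ)
  rw [doProb_causalModel hx hxw hwX hG hyD,
    adjustedProb_causalModel hx hxw hwX hXZ hz' hyD hzD] at hformula
  have hle : (3 / 4 : ℝ≥0∞) ≤ 1 / 2 := hformula.trans_le (noise_setOf_add_eq_one_le x w)
  rw [← ENNReal.toReal_le_toReal (by finiteness) (by finiteness)] at hle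
  norm_num at hle

end CausalModel

namespace IsShortestChain

variable {k : ℕ} {t s : ℕ → S × ℤ} {H : Digraph (S × ℤ)}

section Law

variable (c : IsShortestChain H (X : Set (S × ℤ)) Y Z k t s) (hHG : H ≤ G)
  (hXY : Disjoint (X : Set (S × ℤ)) Y)

theorem isAdmissible_law [DecidableEq S] (hXZ : Disjoint (X : Set (S × ℤ)) Z)
    (hYZ : Disjoint (Y : Set (S × ℤ)) Z) :
    IsAdmissible ((c.linearModel hHG hXY).law Ω) X Z
      fun v => enc (Ω v) ((Pi.single (t (k + 1)) 1 : S × ℤ → ZMod 2) v) := by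
  refine LinearModel.isAdmissible_law (F := (Finset.range (k + 1)).image s) (a := s k) _
    (fun n n' hn => ?_) (fun n hn v hv => ?_) fun n v hv => c.sol_add_one hHG hXY hXZ hYZ n hv
  · exact funext fun v => c.sol_congr hHG hXY (fun i hi =>
      hn (s i) (Finset.mem_image_of_mem s (Finset.mem_range_succ_iff.2 hi))) v
  · by_cases hvt : v = t (k + 1)
    · rw [hvt, c.sol_last, hn, Pi.single_eq_same]
    · rw [c.sol_eq_zero_of_mem hHG hXY hXZ n hv hvt, Pi.single_eq_of_ne hvt]

variable [∀ v, Countable (Ω v)]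

theorem adjustedProb_law [DecidableEq S] (hXZ : Disjoint (X : Set (S × ℤ)) Z)
    (hYZ : Disjoint (Y : Set (S × ℤ)) Z) :
    adjustedProb ((c.linearModel hHG hXY).law Ω) X {t 0} Z
        (fun v => enc (Ω v) ((Pi.single (t (k + 1)) 1 : S × ℤ → ZMod 2) v))
        (fun v => enc (Ω v) 1)
      = noise (S × ℤ) {n | n (s 0) + n (s k) = 0} := by
  set M := c.linearModel hHG hXY
  have hsum : ∀ n, ∑ j ∈ Finset.range k, dec (Ω (t (j + 1))) (M.config n (t (j + 1)))
      = n (s 0) + n (s k) := fun n => by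
    simp only [LinearModel.config, dec_enc]
    exact c.sum_sol_succ hHG hXY n
  have hmeas : Measurable fun ω : ∀ v, Ω v =>
      ∑ j ∈ Finset.range k, dec (Ω (t (j + 1))) (ω (t (j + 1))) :=
    Finset.measurable_fun_sum _ fun j _ =>
      (Measurable.of_discrete (f := dec (Ω (t (j + 1))))).comp (measurable_pi_apply _)
  rw [M.adjustedProb_law (c.isAdmissible_law hHG hXY hXZ hYZ)
    (D := {ω | ∑ j ∈ Finset.range k, dec (Ω (t (j + 1))) (ω (t (j + 1))) = 0})
    (hmeas (measurableSet_singleton 0))]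
  · simp only [Set.mem_ofPred_eq, hsum]
  · intro ω ω' hω
    simp only [Set.mem_ofPred_eq]
    rw [Finset.sum_congr rfl fun j hj => by
      rw [hω (t (j + 1)) (c.mem (j + 1) (by lia) (Finset.mem_range.1 hj))]]
  · intro n hn
    have hsk : n (s k) = 1 := by
      rw [← c.sol_last hHG hXY n, M.config_mem_event_enc.1 hn _ c.last_mem, Pi.single_eq_same]
    rw [M.config_mem_event_singleton (ξ := fun v => enc (Ω v) 1) rfl, c.sol_zero,
      Set.mem_ofPred_eq, hsum, hsk]
    generalize n (s 0) = b
    decide +revert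

end Law

variable (c : IsShortestChain (backdoorGraph G (X : Set (S × ℤ)) Y) (X : Set (S × ℤ)) Y Z k t s)
  (hXY : Disjoint (X : Set (S × ℤ)) Y)

theorem doProb_law [DecidableEq S] [Fintype S] [∀ v, Countable (Ω v)] (hG : IsFTCG G)
    (ξ : ∀ v, Ω v) :
    doProb ((c.linearModel backdoorGraph_le hXY).mechanisms Ω)
        ((c.linearModel backdoorGraph_le hXY).law Ω) X {t 0} (fun v => ξ v)
        (fun v => enc (Ω v) 1)
      = 1 / 4 := by
  have hs := (c.source_mem (Nat.zero_le k) (.inl rfl)).2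
  rw [LinearModel.doProb_eq_of_disjoint _ hG
    (A := leg (OpenStep (backdoorGraph G (X : Set (S × ℤ)) Y) Z) (s 0) (t 0))
    (fun u v huv hv => c.mem_leg_of_mem_par backdoorGraph_le hXY huv hv) (fun v hv => ?_)
    (by simpa using right_mem_leg hs) ξ fun v => enc (Ω v) 1,
    LinearModel.law_apply _ (measurableSet_event _ _), ← noiseBit_singleton_one,
    ← noise_setOf_eq (s 0)]
  · congr 1
    ext n
    rw [Set.mem_ofPred_eq, LinearModel.config_mem_event_singleton _ (ξ := fun v => enc (Ω v) 1) rfl,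
      c.sol_zero, Set.mem_ofPred_eq]
  · have hvt : IsDescendant (backdoorGraph G (X : Set (S × ℤ)) Y) v (t 0) :=
      Relation.ReflTransGen.mono (fun _ _ huv => huv.1) _ _ (reflTransGen_right_of_mem_leg hs hv)
    exact (IsCausalNode.of_mem_ancestors_backdoorGraph hXY ⟨t 0, c.zero_mem, hvt⟩).1

end IsShortestChain

variable [DecidableEq S] [Fintype S] [∀ v, Countable (Ω v)]

theorem IsAdjustmentSet.not_isConnected (hG : IsFTCG G) (hXY : Disjoint X Y)
    (hXZ : Disjoint X Z) (hYZ : Disjoint Y Z) (h : IsAdjustmentSet Ω G X Y Z) :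
    ¬ IsConnected (backdoorGraph G (X : Set (S × ℤ)) Y) (X : Set (S × ℤ)) Y Z := by
  intro hC
  rw [← Finset.disjoint_coe] at hXY hXZ hYZ
  obtain ⟨k, t, s, c⟩ := hC.exists_isShortestChain
  have hformula := h.mono hG (Finset.singleton_subset_iff.2 c.zero_mem) _ _
    ((c.linearModel backdoorGraph_le hXY).isCompatible hG) _ (fun v => enc (Ω v) 1)
    (c.isAdmissible_law backdoorGraph_le hXY hXZ hYZ)
  rw [c.adjustedProb_law backdoorGraph_le hXY hXZ hYZ] at hformula
  have hle : (1 / 2 : ℝ≥0∞) ≤ 1 / 4 :=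
    (one_half_le_noise_setOf_add_eq_zero (s 0) (s k)).trans_eq <|
      hformula.symm.trans (c.doProb_law hXY hG fun v => enc (Ω v) _)
  rw [← ENNReal.toReal_le_toReal (by finiteness) (by finiteness)] at hle
  norm_num at hle

theorem IsFTCG.adjustmentCriterion_iff_isAdjustmentSet (hG : IsFTCG G) (hXY : Disjoint X Y)
    (hXZ : Disjoint X Z) (hYZ : Disjoint Y Z) :
    AdjustmentCriterion G (X : Set (S × ℤ)) Y Z ↔ IsAdjustmentSet Ω G X Y Z := by
  rw [adjustmentCriterion_iff hG.acyclic (Finset.disjoint_coe.2 hXY) (Finset.disjoint_coe.2 hXZ)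
    (Finset.disjoint_coe.2 hYZ)]
  constructor
  · rintro ⟨hF, hC⟩ κ P hP x y hx
    exact hP.doProb_eq_adjustedProb hG hXY hYZ hF hC x y hx
  · intro h
    have hC := h.not_isConnected hG hXY hXZ hYZ
    exact ⟨h.avoidsForbidden hG hXZ hC, hC⟩

end Necessity

end SCGAdjustment

open SCGAdjustment MeasureTheory in
theorem mainTheorem2 {S : Type*} [Fintype S] [DecidableEq S]
    (Ω : S × ℤ → Type*) [∀ v, MeasurableSpace (Ω v)] [∀ v, DiscreteMeasurableSpace (Ω v)]
    [∀ v, Countable (Ω v)] [∀ v, Nontrivial (Ω v)]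
    (Gs : Digraph S) (X Y Z : Finset (S × ℤ))
    (hXY : Disjoint X Y) (hXZ : Disjoint X Z) (hYZ : Disjoint Y Z) :
    CommonAdjustmentCriterion Gs (X : Set (S × ℤ)) (Y : Set (S × ℤ)) (Z : Set (S × ℤ)) ↔
      ∀ Gf ∈ candidates Gs, ∀ (κ : Mechanisms Gf Ω) (P : Measure (∀ v, Ω v)),
        IsCompatible Gf κ P →
          ∀ (x : ∀ v : X, Ω v) (y : ∀ v : Y, Ω v), IsAdmissible P X Z x →
            doProb κ P X Y x y = adjustedProb P X Y Z x y :=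
  forall₂_congr fun _ hGf => hGf.1.adjustmentCriterion_iff_isAdjustmentSet hXY hXZ hYZ
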